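/- **Setting.** Let $M$ be a complex manifold: connected, finite-dimensional, Hausdorff and second countable. Fix a (continuous) Hermitian metric $\|\cdot\|$ on the tangent bundle $TM$ and let $d$ be the distance on $M$ that it induces. Let $k_M$ be the Kobayashi pseudo-distance of $M$; $M$ is *complete hyperbolic* if $k_M$ is a distance and $(M,k_M)$ is a complete metric space. *Weak holomorphic vector fields.* For $p\in[1,\infty]$, a weak holomorphic vector field of order $p$ on $M$ is a map $G:M\times[0,+\infty)\to TM$ with $G(z,t)\in T_zM$ such that 1. for every $z\in M$ the map $t\mapsto G(z,t)$ is (Lebesgue) measurable; 2. for every $t\ge 0$ the map $z\mapsto G(z,t)$ is holomorphic; 3. for every compact $K\subset M$ and every $T>0$ there is $C_{K,T}\in L^p([0,T],\mathbb R^+)$ with $\|G(z,t)\|\le C_{K,T}(t)$ for all $z\in K$ and a.e. $t\in[0,T]$. *Herglotz vector fields.* Suppose that $k_M$ is of class $C^1$ (in the real sense) on $M\times M$ minus the diagonal. A Herglotz vector field (of order $\infty$) is a weak holomorphic vector field $G$ of order $\infty$ such that, for a.e. $t\in[0,+\infty)$, $(dk_M)_{(z,w)}(G(z,t),G(w,t))\le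 0$ for all $z\ne w$ in $M$. *Evolution families.* An evolution family (of order $\infty$) on $M$ is a family of holomorphic maps $\varphi_{s,t}:M\to M$, $0\le s\le t<+\infty$, such that $\varphi_{s,s}=\mathrm{id}_M$, $\varphi_{s,t}=\varphi_{u,t}\circ\varphi_{s,u}$ for all $0\le s\le u\le t$, and for every compact $K\subset M$ and every $T>0$ there is $c_{T,K}>0$ with $$\sup_{z\in K}d(\varphi_{s,t}(z),\varphi_{s,t'}(z))\le c_{T,K}\,|t-t'|\qquad\text{for all } s,t,t' \text{ with } 0\le s\le t,t'\le T.$$ **Theorem 1.1.** Let $M$ be complete hyperbolic and assume that $k_M$ is of class $C^1$ on $M\times M$ minus the diagonal. (a) For every Herglotz vector field $G$ on $M$ there exists a unique evolution family $(\varphi_{s,t})$ on $M$ such that for all $s\ge 0$ and all $z\in M$ $$\frac{\partial\varphi_{s,t}(z)}{\partial t}=G(\varphi_{s,t}(z),t)\qquad\text{for a.e. } t\in[s,+\infty).\tag{$*$}$$ (b) Conversely, for every evolution family $(\varphi_{s,t})$ on $M$ there exists a Herglotz vector field $G$ on $M$ such that $(*)$ holds for all $s\ge 0$ and all $z\in M$.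 Moreover, if $H$ is another weak holomorphic vector field, of any order $p\in[1,\infty]$, that satisfies $(*)$ for all $s\ge0$ and all $z\in M$, then for a.e. $t\in[0,+\infty)$ one has $G(z,t)=H(z,t)$ for all $z\in M$. -/

import Mathlib

open Set Filter Topology MeasureTheory
open scoped Manifold ContDiff ENNReal ComplexConjugate

noncomputable section

namespace Loewner

/-! ### The Kobayashi distance

Throughout, `E` is the finite-dimensional complex model space of the complex manifold `M`, and
"holomorphic" means complex (manifold-)differentiable. -/

/-- The Poincaré distance of the unit disc,
`ω(a, b) = artanh |(a - b) / (1 - conj a * b)|`, where `artanh x = ½ log ((1 + x) / (1 - x))`. -/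
def poincareDist (a b : ℂ) : ℝ :=
  Real.artanh (‖a - b‖ / ‖1 - conj a * b‖)

section Kobayashi

variable (E : Type*) [NormedAddCommGroup E] [NormedSpace ℂ E]
  {M : Type*} [TopologicalSpace M] [ChartedSpace E M]

/-- Infimum of `ω(a, b)` over all holomorphic discs `f : 𝔻 → M` and points `a, b ∈ 𝔻` with
`f a = z` and `f b = w` (it is `∞` if there are none). -/
def discEDist (z w : M) : ℝ≥0∞ :=
  ⨅ (f : ℂ → M) (a : ℂ) (b : ℂ)
    (_ : MDifferentiableOn 𝓘(ℂ, ℂ) 𝓘(ℂ, E) f (Metric.ball 0 1) ∧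
      a ∈ Metric.ball (0 : ℂ) 1 ∧ b ∈ Metric.ball (0 : ℂ) 1 ∧ f a = z ∧ f b = w),
    ENNReal.ofReal (poincareDist a b)

/-- The Kobayashi (pseudo-)distance with values in `[0, ∞]`: infimum of the lengths of all chains
of holomorphic discs from `z` to `w`. -/
def kobayashiEDist (z w : M) : ℝ≥0∞ :=
  ⨅ (m : ℕ) (p : ℕ → M) (_ : p 0 = z ∧ p m = w),
    ∑ i ∈ Finset.range m, discEDist E (p i) (p (i + 1))

/-- The Kobayashi (pseudo-)distance `k_M`. On a connected manifold `kobayashiEDist` is finite, so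
that nothing is lost here. -/
def kobayashiDist (z w : M) : ℝ := (kobayashiEDist E z w).toReal

variable (M) in
/-- `M` is complete hyperbolic: `k_M` is a distance, and it is Cauchy complete. -/
structure IsCompleteHyperbolic : Prop where
  eq_of_dist_eq_zero : ∀ z w : M, kobayashiDist E z w = 0 → z = w
  complete : ∀ u : ℕ → M,
    (∀ ε > 0, ∃ N, ∀ m ≥ N, ∀ n ≥ N, kobayashiDist E (u m) (u n) < ε) →
    ∃ x : M, Tendsto (fun n => kobayashiDist E (u n) x) atTop (𝓝 0)

variable (M) in
/-- `k_M` is of class `C¹`, in the real sense, on `M × M` minus the diagonal. -/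
def KobayashiDistC1 : Prop :=
  ContMDiffOn (𝓘(ℝ, E).prod 𝓘(ℝ, E)) 𝓘(ℝ, ℝ) 1
    (fun p : M × M => kobayashiDist E p.1 p.2) {p | p.1 ≠ p.2}

/-- The real tangent vector underlying a complex tangent vector: in Mathlib both tangent spaces
at `z` are the model space `E`, read in the same preferred chart at `z`. -/
def realVec {z : M} (v : TangentSpace 𝓘(ℂ, E) z) : TangentSpace 𝓘(ℝ, E) z := v

/-- The (real) differential of `k_M` at `(z, w)`, evaluated at the pair `(u, v)` of tangent
vectors `u ∈ T_z M`, `v ∈ T_w M`. -/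
def kobayashiDifferential {z w : M} (u : TangentSpace 𝓘(ℂ, E) z)
    (v : TangentSpace 𝓘(ℂ, E) w) : ℝ :=
  mfderiv (𝓘(ℝ, E).prod 𝓘(ℝ, E)) 𝓘(ℝ, ℝ)
    (fun p : M × M => kobayashiDist E p.1 p.2) (z, w) (realVec E u, realVec E v)

end Kobayashi

/-! ### Hermitian metrics, vector fields and evolution families -/

section Loewner

variable (E : Type*) [NormedAddCommGroup E] [NormedSpace ℂ E]
  (M : Type*) [TopologicalSpace M] [ChartedSpace E M] [IsManifold 𝓘(ℂ, E) ω M]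

/-- A (continuous) Hermitian metric along the fibres of the holomorphic tangent bundle of `M`.
By polarization, continuity of the metric amounts to continuity of `v ↦ ‖v‖²` on the total space
of the tangent bundle. Smooth Hermitian metrics are a special case. -/
structure HermitianMetric where
  inner : ∀ z : M, TangentSpace 𝓘(ℂ, E) z →ₗ⋆[ℂ] TangentSpace 𝓘(ℂ, E) z →ₗ[ℂ] ℂ
  conj_symm : ∀ (z : M) (u v : TangentSpace 𝓘(ℂ, E) z), conj (inner z u v) = inner z v u
  pos : ∀ (z : M) (v : TangentSpace 𝓘(ℂ, E) z), v ≠ 0 → 0 < (inner z v v).re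
  continuous : Continuous fun v : TangentBundle 𝓘(ℂ, E) M => (inner v.proj v.snd v.snd).re

variable {E M}

namespace HermitianMetric

variable (h : HermitianMetric E M)

/-- The norm `‖v‖` of a tangent vector. -/
def norm (z : M) (v : TangentSpace 𝓘(ℂ, E) z) : ℝ := √ (h.inner z v v).re

/-- The distance `d(z, w)` on `M` induced by the metric: the infimum of the lengths of `C¹` paths
from `z` to `w`. It is finite when `M` is connected. -/
def edist (z w : M) : ℝ≥0∞ :=
  letI : ∀ x : M, ENorm (TangentSpace 𝓘(ℝ, E) x) :=
    fun x => ⟨fun v => ENNReal.ofReal (h.norm x v)⟩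
  Manifold.riemannianEDist 𝓘(ℝ, E) z w

end HermitianMetric

/-- `G(z, t)`, `z ∈ M`, `t ≥ 0`, is a weak holomorphic vector field of order `d ∈ [1, ∞]`. Only
the values at times `t ≥ 0` matter. Measurability is Lebesgue measurability on `[0, ∞)`. -/
structure IsWeakHolomorphicVectorField (h : HermitianMetric E M) (d : ℝ≥0∞)
    (G : ∀ z : M, ℝ → TangentSpace 𝓘(ℂ, E) z) : Prop where
  measurable : ∀ z : M, AEStronglyMeasurable (fun t => G z t) (volume.restrict (Ici 0))
  holomorphic : ∀ t : ℝ, 0 ≤ t →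
    MDifferentiable 𝓘(ℂ, E) 𝓘(ℂ, E).tangent fun z : M => (⟨z, G z t⟩ : TangentBundle 𝓘(ℂ, E) M)
  bound : ∀ K : Set M, IsCompact K → ∀ T : ℝ, 0 < T → ∃ C : ℝ → ℝ,
    (∀ t, 0 ≤ C t) ∧ MemLp C d (volume.restrict (Icc 0 T)) ∧
      ∀ᵐ t ∂(volume.restrict (Icc 0 T)), ∀ z ∈ K, h.norm z (G z t) ≤ C t

/-- `G` is a Herglotz vector field: a weak holomorphic vector field of order `∞` such that
`(dk_M)_{(z, w)}(G(z, t), G(w, t)) ≤ 0` for a.e. `t ≥ 0` and all `z ≠ w`. -/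
structure IsHerglotzVectorField (h : HermitianMetric E M)
    (G : ∀ z : M, ℝ → TangentSpace 𝓘(ℂ, E) z) : Prop where
  weak : IsWeakHolomorphicVectorField h ∞ G
  dissipative : ∀ᵐ t ∂(volume.restrict (Ici (0 : ℝ))), ∀ z w : M, z ≠ w →
    kobayashiDifferential E (G z t) (G w t) ≤ 0

/-- `φ s t`, `0 ≤ s ≤ t`, is an evolution family (of order `∞`) on `M`. Only the values at times
`0 ≤ s ≤ t` matter. -/
structure IsEvolutionFamily (h : HermitianMetric E M) (φ : ℝ → ℝ → M → M) : Prop where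
  refl : ∀ s, 0 ≤ s → φ s s = id
  comp : ∀ s u t, 0 ≤ s → s ≤ u → u ≤ t → φ s t = φ u t ∘ φ s u
  holomorphic : ∀ s t, 0 ≤ s → s ≤ t → MDifferentiable 𝓘(ℂ, E) 𝓘(ℂ, E) (φ s t)
  lipschitz : ∀ K : Set M, IsCompact K → ∀ T : ℝ, 0 < T → ∃ c : ℝ, 0 < c ∧
    ∀ s t t', 0 ≤ s → s ≤ t → s ≤ t' → t ≤ T → t' ≤ T → ∀ z ∈ K,
      h.edist (φ s t z) (φ s t' z) ≤ ENNReal.ofReal (c * |t - t'|)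

/-- `φ` is generated by `G`: for all `s ≥ 0` and `z ∈ M`, for a.e. `t ∈ [s, ∞)` the curve
`t ↦ φ s t z` is differentiable at `t`, with velocity `G (φ s t z) t`. -/
def IsGeneratedBy (φ : ℝ → ℝ → M → M) (G : ∀ z : M, ℝ → TangentSpace 𝓘(ℂ, E) z) : Prop :=
  ∀ s : ℝ, 0 ≤ s → ∀ z : M, ∀ᵐ t ∂(volume.restrict (Ici s)),
    HasMFDerivAt 𝓘(ℝ, ℝ) 𝓘(ℝ, E) (fun τ => φ s τ z) t
      ((1 : ℝ →L[ℝ] ℝ).smulRight (realVec E (G (φ s t z) t)))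

end Loewner

end Loewner

end

/-! Both directions rest on one fact: holomorphic self-maps do not increase `k_M`, and the Herglotz
condition is the infinitesimal form of this contraction.

From fields to families. In a chart a bounded holomorphic field is Lipschitz in space by Cauchy's
estimate, so Picard iteration yields local solutions that depend holomorphically on the initial
value (`IsBoundedField.exists_flow`, `exists_isFlowOn_nhds`). Along two trajectories of a Herglotz
field `k_M` is a Lipschitz function of time with a.e. nonpositive derivative, hence nonincreasing
(`IsTrajectory.dist_le`). This gives uniqueness, and it also rules out explosion. Closed `k_M`-balls
are compact: `k_M` induces the topology of `M` (Barth, `exists_kobayashiDist_lt_imp_mem`), it has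
almost intermediate points because chains of discs can be cut anywhere, and a complete locally
compact space with that property is proper (Hopf-Rinow, `properSpace_of_intermediate`). One base
point has a lifetime `δ` that is uniform for bounded initial times. During that time every other
trajectory keeps a bounded distance from the trajectory of the base point, so it stays in a compact
ball, where local lifetimes are uniform, and it therefore lives for the time `δ` as well
(`exists_isFlowOn_univ_of_le`). Iteration gives the global flow, and the same compactness gives the
Lipschitz estimate of an evolution family.

From families to fields. Each orbit is Lipschitz, hence differentiable a.e., but the exceptional
null set depends on the orbit. Only the countably many orbits with rational initial time and initial
point in a countable dense set are used: for a.e. `t` all of them that have started by time `t` are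
differentiable at `t`, and the points they have reached are dense (`dense_reachable`). At such a
point the right difference quotients of `φ t τ` at `τ = t` converge. These quotients are locally
bounded holomorphic maps, so by a Vitali argument they converge everywhere
(`exists_tendsto_of_dense`, `isRegularTime`), and the limit field is holomorphic
(`differentiableAt_of_tendsto_of_bounded`). Contraction of `k_M` by `φ t τ` passes to the limit and
becomes the Herglotz inequality. Uniqueness of the field uses the same dense set of reached points.
-/

noncomputable section

namespace Loewner

/-! ### Cauchy estimates and limits of bounded families of holomorphic maps -/

section Holomorphic

variable {E F : Type*} [NormedAddCommGroup E] [NormedSpace ℂ E]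
  [NormedAddCommGroup F] [NormedSpace ℂ F]

/-- Cauchy's estimate in Lipschitz form. -/
theorem norm_sub_le_of_norm_le {f : E → F} {U : Set E} {C r : ℝ} {z w : E} (hr : 0 < r)
    (hU : Metric.ball z r ⊆ U) (hd : DifferentiableOn ℂ f U) (hC : ∀ y ∈ U, ‖f y‖ ≤ C)
    (hw : w ∈ U) : ‖f w - f z‖ ≤ 2 * C / r * ‖w - z‖ := by
  have hz : z ∈ U := hU (Metric.mem_ball_self hr)
  have h2 : ∀ y ∈ U, ‖f y - f z‖ ≤ 2 * C := fun y hy => by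
    linarith [norm_sub_le (f y) (f z), hC y hy, hC z hz]
  by_cases hwz : w ∈ Metric.ball z r
  · rw [← dist_eq_norm, ← dist_eq_norm]
    refine Complex.dist_le_div_mul_dist_of_mapsTo_ball (hd.mono hU) (fun y hy => ?_) hwz
    rw [Metric.mem_closedBall, dist_eq_norm]
    exact h2 y (hU hy)
  -- Outside the ball the trivial bound `2 * C` suffices, because there `‖w - z‖ ≥ r`.
  · rw [Metric.mem_ball, not_lt, dist_eq_norm] at hwz
    have h0 : 0 ≤ C := (norm_nonneg _).trans (hC z hz)
    calc ‖f w - f z‖ ≤ 2 * C := h2 w hw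
      _ = 2 * C / r * r := by field_simp
      _ ≤ _ := by gcongr

/-- Cauchy's estimate for the derivative. -/
theorem norm_fderiv_le_of_norm_le {f : E → F} {C r : ℝ} {z : E} (hr : 0 < r)
    (hd : DifferentiableOn ℂ f (Metric.ball z r)) (hC : ∀ y ∈ Metric.ball z r, ‖f y‖ ≤ C) :
    ‖fderiv ℂ f z‖ ≤ 2 * C / r := by
  refine Complex.norm_fderiv_le_div_of_mapsTo_ball hd (fun y hy => ?_) hr
  rw [Metric.mem_closedBall, dist_eq_norm]
  linarith [norm_sub_le (f y) (f z), hC y hy, hC z (Metric.mem_ball_self hr)]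

variable [CompleteSpace F]

/-- A bounded pointwise limit of holomorphic maps is holomorphic. -/
theorem differentiableAt_of_tendsto_of_bounded [FiniteDimensional ℂ E] {f : ℕ → E → F}
    {g : E → F} {y₀ : E} {R C : ℝ} (hR : 0 < R)
    (hd : ∀ n, DifferentiableOn ℂ (f n) (Metric.ball y₀ R))
    (hC : ∀ n, ∀ y ∈ Metric.ball y₀ R, ‖f n y‖ ≤ C)
    (hf : ∀ y ∈ Metric.ball y₀ R, Tendsto (fun n => f n y) atTop (𝓝 (g y))) :
    DifferentiableAt ℂ g y₀ := by
  have : ProperSpace E := FiniteDimensional.proper ℂ E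
  have hC0 : 0 ≤ C := (norm_nonneg _).trans (hC 0 y₀ (Metric.mem_ball_self hR))
  have hLip : ∀ n, ∀ z ∈ Metric.closedBall y₀ (R / 2), ∀ w ∈ Metric.closedBall y₀ (R / 2),
      ‖f n w - f n z‖ ≤ 2 * C / (R / 2) * ‖w - z‖ := fun n z hz w hw => by
    refine norm_sub_le_of_norm_le (by positivity) (Metric.ball_subset_ball' ?_) (hd n) (hC n) ?_
    · linarith [Metric.mem_closedBall.1 hz]
    · exact Metric.closedBall_subset_ball (by linarith) hw
  set L := 2 * C / (R / 2) with hL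
  have hL0 : 0 ≤ L := by positivity
  -- uniform Cauchy property on the half ball
  have hU : ∀ ε > 0, ∃ N, ∀ m ≥ N, ∀ n ≥ N, ∀ z ∈ Metric.closedBall y₀ (R / 2),
      ‖f m z - f n z‖ ≤ ε := by
    intro ε hε
    -- The common Lipschitz constant `L` turns pointwise convergence on a finite net into a uniform
    -- Cauchy property. The mesh uses `L + 1` since `L` may vanish.
    obtain ⟨t, htK, htf, ht⟩ := (isCompact_closedBall y₀ (R / 2)).totallyBounded.exists_subset
      (Metric.dist_mem_uniformity (show 0 < ε / (4 * (L + 1)) by positivity))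
    have h1 : ∀ᶠ N in atTop, ∀ y ∈ t, ‖f N y - g y‖ < ε / 4 := by
      refine (htf.eventually_all).2 fun y hy => ?_
      have := hf y (Metric.closedBall_subset_ball (by linarith) (htK hy))
      filter_upwards [Metric.tendsto_nhds.1 this (ε / 4) (by positivity)] with n hn
      rwa [dist_eq_norm] at hn
    obtain ⟨N, hN⟩ := eventually_atTop.1 h1
    refine ⟨N, fun m hm n hn z hz => ?_⟩
    obtain ⟨y, hy, hyz⟩ := mem_iUnion₂.1 (ht hz)
    have hyz : dist z y < ε / (4 * (L + 1)) := hyz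
    rw [dist_eq_norm] at hyz
    have h2 : L * ‖z - y‖ ≤ ε / 4 := by
      calc L * ‖z - y‖ ≤ (L + 1) * (ε / (4 * (L + 1))) := by gcongr; linarith
        _ = ε / 4 := by field_simp
    have h3 := hLip m y (htK hy) z hz
    have h4 := hLip n y (htK hy) z hz
    have h5 := hN m hm y hy
    have h6 := hN n hn y hy
    have h7 : f m z - f n z = (f m z - f m y) + (f m y - g y) - (f n y - g y) - (f n z - f n y) := by
      abel
    rw [h7]
    linarith [norm_sub_le ((f m z - f m y) + (f m y - g y) - (f n y - g y)) (f n z - f n y),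
      norm_sub_le ((f m z - f m y) + (f m y - g y)) (f n y - g y),
      norm_add_le (f m z - f m y) (f m y - g y)]
  -- uniform Cauchy property of the derivatives
  have hda : ∀ n, ∀ z ∈ Metric.ball y₀ (R / 4), DifferentiableAt ℂ (f n) z := fun n z hz =>
    (hd n).differentiableAt
      (Metric.isOpen_ball.mem_nhds (Metric.ball_subset_ball (by linarith) hz))
  have hU' : UniformCauchySeqOn (fun n => fderiv ℂ (f n)) atTop (Metric.ball y₀ (R / 4)) := by
    rw [Metric.uniformCauchySeqOn_iff]
    intro ε hε
    -- Cauchy's estimate on balls of radius `R / 4` turns this bound into `ε / 2` for the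
    -- derivatives.
    obtain ⟨N, hN⟩ := hU (ε * R / 16) (by positivity)
    refine ⟨N, fun m hm n hn z hz => ?_⟩
    have hsub : Metric.ball z (R / 4) ⊆ Metric.ball y₀ (R / 2) :=
      Metric.ball_subset_ball' (by linarith [Metric.mem_ball.1 hz])
    have hd' : ∀ n, DifferentiableOn ℂ (f n) (Metric.ball z (R / 4)) := fun n =>
      (hd n).mono (hsub.trans (Metric.ball_subset_ball (by linarith)))
    rw [dist_eq_norm, ← fderiv_sub (hda m z hz) (hda n z hz)]
    have := norm_fderiv_le_of_norm_le (f := f m - f n) (show 0 < R / 4 by positivity)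
      ((hd' m).sub (hd' n)) (fun y hy => hN m hm n hn y (Metric.ball_subset_closedBall (hsub hy)))
    refine this.trans_lt ?_
    rw [div_lt_iff₀ (by positivity)]
    nlinarith [mul_pos hε hR]
  have hlim : ∀ z ∈ Metric.ball y₀ (R / 4), ∃ A, Tendsto (fun n => fderiv ℂ (f n) z) atTop (𝓝 A) :=
    fun z hz => cauchySeq_tendsto_of_complete (hU'.cauchySeq hz)
  choose! A hA using hlim
  have := hasFDerivAt_of_tendstoUniformlyOn (𝕜 := ℂ) Metric.isOpen_ball
    (hU'.tendstoUniformlyOn_of_tendsto hA)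
    (fun n z hz => (hda n z hz).hasFDerivAt)
    (fun z hz => hf z (Metric.ball_subset_ball (by linarith) hz))
    (Metric.mem_ball_self (show 0 < R / 4 by positivity))
  exact this.differentiableAt

/-- A family of uniformly bounded holomorphic maps that converges on a dense subset of a ball
converges at the center. -/
theorem exists_tendsto_of_dense {ι : Type*} {l : Filter ι} [l.NeBot] {f : ι → E → F} {y₀ : E}
    {R C : ℝ} (hR : 0 < R) (S : Set E) (hS : y₀ ∈ closure S)
    (hd : ∀ᶠ n in l, DifferentiableOn ℂ (f n) (Metric.ball y₀ R))
    (hC : ∀ᶠ n in l, ∀ y ∈ Metric.ball y₀ R, ‖f n y‖ ≤ C)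
    (hf : ∀ y ∈ S, ∃ v, Tendsto (fun n => f n y) l (𝓝 v)) :
    ∃ v, Tendsto (fun n => f n y₀) l (𝓝 v) := by
  have hC0 : 0 ≤ C := by
    obtain ⟨n, hn⟩ := hC.exists
    exact (norm_nonneg _).trans (hn y₀ (Metric.mem_ball_self hR))
  set L := 2 * C / R with hL
  have hL0 : 0 ≤ L := by positivity
  have hLip : ∀ᶠ n in l, ∀ w ∈ Metric.ball y₀ R, ‖f n w - f n y₀‖ ≤ L * ‖w - y₀‖ := by
    filter_upwards [hd, hC] with n hn hn' w hw
    exact norm_sub_le_of_norm_le hR Subset.rfl hn hn' hw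
  refine cauchy_map_iff_exists_tendsto.1 (Metric.cauchy_iff.2 ⟨inferInstance, fun ε hε => ?_⟩)
  obtain ⟨y, hyS, hy⟩ := Metric.mem_closure_iff.1 hS (min R (ε / (4 * (L + 1))))
    (lt_min hR (by positivity))
  obtain ⟨v, hv⟩ := hf y hyS
  have hyR : y ∈ Metric.ball y₀ R := by
    rw [Metric.mem_ball']; exact hy.trans_le (min_le_left _ _)
  have h2 : L * ‖y - y₀‖ ≤ ε / 4 := by
    have : ‖y - y₀‖ ≤ ε / (4 * (L + 1)) := by
      rw [← dist_eq_norm, dist_comm]; exact hy.le.trans (min_le_right _ _)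
    calc L * ‖y - y₀‖ ≤ (L + 1) * (ε / (4 * (L + 1))) := by gcongr; linarith
      _ = ε / 4 := by field_simp
  refine ⟨Metric.ball v (ε / 2), ?_, fun a ha b hb => ?_⟩
  · rw [Filter.mem_map]
    filter_upwards [hLip, Metric.tendsto_nhds.1 hv (ε / 4) (by positivity)] with n hn hn'
    rw [mem_preimage, Metric.mem_ball]
    calc dist (f n y₀) v ≤ dist (f n y₀) (f n y) + dist (f n y) v := dist_triangle _ _ _
      _ < ε / 4 + ε / 4 := by
        refine add_lt_add_of_le_of_lt ?_ hn'
        rw [dist_comm, dist_eq_norm]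
        exact (hn y hyR).trans h2
      _ = ε / 2 := by ring
  · linarith [dist_triangle_right a b v, Metric.mem_ball.1 ha, Metric.mem_ball.1 hb]

end Holomorphic

/-! ### Integrals of holomorphic maps depending on a parameter -/

section Integrals

variable {E F : Type*} [NormedAddCommGroup E] [NormedSpace ℂ E] [FiniteDimensional ℂ E]
  [NormedAddCommGroup F] [NormedSpace ℂ F] {α : Type*} [MeasurableSpace α] {μ : Measure α}

/-- Each directional derivative is a limit of a sequence of measurable difference quotients, and in
finite dimension the derivative is a finite combination of directional derivatives along a basis. -/
theorem aestronglyMeasurable_fderiv_of_bounded {f : E → α → F} {U : Set E} {y₀ : E}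
    (hU : U ∈ 𝓝 y₀)
    (hd : ∀ᵐ a ∂μ, DifferentiableAt ℂ (f · a) y₀)
    (hm : ∀ y ∈ U, AEStronglyMeasurable (f y) μ) :
    AEStronglyMeasurable (fun a => fderiv ℂ (f · a) y₀) μ := by
  have key : ∀ v : E, AEStronglyMeasurable (fun a => fderiv ℂ (f · a) y₀ v) μ := by
    intro v
    have hc : Tendsto (fun n : ℕ => y₀ + ((1 : ℂ) / ((n : ℂ) + 1)) • v) atTop (𝓝 y₀) := by
      have := (tendsto_one_div_add_atTop_nhds_zero_nat (𝕜 := ℂ)).smul_const v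
      simpa using tendsto_const_nhds.add this
    obtain ⟨N, hN⟩ := eventually_atTop.1 (hc hU)
    -- The shift by `N` puts every sample point into `U`, so that each single quotient is
    -- measurable.
    refine aestronglyMeasurable_of_tendsto_ae atTop
      (f := fun n a => ((((n + N : ℕ) : ℂ) + 1)) •
        (f (y₀ + ((1 : ℂ) / (((n + N : ℕ) : ℂ) + 1)) • v) a - f y₀ a)) (fun n => ?_) ?_
    · exact ((hm _ (hN (n + N) (by omega))).sub (hm _ (mem_of_mem_nhds hU))).const_smul _
    · filter_upwards [hd] with a ha
      have h1 := ha.hasFDerivAt.hasLineDerivAt v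
      have h2 := (h1.tendsto_slope_zero).comp (tendsto_nhdsWithin_iff.2
        ⟨(tendsto_one_div_add_atTop_nhds_zero_nat (𝕜 := ℂ)).comp (tendsto_add_atTop_nat N),
          Eventually.of_forall fun n => by
            have : (((n + N : ℕ) : ℂ) + 1) ≠ 0 := by exact_mod_cast Nat.succ_ne_zero (n + N)
            simpa using this⟩)
      refine h2.congr fun n => ?_
      simp
  let b := Module.finBasis ℂ E
  have hsum : (fun a => fderiv ℂ (f · a) y₀) = fun a => ∑ i,
      (LinearMap.toContinuousLinearMap (b.coord i)).smulRight (fderiv ℂ (f · a) y₀ (b i)) := by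
    funext a
    ext v
    conv_lhs => rw [← b.sum_repr v]
    simp only [map_sum, map_smul, sum_apply,
      ContinuousLinearMap.smulRight_apply, LinearMap.coe_toContinuousLinearMap',
      Module.Basis.coord_apply]
  rw [hsum]
  refine Finset.aestronglyMeasurable_fun_sum _ fun i _ => ?_
  exact ((ContinuousLinearMap.smulRightL ℂ E F
    (LinearMap.toContinuousLinearMap (b.coord i))).continuous).comp_aestronglyMeasurable (key _)

/-- An integral of uniformly bounded holomorphic maps is holomorphic. -/
theorem differentiableAt_integral_of_bounded [NormedSpace ℝ F] [CompleteSpace F]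
    [IsScalarTower ℝ ℂ F] [IsFiniteMeasure μ]
    {f : E → α → F} {y₀ : E} {R C : ℝ} (hR : 0 < R)
    (hd : ∀ᵐ a ∂μ, DifferentiableOn ℂ (f · a) (Metric.ball y₀ R))
    (hm : ∀ y ∈ Metric.ball y₀ R, AEStronglyMeasurable (f y) μ)
    (hC : ∀ᵐ a ∂μ, ∀ y ∈ Metric.ball y₀ R, ‖f y a‖ ≤ C) :
    DifferentiableAt ℂ (fun y => ∫ a, f y a ∂μ) y₀ := by
  have hda : ∀ᵐ a ∂μ, ∀ y ∈ Metric.ball y₀ R, DifferentiableAt ℂ (f · a) y := by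
    filter_upwards [hd] with a ha y hy
    exact ha.differentiableAt (Metric.isOpen_ball.mem_nhds hy)
  -- Differentiation under the integral sign; the dominating constant is Cauchy's estimate on balls
  -- of radius `R / 2` centred in the half ball.
  have := hasFDerivAt_integral_of_dominated_of_fderiv_le (𝕜 := ℂ) (μ := μ) (F := f)
    (F' := fun y a => fderiv ℂ (f · a) y) (x₀ := y₀) (bound := fun _ => 2 * C / (R / 2))
    (s := Metric.ball y₀ (R / 2)) (Metric.ball_mem_nhds _ (by positivity))
    (by filter_upwards [Metric.ball_mem_nhds y₀ hR] with y hy using hm y hy)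
    ((integrable_const C).mono' (hm y₀ (Metric.mem_ball_self hR))
      (by filter_upwards [hC] with a ha using ha y₀ (Metric.mem_ball_self hR)))
    (aestronglyMeasurable_fderiv_of_bounded (Metric.ball_mem_nhds y₀ hR)
      (by filter_upwards [hda] with a ha using ha y₀ (Metric.mem_ball_self hR)) hm)
    (by
      filter_upwards [hd, hC] with a ha ha' y hy
      have hsub : Metric.ball y (R / 2) ⊆ Metric.ball y₀ R :=
        Metric.ball_subset_ball' (by linarith [Metric.mem_ball.1 hy])
      exact norm_fderiv_le_of_norm_le (by positivity) (ha.mono hsub) fun z hz => ha' z (hsub hz))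
    (integrable_const _)
    (by
      filter_upwards [hda] with a ha y hy
      exact (ha y (Metric.ball_subset_ball (by linarith) hy)).hasFDerivAt)
  exact this.differentiableAt

end Integrals

/-! ### Measurability of superpositions and monotonicity of Lipschitz functions -/

section Superposition

variable {E F : Type*} [NormedAddCommGroup E] [NormedAddCommGroup F]

/-- Superposition of a Carathéodory map with a continuous curve is measurable. -/
theorem aestronglyMeasurable_comp_curve [SecondCountableTopology E] {g : E → ℝ → F} {U : Set E}
    {μ : Measure ℝ}
    (hc : ∀ᵐ t ∂μ, ContinuousOn (g · t) U)
    (hm : ∀ y ∈ U, AEStronglyMeasurable (g y) μ)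
    {x : ℝ → E} (hx : Continuous x) (hxU : ∀ t, x t ∈ U) :
    AEStronglyMeasurable (fun t => g (x t) t) μ := by
  borelize E
  have hxm : Measurable x := hx.measurable
  -- Along a simple function with values in `U` the superposition is a finite sum of the measurable
  -- functions `g v` cut off to level sets. Continuity in space then allows passing to the limit.
  let a : ℕ → SimpleFunc ℝ E := fun n => SimpleFunc.approxOn x hxm U (x 0) (hxU 0) n
  have haU : ∀ n t, a n t ∈ U := fun n t => SimpleFunc.approxOn_mem hxm (hxU 0) n t
  refine aestronglyMeasurable_of_tendsto_ae atTop (f := fun n t => g (a n t) t) (fun n => ?_) ?_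
  · classical
    have h1 : (fun t => g (a n t) t) = fun t => ∑ v ∈ (a n).range,
        ((a n) ⁻¹' {v}).indicator (g v) t := by
      funext t
      rw [Finset.sum_eq_single (a n t)]
      · simp
      · intro v _ hv
        exact indicator_of_notMem (fun h => hv h.symm) _
      · intro h
        exact absurd ((a n).mem_range_self t) h
    rw [h1]
    refine Finset.aestronglyMeasurable_fun_sum _ fun v hv => ?_
    obtain ⟨t, rfl⟩ := SimpleFunc.mem_range.1 hv
    exact (hm _ (haU n t)).indicator ((a n).measurableSet_fiber _)
  · filter_upwards [hc] with t ht
    have h1 : Tendsto (fun n => a n t) atTop (𝓝[U] (x t)) :=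
      tendsto_nhdsWithin_iff.2 ⟨SimpleFunc.tendsto_approxOn hxm (hxU 0)
        (subset_closure (hxU t)), Eventually.of_forall fun n => haU n t⟩
    exact (ht (x t) (hxU t)).tendsto.comp h1

/-- A Lipschitz real function whose derivative is a.e. nonpositive is nonincreasing. -/
theorem le_of_lipschitzOnWith_of_deriv_nonpos {f : ℝ → ℝ} {a b : ℝ} {K : NNReal} (hab : a ≤ b)
    (hf : LipschitzOnWith K f (Icc a b)) (h : ∀ᵐ t, t ∈ Ioo a b → deriv f t ≤ 0) : f b ≤ f a := by
  have h1 := (LipschitzOnWith.absolutelyContinuousOnInterval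
    (by rwa [uIcc_of_le hab] : LipschitzOnWith K f (uIcc a b))).integral_deriv_eq_sub
  have h2 : ∫ t in a..b, deriv f t ≤ 0 := by
    rw [intervalIntegral.integral_of_le hab, integral_Ioc_eq_integral_Ioo]
    exact integral_nonpos_of_ae ((ae_restrict_iff' measurableSet_Ioo).2 h)
  linarith

end Superposition

/-! ### Picard iteration for bounded holomorphic fields measurable in time -/

section Caratheodory

variable {E : Type*} [NormedAddCommGroup E] [NormedSpace ℂ E]

/-- A time dependent vector field on the interval `[s, e]`, holomorphic and bounded by `C` on
the ball of radius `2 * R` around `y₀`, and measurable in time. -/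
structure IsBoundedField (g : E → ℝ → E) (y₀ : E) (R C s e : ℝ) : Prop where
  radius_pos : 0 < R
  holomorphic : ∀ t ∈ Icc s e, DifferentiableOn ℂ (g · t) (Metric.ball y₀ (2 * R))
  measurable : ∀ y ∈ Metric.ball y₀ (2 * R),
    AEStronglyMeasurable (g y) (volume.restrict (Icc s e))
  bound : ∀ t ∈ Icc s e, ∀ y ∈ Metric.ball y₀ (2 * R), ‖g y t‖ ≤ C
  le : s ≤ e
  -- This keeps curves started within `R / 2` of `y₀` inside the ball of radius `R`, and makes the
  -- Picard operator contract by `1 / 2`. Holomorphy on radius `2 * R` leaves room for Cauchy's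
  -- estimate with radius `R` around points of these curves.
  short : C * (e - s) ≤ R / 4

/-- Curves on `[s, e]` starting near `y`, on which the Picard operator acts. -/
structure IsPicardCurve (y : E) (R C s e : ℝ) (x : ℝ → E) : Prop where
  near : ∀ t ∈ Icc s e, ‖x t - y‖ ≤ R / 4
  lipschitz : ∀ t ∈ Icc s e, ∀ t' ∈ Icc s e, ‖x t - x t'‖ ≤ C * |t - t'|

/-- The Picard operator. -/
def picard (g : E → ℝ → E) (s : ℝ) (y : E) (x : ℝ → E) (t : ℝ) : E :=
  y + ∫ σ in s..t, g (x σ) σ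

/-- The Picard iterates, starting from the constant curve. -/
def picardIter (g : E → ℝ → E) (s : ℝ) (y : E) : ℕ → ℝ → E
  | 0 => fun _ => y
  | n + 1 => picard g s y (picardIter g s y n)

variable {g : E → ℝ → E} {y₀ y : E} {R C s e : ℝ} {x x' : ℝ → E}

namespace IsBoundedField

theorem nonneg (hg : IsBoundedField g y₀ R C s e) : 0 ≤ C :=
  (norm_nonneg _).trans (hg.bound s (left_mem_Icc.2 hg.le) y₀
    (Metric.mem_ball_self (by linarith [hg.radius_pos])))

end IsBoundedField

namespace IsPicardCurve

omit [NormedSpace ℂ E] in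
theorem continuousOn (hx : IsPicardCurve y R C s e x) : ContinuousOn x (Icc s e) := by
  have : LipschitzOnWith (Real.toNNReal C) x (Icc s e) := by
    refine LipschitzOnWith.of_dist_le_mul fun t ht t' ht' => ?_
    rw [dist_eq_norm, Real.dist_eq]
    exact (hx.lipschitz t ht t' ht').trans (by gcongr; exact Real.le_coe_toNNReal C)
  exact this.continuousOn

theorem mem_ball (hg : IsBoundedField g y₀ R C s e) (hy : y ∈ Metric.ball y₀ (R / 2))
    (hx : IsPicardCurve y R C s e x) {t : ℝ} (ht : t ∈ Icc s e) : x t ∈ Metric.ball y₀ R := by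
  have h1 := hx.near t ht
  rw [← dist_eq_norm] at h1
  have := hg.radius_pos
  rw [Metric.mem_ball] at hy ⊢
  linarith [dist_triangle (x t) y y₀]

variable [FiniteDimensional ℂ E]

theorem aestronglyMeasurable (hg : IsBoundedField g y₀ R C s e)
    (hy : y ∈ Metric.ball y₀ (R / 2)) (hx : IsPicardCurve y R C s e x) :
    AEStronglyMeasurable (fun σ => g (x σ) σ) (volume.restrict (Icc s e)) := by
  have : ProperSpace E := FiniteDimensional.proper ℂ E
  -- Superposition needs a curve that is continuous on the whole line, hence the constant extension
  -- beyond the endpoints.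
  have h1 : AEStronglyMeasurable (fun σ => g (IccExtend hg.le ((Icc s e).domRestrict x) σ) σ)
      (volume.restrict (Icc s e)) := by
    refine aestronglyMeasurable_comp_curve (U := Metric.ball y₀ (2 * R)) ?_ hg.measurable
      (hx.continuousOn.domRestrict.Icc_extend') fun t => ?_
    · filter_upwards [ae_restrict_mem measurableSet_Icc] with t ht
      exact (hg.holomorphic t ht).continuousOn
    · exact Metric.ball_subset_ball (by linarith [hg.radius_pos])
        (hx.mem_ball hg hy (projIcc s e hg.le t).2)
  refine h1.congr ?_
  filter_upwards [ae_restrict_mem measurableSet_Icc] with t ht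
  rw [IccExtend_of_mem _ _ ht]
  rfl

omit [FiniteDimensional ℂ E] in
theorem norm_le (hg : IsBoundedField g y₀ R C s e) (hy : y ∈ Metric.ball y₀ (R / 2))
    (hx : IsPicardCurve y R C s e x) {t : ℝ} (ht : t ∈ Icc s e) : ‖g (x t) t‖ ≤ C :=
  hg.bound t ht _ (Metric.ball_subset_ball (by linarith [hg.radius_pos]) (hx.mem_ball hg hy ht))

theorem intervalIntegrable (hg : IsBoundedField g y₀ R C s e)
    (hy : y ∈ Metric.ball y₀ (R / 2)) (hx : IsPicardCurve y R C s e x) {t t' : ℝ}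
    (ht : t ∈ Icc s e) (ht' : t' ∈ Icc s e) :
    IntervalIntegrable (fun σ => g (x σ) σ) volume t t' := by
  have h1 : IntegrableOn (fun σ => g (x σ) σ) (Icc s e) :=
    (integrable_const C).mono' (hx.aestronglyMeasurable hg hy)
      (by filter_upwards [ae_restrict_mem measurableSet_Icc] with t ht using hx.norm_le hg hy ht)
  exact (h1.mono_set (uIcc_subset_Icc ht ht')).intervalIntegrable

theorem picard_sub (hg : IsBoundedField g y₀ R C s e)
    (hy : y ∈ Metric.ball y₀ (R / 2)) (hx : IsPicardCurve y R C s e x) {t t' : ℝ}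
    (ht : t ∈ Icc s e) (ht' : t' ∈ Icc s e) :
    ‖picard g s y x t - picard g s y x t'‖ ≤ C * |t - t'| := by
  have hs : s ∈ Icc s e := left_mem_Icc.2 hg.le
  rw [picard, picard, add_sub_add_left_eq_sub, intervalIntegral.integral_interval_sub_left
    (hx.intervalIntegrable hg hy hs ht) (hx.intervalIntegrable hg hy hs ht')]
  refine intervalIntegral.norm_integral_le_of_norm_le_const fun σ hσ => hx.norm_le hg hy ?_
  exact uIcc_subset_Icc ht' ht (uIoc_subset_uIcc hσ)

theorem picard (hg : IsBoundedField g y₀ R C s e)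
    (hy : y ∈ Metric.ball y₀ (R / 2)) (hx : IsPicardCurve y R C s e x) :
    IsPicardCurve y R C s e (picard g s y x) where
  near t ht := by
    have h1 := hx.picard_sub hg hy ht (left_mem_Icc.2 hg.le)
    have h2 : Loewner.picard g s y x s = y := by simp [Loewner.picard]
    rw [h2, abs_of_nonneg (by linarith [ht.1])] at h1
    refine h1.trans (le_trans ?_ hg.short)
    gcongr
    · exact hg.nonneg
    · exact ht.2
  lipschitz t ht t' ht' := hx.picard_sub hg hy ht ht'

/-- By Cauchy's estimate `g` has Lipschitz constant `2 * C / R` along the curves, and integrating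
over a time with `C * (e - s) ≤ R / 4` leaves the factor `1 / 2`. -/
theorem contract (hg : IsBoundedField g y₀ R C s e)
    (hy : y ∈ Metric.ball y₀ (R / 2)) (hx : IsPicardCurve y R C s e x)
    (hx' : IsPicardCurve y R C s e x') {ε : ℝ} (hε : ∀ t ∈ Icc s e, ‖x t - x' t‖ ≤ ε)
    {t : ℝ} (ht : t ∈ Icc s e) :
    ‖Loewner.picard g s y x t - Loewner.picard g s y x' t‖ ≤ ε / 2 := by
  have hs : s ∈ Icc s e := left_mem_Icc.2 hg.le
  have hR := hg.radius_pos
  have hε0 : 0 ≤ ε := (norm_nonneg _).trans (hε s hs)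
  have hC := hg.nonneg
  rw [Loewner.picard, Loewner.picard, add_sub_add_left_eq_sub,
    ← intervalIntegral.integral_sub (hx.intervalIntegrable hg hy hs ht)
      (hx'.intervalIntegrable hg hy hs ht)]
  have h1 : ‖∫ σ in s..t, (g (x σ) σ - g (x' σ) σ)‖ ≤ 2 * C / R * ε * |t - s| := by
    refine intervalIntegral.norm_integral_le_of_norm_le_const fun σ hσ => ?_
    have hσ' : σ ∈ Icc s e := uIcc_subset_Icc hs ht (uIoc_subset_uIcc hσ)
    have h2 := norm_sub_le_of_norm_le (z := x' σ) (w := x σ) hR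
      (Metric.ball_subset_ball' (by linarith [Metric.mem_ball.1 (hx'.mem_ball hg hy hσ')]))
      (hg.holomorphic σ hσ') (hg.bound σ hσ')
      (Metric.ball_subset_ball (by linarith) (hx.mem_ball hg hy hσ'))
    exact h2.trans (by gcongr; exact hε σ hσ')
  refine h1.trans ?_
  rw [abs_of_nonneg (by linarith [ht.1])]
  calc 2 * C / R * ε * (t - s) ≤ 2 * C / R * ε * (e - s) := by gcongr; exact ht.2
    _ = 2 * ε / R * (C * (e - s)) := by ring
    _ ≤ 2 * ε / R * (R / 4) := by gcongr; exact hg.short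
    _ = ε / 2 := by field_simp; ring

end IsPicardCurve

variable [FiniteDimensional ℂ E]

theorem isPicardCurve_picardIter (hg : IsBoundedField g y₀ R C s e)
    (hy : y ∈ Metric.ball y₀ (R / 2)) (n : ℕ) : IsPicardCurve y R C s e (picardIter g s y n) := by
  induction n with
  | zero =>
    have := hg.radius_pos
    have hC := hg.nonneg
    exact ⟨fun t _ => by simp [picardIter]; positivity,
      fun t _ t' _ => by simp [picardIter]; positivity⟩
  | succ n ih => exact ih.picard hg hy

theorem norm_picardIter_succ_sub_le (hg : IsBoundedField g y₀ R C s e)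
    (hy : y ∈ Metric.ball y₀ (R / 2)) (n : ℕ) : ∀ t ∈ Icc s e,
    ‖picardIter g s y n t - picardIter g s y (n + 1) t‖ ≤ R / 2 / 2 ^ n := by
  induction n with
  | zero =>
    intro t ht
    have := hg.radius_pos
    have h1 := (isPicardCurve_picardIter hg hy 1).near t ht
    rw [norm_sub_rev] at h1
    simp only [pow_zero, div_one]
    exact h1.trans (by linarith)
  | succ n ih =>
    intro t ht
    have := (isPicardCurve_picardIter hg hy n).contract hg hy
      (isPicardCurve_picardIter hg hy (n + 1)) ih ht
    refine this.trans_eq ?_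
    rw [pow_succ]
    field_simp

/-- The integrand of the next iterate is `g (·, σ)` after a holomorphic map and is bounded by `C`,
so its integral is holomorphic in the initial value. -/
theorem differentiableAt_picardIter (hg : IsBoundedField g y₀ R C s e) (n : ℕ) :
    ∀ t ∈ Icc s e, ∀ y ∈ Metric.ball y₀ (R / 2),
      DifferentiableAt ℂ (fun y => picardIter g s y n t) y := by
  induction n with
  | zero => intro t _ y _; exact differentiableAt_id
  | succ n ih =>
    intro t ht y hy
    have hs : s ∈ Icc s e := left_mem_Icc.2 hg.le
    have hR := hg.radius_pos
    refine differentiableAt_id.add ?_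
    simp only [intervalIntegral.integral_of_le ht.1]
    obtain ⟨r, hr, hry⟩ := Metric.isOpen_iff.1 Metric.isOpen_ball y hy
    have hsub : Ioc s t ⊆ Icc s e := Ioc_subset_Icc_self.trans (Icc_subset_Icc_right ht.2)
    refine differentiableAt_integral_of_bounded (R := r) (C := C) hr ?_ (fun z hz => ?_) ?_
    · filter_upwards [ae_restrict_mem measurableSet_Ioc] with σ hσ z hz
      refine DifferentiableAt.differentiableWithinAt ?_
      have h1 := (isPicardCurve_picardIter hg (hry hz) n).mem_ball hg (hry hz) (hsub hσ)
      have h2 : DifferentiableAt ℂ (g · σ) (picardIter g s z n σ) :=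
        (hg.holomorphic σ (hsub hσ)).differentiableAt
          (Metric.isOpen_ball.mem_nhds (Metric.ball_subset_ball (by linarith) h1))
      exact h2.comp z (ih σ (hsub hσ) z (hry hz))
    · exact ((isPicardCurve_picardIter hg (hry hz) n).aestronglyMeasurable hg
        (hry hz)).mono_measure (Measure.restrict_mono hsub le_rfl)
    · filter_upwards [ae_restrict_mem measurableSet_Ioc] with σ hσ z hz
      exact (isPicardCurve_picardIter hg (hry hz) n).norm_le hg (hry hz) (hsub hσ)

/-- **Carathéodory's theorem** for holomorphic vector fields: local solutions exist and depend
holomorphically on the initial value. -/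
theorem IsBoundedField.exists_flow (hg : IsBoundedField g y₀ R C s e) :
    ∃ f : ℝ → E → E, ∀ y ∈ Metric.ball y₀ (R / 2), f s y = y ∧
      (∀ t ∈ Icc s e, f t y ∈ Metric.ball y₀ R) ∧
      (∀ t ∈ Icc s e, ∀ t' ∈ Icc s e, ‖f t y - f t' y‖ ≤ C * |t - t'|) ∧
      (∀ᵐ t ∂volume.restrict (Icc s e), HasDerivAt (f · y) (g (f t y) t) t) ∧
      ∀ t ∈ Icc s e, DifferentiableAt ℂ (f t) y := by
  have hR := hg.radius_pos
  have hs : s ∈ Icc s e := left_mem_Icc.2 hg.le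
  have : CompleteSpace E := FiniteDimensional.complete ℂ E
  have hlim : ∀ y ∈ Metric.ball y₀ (R / 2), ∀ t ∈ Icc s e, ∃ v,
      Tendsto (fun n => picardIter g s y n t) atTop (𝓝 v) := fun y hy t ht =>
    cauchySeq_tendsto_of_complete (cauchySeq_of_le_geometric_two (C := R) fun n => by
      rw [dist_eq_norm]; exact norm_picardIter_succ_sub_le hg hy n t ht)
  choose! f hf using hlim
  have hfx : ∀ y ∈ Metric.ball y₀ (R / 2), IsPicardCurve y R C s e (f y) := fun y hy => by
    refine ⟨fun t ht => ?_, fun t ht t' ht' => ?_⟩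
    · exact le_of_tendsto ((hf y hy t ht).sub_const y).norm
        (Eventually.of_forall fun n => (isPicardCurve_picardIter hg hy n).near t ht)
    · exact le_of_tendsto ((hf y hy t ht).sub (hf y hy t' ht')).norm
        (Eventually.of_forall fun n => (isPicardCurve_picardIter hg hy n).lipschitz t ht t' ht')
  -- The iterates of index `n + 1` tend to `f y` by definition, and to the Picard image of `f y` by
  -- the contraction estimate.
  have hfix : ∀ y ∈ Metric.ball y₀ (R / 2), ∀ t ∈ Icc s e, f y t = picard g s y (f y) t := by
    intro y hy t ht
    refine tendsto_nhds_unique ((tendsto_add_atTop_iff_nat 1).2 (hf y hy t ht)) ?_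
    rw [tendsto_iff_norm_sub_tendsto_zero]
    refine squeeze_zero (g := fun n : ℕ => R / 2 ^ n / 2) (fun n => norm_nonneg _) (fun n => ?_) ?_
    · refine (isPicardCurve_picardIter hg hy n).contract hg hy (hfx y hy) (fun σ hσ => ?_) ht
      rw [← dist_eq_norm]
      exact dist_le_of_le_geometric_two_of_tendsto (C := R) (fun n => by
        rw [dist_eq_norm]; exact norm_picardIter_succ_sub_le hg hy n σ hσ) (hf y hy σ hσ) n
    · have h1 := (tendsto_pow_atTop_nhds_zero_of_lt_one (r := (1 / 2 : ℝ)) (by norm_num)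
        (by norm_num)).const_mul (R / 2)
      rw [mul_zero] at h1
      refine h1.congr fun n => ?_
      rw [one_div, inv_pow]
      ring
  refine ⟨fun t y => f y t, fun y hy => ⟨?_, fun t ht => (hfx y hy).mem_ball hg hy ht,
    (hfx y hy).lipschitz, ?_, fun t ht => ?_⟩⟩
  · exact (hfix y hy s hs).trans (by simp [picard])
  · have h1 := ((hfx y hy).intervalIntegrable hg hy hs (right_mem_Icc.2 hg.le)).ae_hasDerivAt_integral
    rw [uIcc_of_le hg.le] at h1
    -- The fixed point equation holds only on `[s, e]`, so two-sided derivatives are taken in the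
    -- interior; the endpoints form a null set.
    rw [← restrict_Ioo_eq_restrict_Icc, ae_restrict_iff' measurableSet_Ioo]
    filter_upwards [h1] with t ht1 ht
    have h2 := (ht1 (Ioo_subset_Icc_self ht) s hs).const_add y
    refine h2.congr_of_eventuallyEq ?_
    filter_upwards [Ioo_mem_nhds ht.1 ht.2] with σ hσ
    exact hfix y hy σ (Ioo_subset_Icc_self hσ)
  · obtain ⟨r, hr, hry⟩ := Metric.isOpen_iff.1 Metric.isOpen_ball y hy
    refine differentiableAt_of_tendsto_of_bounded (f := fun n z => picardIter g s z n t)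
      (R := r) (C := ‖y₀‖ + R) hr
      (fun n z hz => (differentiableAt_picardIter hg n t ht z (hry hz)).differentiableWithinAt)
      (fun n z hz => ?_) (fun z hz => hf z (hry hz) t ht)
    have h1 := (isPicardCurve_picardIter hg (hry hz) n).mem_ball hg (hry hz) ht
    rw [Metric.mem_ball, dist_eq_norm] at h1
    linarith [norm_le_insert' (picardIter g s z n t) y₀]

end Caratheodory

/-! ### The Poincaré distance on a radius and automorphisms of the disc -/

section Poincare

/-- The radius `[0, 1)` is a geodesic, so Poincaré distances add up along it. This additivity is
what allows a disc in a chain to be cut at an intermediate point. -/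
theorem artanh_sub {a b : ℝ} (ha : 0 ≤ a) (hab : a ≤ b) (hb : b < 1) :
    Real.artanh ((b - a) / (1 - a * b)) = Real.artanh b - Real.artanh a := by
  have h1 : 0 < 1 - a * b := by nlinarith
  have h2 : 0 ≤ (b - a) / (1 - a * b) := div_nonneg (by linarith) h1.le
  have h3 : (b - a) / (1 - a * b) ≤ 1 := by rw [div_le_one h1]; nlinarith
  rw [Real.artanh_eq_half_log ⟨by linarith, h3⟩, Real.artanh_eq_half_log ⟨by linarith, hb.le⟩,
    Real.artanh_eq_half_log ⟨by linarith, by linarith⟩, ← mul_sub, ← Real.log_div]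
  · congr 2
    have h4 : 1 - a ≠ 0 := by linarith
    have h5 : 1 - b ≠ 0 := by linarith
    have h6 : 1 + a ≠ 0 := by linarith
    have h9 : 1 - b * a ≠ 0 := by rw [mul_comm]; exact h1.ne'
    have h7 : 1 - (b - a) / (1 - a * b) = (1 - b) * (1 + a) / (1 - a * b) := by
      field_simp; ring
    have h8 : 1 + (b - a) / (1 - a * b) = (1 + b) * (1 - a) / (1 - a * b) := by
      field_simp; ring
    rw [h7, h8]
    field_simp
  · exact (div_pos (by linarith) (by linarith)).ne'
  · exact (div_pos (by linarith) (by linarith)).ne'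

theorem artanh_le_two_mul {x : ℝ} (h0 : 0 ≤ x) (h : x ≤ 1 / 2) : Real.artanh x ≤ 2 * x := by
  rw [Real.artanh_eq_half_log ⟨by linarith, by linarith⟩]
  have h1 : 0 < 1 - x := by linarith
  have h2 := Real.log_le_sub_one_of_pos (show 0 < (1 + x) / (1 - x) by positivity)
  have h3 : (1 + x) / (1 - x) - 1 ≤ 4 * x := by
    rw [sub_le_iff_le_add, div_le_iff₀ h1]
    nlinarith
  linarith

theorem poincareDist_ofReal {a b : ℝ} (ha : 0 ≤ a) (hab : a ≤ b) (hb : b < 1) :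
    poincareDist a b = Real.artanh b - Real.artanh a := by
  rw [← artanh_sub ha hab hb, poincareDist]
  have h1 : 0 < 1 - a * b := by nlinarith
  have h2 : ‖(a : ℂ) - b‖ = b - a := by
    rw [← Complex.ofReal_sub, Complex.norm_real, Real.norm_eq_abs, abs_of_nonpos (by linarith)]
    ring
  have h3 : ‖1 - conj (a : ℂ) * b‖ = 1 - a * b := by
    rw [Complex.conj_ofReal, ← Complex.ofReal_mul, ← Complex.ofReal_one, ← Complex.ofReal_sub,
      Complex.norm_real, Real.norm_eq_abs, abs_of_pos h1]
  rw [h2, h3]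

theorem poincareDist_comm (a b : ℂ) : poincareDist a b = poincareDist b a := by
  rw [poincareDist, poincareDist, norm_sub_rev, ← Complex.norm_conj (1 - conj b * a)]
  simp [mul_comm]

theorem one_add_conj_mul_ne_zero {a ζ : ℂ} (ha : ‖a‖ < 1) (hζ : ‖ζ‖ < 1) :
    1 + conj a * ζ ≠ 0 := by
  intro h
  have h1 : ‖conj a * ζ‖ = 1 := by
    rw [show conj a * ζ = -1 by linear_combination h]; simp
  rw [norm_mul, Complex.norm_conj] at h1
  nlinarith [norm_nonneg a, norm_nonneg ζ]

/-- The squared norms of denominator and numerator differ by `(1 - ‖a‖²) * (1 - ‖ζ‖²)`. -/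
theorem norm_add_div_lt_one {a ζ : ℂ} (ha : ‖a‖ < 1) (hζ : ‖ζ‖ < 1) :
    ‖(ζ + a) / (1 + conj a * ζ)‖ < 1 := by
  rw [norm_div, div_lt_one (norm_pos_iff.2 (one_add_conj_mul_ne_zero ha hζ))]
  refine lt_of_pow_lt_pow_left₀ 2 (norm_nonneg _) ?_
  have h1 : ‖a‖ ^ 2 < 1 := by nlinarith [norm_nonneg a]
  have h2 : ‖ζ‖ ^ 2 < 1 := by nlinarith [norm_nonneg ζ]
  rw [Complex.sq_norm] at h1 h2 ⊢
  rw [Complex.sq_norm]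
  simp only [Complex.normSq_apply, Complex.add_re, Complex.add_im, Complex.mul_re, Complex.mul_im,
    Complex.one_re, Complex.one_im, Complex.conj_re, Complex.conj_im] at h1 h2 ⊢
  nlinarith [mul_pos (sub_pos.2 h1) (sub_pos.2 h2)]

end Poincare

/-! ### Chains of discs: normalization, pseudo-distance axioms, contraction -/

section Chains

variable {E : Type*} [NormedAddCommGroup E] [NormedSpace ℂ E]
  {M : Type*} [TopologicalSpace M] [ChartedSpace E M]

variable (E) in
/-- A holomorphic disc in `M`. -/
def IsDisc (f : ℂ → M) : Prop := MDifferentiableOn 𝓘(ℂ, ℂ) 𝓘(ℂ, E) f (Metric.ball 0 1)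

/-- Every disc through two points can be normalized such that the points correspond to `0` and
to some `b ∈ [0, 1)`. -/
theorem exists_disc_of_discEDist_lt {z w : M} {r : ℝ≥0∞} (h : discEDist E z w < r) :
    ∃ (f : ℂ → M) (b : ℝ), IsDisc E f ∧ 0 ≤ b ∧ b < 1 ∧ f 0 = z ∧ f b = w ∧
      ENNReal.ofReal (Real.artanh b) < r := by
  simp only [discEDist, iInf_lt_iff] at h
  obtain ⟨f, a, b, ⟨hf, ha, hb, rfl, rfl⟩, hr⟩ := h
  rw [mem_ball_zero_iff] at ha hb
  -- `u` is the image of `b` under the automorphism that moves `a` to `0`.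
  set u : ℂ := (b - a) / (1 - conj a * b) with hu
  have hu1 : ‖u‖ < 1 := by
    have := norm_add_div_lt_one (a := -a) (ζ := b) (by rwa [norm_neg]) hb
    rw [map_neg, neg_mul, ← sub_eq_add_neg, ← sub_eq_add_neg] at this
    exact this
  -- A rotation brings the second point to the positive radius; for `u = 0` any unimodular `c`
  -- serves.
  obtain ⟨c, hc, huc⟩ : ∃ c : ℂ, ‖c‖ = 1 ∧ u = c * ‖u‖ := by
    by_cases h0 : u = 0
    · exact ⟨1, by simp, by simp [h0]⟩
    · have : (‖u‖ : ℂ) ≠ 0 := by exact_mod_cast norm_ne_zero_iff.2 h0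
      exact ⟨u / ‖u‖, by simp [h0], by field_simp⟩
  have hc1 : ∀ ζ : ℂ, ‖ζ‖ < 1 → ‖c * ζ‖ < 1 := fun ζ hζ => by rwa [norm_mul, hc, one_mul]
  refine ⟨fun ζ => f ((c * ζ + a) / (1 + conj a * (c * ζ))), ‖u‖, ?_, norm_nonneg _, hu1, ?_, ?_, ?_⟩
  · refine MDifferentiableOn.comp (I' := 𝓘(ℂ, ℂ)) (u := Metric.ball 0 1) hf ?_ fun ζ hζ => ?_
    · rw [mdifferentiableOn_iff_differentiableOn]
      refine DifferentiableOn.div (by fun_prop) (by fun_prop) fun ζ hζ => ?_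
      exact one_add_conj_mul_ne_zero ha (hc1 ζ (mem_ball_zero_iff.1 hζ))
    · exact mem_ball_zero_iff.2 (norm_add_div_lt_one ha (hc1 ζ (mem_ball_zero_iff.1 hζ)))
  · simp
  · have h1 : 1 - conj a * b ≠ 0 := by
      have := one_add_conj_mul_ne_zero (a := -a) (ζ := b) (by rwa [norm_neg]) hb
      rwa [map_neg, neg_mul, ← sub_eq_add_neg] at this
    have h2 : 1 + conj a * (c * ‖u‖) ≠ 0 := one_add_conj_mul_ne_zero ha (hc1 _ (by simpa using hu1))
    simp only
    congr 1
    rw [div_eq_iff h2, ← huc]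
    have h3 : u * (1 - conj a * b) = b - a := div_mul_cancel₀ _ h1
    linear_combination h3
  · rwa [poincareDist, norm_sub_rev, ← norm_div] at hr

theorem discEDist_le {f : ℂ → M} (hf : IsDisc E f) {a b : ℝ} (ha : 0 ≤ a) (hab : a ≤ b)
    (hb : b < 1) : discEDist E (f a) (f b) ≤ ENNReal.ofReal (Real.artanh b - Real.artanh a) := by
  rw [← poincareDist_ofReal ha hab hb]
  refine iInf_le_of_le f (iInf_le_of_le (a : ℂ) (iInf_le_of_le (b : ℂ) (iInf_le _ ⟨hf, ?_, ?_,
    rfl, rfl⟩)))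
  · rw [mem_ball_zero_iff, Complex.norm_real, Real.norm_eq_abs, abs_of_nonneg ha]; linarith
  · rw [mem_ball_zero_iff, Complex.norm_real, Real.norm_eq_abs, abs_of_nonneg (ha.trans hab)]
    exact hb

theorem discEDist_comm_le (z w : M) : discEDist E w z ≤ discEDist E z w := by
  refine le_iInf fun f => le_iInf fun a => le_iInf fun b => le_iInf fun ⟨hf, ha, hb, hz, hw⟩ => ?_
  rw [poincareDist_comm]
  exact iInf_le_of_le f (iInf_le_of_le b (iInf_le_of_le a (iInf_le _ ⟨hf, hb, ha, hw, hz⟩)))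

theorem discEDist_comm (z w : M) : discEDist E z w = discEDist E w z :=
  le_antisymm (discEDist_comm_le w z) (discEDist_comm_le z w)

theorem kobayashiEDist_le_sum (m : ℕ) (p : ℕ → M) : kobayashiEDist E (p 0) (p m) ≤
    ∑ i ∈ Finset.range m, discEDist E (p i) (p (i + 1)) :=
  iInf_le_of_le m (iInf_le_of_le p (iInf_le _ ⟨rfl, rfl⟩))

theorem kobayashiEDist_self (z : M) : kobayashiEDist E z z = 0 := by
  have := kobayashiEDist_le_sum (E := E) 0 (fun _ => z)
  simpa using this

theorem kobayashiEDist_le_discEDist (z w : M) : kobayashiEDist E z w ≤ discEDist E z w := by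
  have := kobayashiEDist_le_sum (E := E) 1 (fun n : ℕ => if n = 0 then z else w)
  simpa using this

theorem kobayashiEDist_comm_le (z w : M) : kobayashiEDist E w z ≤ kobayashiEDist E z w := by
  refine le_iInf fun m => le_iInf fun p => le_iInf fun ⟨hz, hw⟩ => ?_
  have := kobayashiEDist_le_sum (E := E) m (fun i => p (m - i))
  simp only [tsub_zero, tsub_self, hz, hw] at this
  refine this.trans_eq ?_
  rw [← Finset.sum_range_reflect]
  refine Finset.sum_congr rfl fun i hi => ?_
  rw [Finset.mem_range] at hi
  rw [discEDist_comm, show m - (m - 1 - i + 1) = i by omega, show m - (m - 1 - i) = i + 1 by omega]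

theorem kobayashiEDist_comm (z w : M) : kobayashiEDist E z w = kobayashiEDist E w z :=
  le_antisymm (kobayashiEDist_comm_le w z) (kobayashiEDist_comm_le z w)

theorem kobayashiEDist_triangle (z y w : M) :
    kobayashiEDist E z w ≤ kobayashiEDist E z y + kobayashiEDist E y w := by
  conv_rhs => rw [kobayashiEDist, kobayashiEDist]
  simp only [ENNReal.iInf_add, ENNReal.add_iInf]
  refine le_iInf fun n => le_iInf fun q => le_iInf fun ⟨hq, hq'⟩ => le_iInf fun m => le_iInf fun p =>
    le_iInf fun ⟨hp, hp'⟩ => ?_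
  -- The index `m` belongs to both chains and is read off from `p`; this is harmless since `p m = y
  -- = q 0`.
  have := kobayashiEDist_le_sum (E := E) (m + n) (fun i => if i ≤ m then p i else q (i - m))
  have h1 : (if m + n ≤ m then p (m + n) else q (m + n - m)) = w := by
    split_ifs with h
    · obtain rfl : n = 0 := by omega
      rw [add_zero, hp', ← hq, hq']
    · rw [add_tsub_cancel_left, hq']
  simp only [h1, zero_le, if_true, hp] at this
  refine this.trans_eq ?_
  rw [Finset.sum_range_add]
  congr 1
  · refine Finset.sum_congr rfl fun i hi => ?_
    rw [Finset.mem_range] at hi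
    rw [if_pos hi.le, if_pos (by omega)]
  · refine Finset.sum_congr rfl fun i _ => ?_
    rw [if_neg (show ¬ m + i + 1 ≤ m by omega), show m + i + 1 - m = i + 1 by omega]
    congr 1
    rcases Nat.eq_zero_or_pos i with rfl | hi
    · simp [hp', hq]
    · rw [if_neg (by omega), add_tsub_cancel_left]

theorem discEDist_map_le {F : M → M} (hF : MDifferentiable 𝓘(ℂ, E) 𝓘(ℂ, E) F) (z w : M) :
    discEDist E (F z) (F w) ≤ discEDist E z w := by
  refine le_iInf fun f => le_iInf fun a => le_iInf fun b => le_iInf fun ⟨hf, ha, hb, hz, hw⟩ => ?_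
  exact iInf_le_of_le (F ∘ f) (iInf_le_of_le a (iInf_le_of_le b (iInf_le _
    ⟨hF.comp_mdifferentiableOn hf, ha, hb, congrArg F hz, congrArg F hw⟩)))

theorem kobayashiEDist_map_le {F : M → M} (hF : MDifferentiable 𝓘(ℂ, E) 𝓘(ℂ, E) F) (z w : M) :
    kobayashiEDist E (F z) (F w) ≤ kobayashiEDist E z w := by
  refine le_iInf fun m => le_iInf fun p => le_iInf fun ⟨hz, hw⟩ => ?_
  have := kobayashiEDist_le_sum (E := E) m (F ∘ p)
  simp only [Function.comp_apply, hz, hw] at this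
  exact this.trans (Finset.sum_le_sum fun i _ => discEDist_map_le hF _ _)

end Chains

/-! ### Local bounds, finiteness and innerness of the Kobayashi distance -/

section Finite

variable {E : Type*} [NormedAddCommGroup E] [NormedSpace ℂ E]
  {M : Type*} [TopologicalSpace M] [ChartedSpace E M]

/-- The Kobayashi distance is locally bounded by the distance in a chart. -/
theorem exists_kobayashiEDist_le [IsManifold 𝓘(ℂ, E) 1 M] (q : M) :
    ∃ U ∈ 𝓝 q, ∃ A : ℝ, 0 < A ∧ U ⊆ (chartAt E q).source ∧ ∀ z ∈ U, ∀ w ∈ U,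
      kobayashiEDist E z w ≤ ENNReal.ofReal (A * ‖chartAt E q z - chartAt E q w‖) := by
  set χ := chartAt E q with hχ
  have hq : q ∈ χ.source := mem_chart_source E q
  obtain ⟨ε, hε, hball⟩ := Metric.isOpen_iff.1 χ.open_target (χ q) (χ.map_source hq)
  -- Points lie within `R` of the centre and carry affine discs of radius `4 * R`, which adds up to
  -- `ε`.
  set R := ε / 5 with hR
  have hR0 : 0 < R := by positivity
  refine ⟨χ.source ∩ χ ⁻¹' Metric.ball (χ q) R, inter_mem (χ.open_source.mem_nhds hq)
    ((χ.continuousAt hq).preimage_mem_nhds (Metric.ball_mem_nhds _ hR0)), 1 / (2 * R), by positivity,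
    inter_subset_left, fun z hz w hw => ?_⟩
  obtain ⟨hzs, hzR⟩ := hz
  obtain ⟨hws, hwR⟩ := hw
  rw [mem_preimage, Metric.mem_ball] at hzR hwR
  by_cases hzw : z = w
  · rw [hzw, kobayashiEDist_self]; exact zero_le
  set δ := χ w - χ z with hδ
  have hδ0 : δ ≠ 0 := sub_ne_zero.2 fun h => hzw (χ.injOn hzs hws h.symm)
  have hδn : 0 < ‖δ‖ := norm_pos_iff.2 hδ0
  have hδR : ‖δ‖ < 2 * R := by
    rw [hδ, ← dist_eq_norm]
    linarith [dist_triangle_right (χ w) (χ z) (χ q)]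
  -- The affine disc of radius `4 * R` centred at `z` in the direction of `w`. It reaches `w` at the
  -- parameter `‖δ‖ / (4 * R) ≤ 1 / 2`, where `artanh x ≤ 2 * x`; this explains the constant `1 / (2
  -- * R)`.
  set f : ℂ → M := fun ζ => χ.symm (χ z + (ζ * (4 * R / ‖δ‖ : ℝ)) • δ) with hf
  have hdisc : IsDisc E f := by
    refine MDifferentiableOn.comp (I' := 𝓘(ℂ, E)) (u := χ.target)
      (mdifferentiableOn_atlas_symm (chart_mem_atlas E q)) ?_ fun ζ hζ => hball ?_
    · rw [mdifferentiableOn_iff_differentiableOn]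
      fun_prop
    · rw [Metric.mem_ball, dist_eq_norm]
      have h1 : ‖(ζ * (4 * R / ‖δ‖ : ℝ)) • δ‖ ≤ 4 * R := by
        rw [norm_smul, norm_mul, Complex.norm_real, Real.norm_eq_abs, abs_of_nonneg (by positivity)]
        have : ‖ζ‖ ≤ 1 := (mem_ball_zero_iff.1 hζ).le
        calc ‖ζ‖ * (4 * R / ‖δ‖) * ‖δ‖ = ‖ζ‖ * (4 * R) := by field_simp
          _ ≤ 1 * (4 * R) := by gcongr
          _ = _ := one_mul _
      rw [dist_eq_norm] at hzR
      calc ‖χ z + (ζ * (4 * R / ‖δ‖ : ℝ)) • δ - χ q‖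
          = ‖(χ z - χ q) + (ζ * (4 * R / ‖δ‖ : ℝ)) • δ‖ := by congr 1; abel
        _ ≤ ‖χ z - χ q‖ + ‖(ζ * (4 * R / ‖δ‖ : ℝ)) • δ‖ := norm_add_le _ _
        _ < R + 4 * R := by linarith
        _ = ε := by rw [hR]; ring
  have h0 : f ((0 : ℝ) : ℂ) = z := by simp [hf, χ.left_inv hzs]
  have h1 : f ((‖δ‖ / (4 * R) : ℝ) : ℂ) = w := by
    have h2 : (‖δ‖ / (4 * R) : ℝ) * (4 * R / ‖δ‖ : ℝ) = 1 := by field_simp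
    simp only [hf]
    rw [← Complex.ofReal_mul, h2, Complex.ofReal_one, one_smul, hδ, add_sub_cancel, χ.left_inv hws]
  have h3 : ‖δ‖ / (4 * R) ≤ 1 / 2 := by
    rw [div_le_iff₀ (by positivity)]; linarith
  have h4 := discEDist_le hdisc le_rfl (show 0 ≤ ‖δ‖ / (4 * R) by positivity) (by linarith)
  rw [h0, h1, Real.artanh_zero, sub_zero] at h4
  refine (kobayashiEDist_le_discEDist z w).trans (h4.trans (ENNReal.ofReal_le_ofReal ?_))
  refine (artanh_le_two_mul (by positivity) h3).trans_eq ?_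
  rw [norm_sub_rev (χ z)]
  rw [← hδ]
  field_simp
  norm_num

theorem kobayashiDist_nonneg (z w : M) : 0 ≤ kobayashiDist E z w := ENNReal.toReal_nonneg

theorem kobayashiDist_self (z : M) : kobayashiDist E z z = 0 := by
  simp [kobayashiDist, kobayashiEDist_self]

theorem kobayashiDist_comm (z w : M) : kobayashiDist E z w = kobayashiDist E w z := by
  rw [kobayashiDist, kobayashiDist, kobayashiEDist_comm]

theorem kobayashiDist_le_of_edist_le {z w : M} {r : ℝ} (hr : 0 ≤ r)
    (h : kobayashiEDist E z w ≤ ENNReal.ofReal r) : kobayashiDist E z w ≤ r :=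
  ENNReal.toReal_le_of_le_ofReal hr h

theorem kobayashiDist_disc_le {f : ℂ → M} (hf : IsDisc E f) {a b : ℝ} (ha : 0 ≤ a) (hab : a ≤ b)
    (hb : b < 1) : kobayashiDist E (f a) (f b) ≤ Real.artanh b - Real.artanh a :=
  kobayashiDist_le_of_edist_le (sub_nonneg.2 (Real.artanh_le_artanh (by linarith) hb hab))
    ((kobayashiEDist_le_discEDist _ _).trans (discEDist_le hf ha hab hb))

variable [IsManifold 𝓘(ℂ, E) 1 M]

theorem eventually_kobayashiEDist_lt_top (z : M) : ∀ᶠ w in 𝓝 z, kobayashiEDist E z w < (⊤ : ℝ≥0∞) := by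
  obtain ⟨U, hU, A, -, -, h⟩ := exists_kobayashiEDist_le (E := E) z
  filter_upwards [hU] with w hw
  exact (h z (mem_of_mem_nhds hU) w hw).trans_lt ENNReal.ofReal_lt_top

variable [ConnectedSpace M]

/-- Nearby points have finite distance, so by the triangle inequality the points at finite distance
from `z` form a nonempty clopen set. -/
theorem kobayashiEDist_ne_top (z w : M) : kobayashiEDist E z w ≠ ⊤ := by
  have h : IsClopen {w : M | kobayashiEDist E z w < (⊤ : ℝ≥0∞)} := by
    constructor
    · rw [← isOpen_compl_iff, isOpen_iff_mem_nhds]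
      intro y hy
      filter_upwards [eventually_kobayashiEDist_lt_top (E := E) y] with v hv hv'
      refine hy ((kobayashiEDist_triangle z v y).trans_lt (ENNReal.add_lt_top.2 ⟨hv', ?_⟩))
      rwa [kobayashiEDist_comm]
    · rw [isOpen_iff_mem_nhds]
      intro y hy
      filter_upwards [eventually_kobayashiEDist_lt_top (E := E) y] with v hv
      exact (kobayashiEDist_triangle z y v).trans_lt (ENNReal.add_lt_top.2 ⟨hy, hv⟩)
  have := h.eq_univ ⟨z, by simp [kobayashiEDist_self]⟩
  exact (this ▸ mem_univ w : w ∈ {w : M | kobayashiEDist E z w < (⊤ : ℝ≥0∞)}).ne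

theorem ofReal_kobayashiDist (z w : M) :
    ENNReal.ofReal (kobayashiDist E z w) = kobayashiEDist E z w :=
  ENNReal.ofReal_toReal (kobayashiEDist_ne_top z w)

theorem kobayashiDist_triangle (z y w : M) :
    kobayashiDist E z w ≤ kobayashiDist E z y + kobayashiDist E y w := by
  rw [kobayashiDist, kobayashiDist, kobayashiDist,
    ← ENNReal.toReal_add (kobayashiEDist_ne_top _ _) (kobayashiEDist_ne_top _ _)]
  exact ENNReal.toReal_mono
    (ENNReal.add_ne_top.2 ⟨kobayashiEDist_ne_top _ _, kobayashiEDist_ne_top _ _⟩)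
    (kobayashiEDist_triangle z y w)

theorem kobayashiDist_map_le {F : M → M} (hF : MDifferentiable 𝓘(ℂ, E) 𝓘(ℂ, E) F) (z w : M) :
    kobayashiDist E (F z) (F w) ≤ kobayashiDist E z w :=
  ENNReal.toReal_mono (kobayashiEDist_ne_top _ _) (kobayashiEDist_map_le hF z w)

/-- Induction along a chain of discs. -/
theorem kobayashiDist_induction {P : M → M → ℝ → Prop} (base : ∀ z r, 0 < r → P z z r)
    (step : ∀ (f : ℂ → M) (b : ℝ) (w : M) (r : ℝ), IsDisc E f → 0 ≤ b → b < 1 →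
      kobayashiDist E (f b) w < r - Real.artanh b → P (f b) w (r - Real.artanh b) →
      P (f 0) w r) {z w : M} {r : ℝ} (h : kobayashiDist E z w < r) : P z w r := by
  have h0 : 0 < r := (kobayashiDist_nonneg z w).trans_lt h
  have h1 : kobayashiEDist E z w < ENNReal.ofReal r := by
    rw [← ofReal_kobayashiDist]; exact (ENNReal.ofReal_lt_ofReal_iff h0).2 h
  simp only [kobayashiEDist, iInf_lt_iff] at h1
  obtain ⟨m, p, ⟨rfl, rfl⟩, hs⟩ := h1
  clear h
  induction m generalizing r p with
  | zero => exact base _ _ h0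
  | succ m ih =>
    rw [Finset.sum_range_succ', add_comm] at hs
    set S := ∑ i ∈ Finset.range m, discEDist E (p (i + 1)) (p (i + 1 + 1)) with hS
    obtain ⟨f, b, hf, hb0, hb1, hf0, hfb, hlt⟩ := exists_disc_of_discEDist_lt (lt_tsub_iff_right.2 hs)
    rw [lt_tsub_iff_right, add_comm] at hlt
    have hb : 0 ≤ Real.artanh b := Real.artanh_nonneg hb0
    have h2 : S < ENNReal.ofReal (r - Real.artanh b) := by
      rw [ENNReal.ofReal_sub _ hb]
      exact lt_tsub_iff_right.2 hlt
    have h3 : 0 < r - Real.artanh b := by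
      by_contra hcon
      rw [ENNReal.ofReal_of_nonpos (not_lt.1 hcon)] at h2
      exact absurd h2 not_lt_zero
    have h4 := ih h3 (fun i => p (i + 1)) h2
    have h5 := (kobayashiEDist_le_sum (E := E) m (fun i => p (i + 1))).trans_lt h2
    simp only [zero_add] at h4 h5
    rw [← hfb] at h4 h5
    rw [← hf0]
    refine step f b _ r hf hb0 hb1 ?_ h4
    rwa [← ofReal_kobayashiDist, ENNReal.ofReal_lt_ofReal_iff h3] at h5

/-- Balls of the Kobayashi distance are connected. -/
theorem exists_isPreconnected {z w : M} {r : ℝ} (h : kobayashiDist E z w < r) :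
    ∃ A : Set M, IsPreconnected A ∧ z ∈ A ∧ w ∈ A ∧ ∀ y ∈ A, kobayashiDist E z y < r := by
  refine kobayashiDist_induction (E := E)
    (P := fun z w r => ∃ A : Set M, IsPreconnected A ∧ z ∈ A ∧ w ∈ A ∧
      ∀ y ∈ A, kobayashiDist E z y < r) (fun z r hr => ?_) (fun f b w r hf hb0 hb1 hlt ih => ?_) h
  · exact ⟨{z}, isPreconnected_singleton, rfl, rfl, fun y hy => by
      rw [mem_singleton_iff.1 hy, kobayashiDist_self]; exact hr⟩
  · obtain ⟨A, hA, hfA, hwA, hAr⟩ := ih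
    have hb : f b ∈ (fun t : ℝ => f t) '' Icc 0 b := ⟨b, right_mem_Icc.2 hb0, rfl⟩
    have hd : ∀ t ∈ Icc 0 b, kobayashiDist E (f 0) (f t) ≤ Real.artanh t := fun t ht => by
      have := kobayashiDist_disc_le hf le_rfl ht.1 (ht.2.trans_lt hb1)
      rwa [Real.artanh_zero, sub_zero, Complex.ofReal_zero] at this
    refine ⟨(fun t : ℝ => f t) '' Icc 0 b ∪ A, ?_, Or.inl ⟨0, left_mem_Icc.2 hb0, by simp⟩,
      Or.inr hwA, ?_⟩
    · refine IsPreconnected.union (f b) hb hfA (isPreconnected_Icc.image _ ?_) hA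
      refine hf.continuousOn.comp Complex.continuous_ofReal.continuousOn fun t ht => ?_
      rw [mem_ball_zero_iff, Complex.norm_real, Real.norm_eq_abs, abs_of_nonneg ht.1]
      exact ht.2.trans_lt hb1
    · rintro y (⟨t, ht, rfl⟩ | hy)
      · have h1 := Real.artanh_le_artanh (by linarith [ht.1]) hb1 ht.2
        linarith [hd t ht, kobayashiDist_nonneg (E := E) (f b) w]
      · linarith [kobayashiDist_triangle (E := E) (f 0) (f b) y, hAr y hy,
          hd b (right_mem_Icc.2 hb0)]

/-- The Kobayashi distance is inner: there are almost intermediate points. -/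
theorem exists_intermediate {z w : M} {r : ℝ} (h : kobayashiDist E z w < r) {ρ : ℝ} (hρ : 0 < ρ)
    (hρr : ρ < r) : ∃ y, kobayashiDist E z y < ρ ∧ kobayashiDist E y w < r - ρ := by
  refine kobayashiDist_induction (E := E)
    (P := fun z w r => ∀ ρ, 0 < ρ → ρ < r →
      ∃ y, kobayashiDist E z y < ρ ∧ kobayashiDist E y w < r - ρ)
    (fun z r _ ρ hρ hρr => ⟨z, ?_, ?_⟩) (fun f b w r hf hb0 hb1 hlt ih ρ hρ hρr => ?_) h ρ hρ hρr
  · rwa [kobayashiDist_self]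
  · rw [kobayashiDist_self]; linarith
  · set α := Real.artanh b with hα
    have hα0 : 0 ≤ α := Real.artanh_nonneg hb0
    set κ := kobayashiDist E (f b) w with hκ
    have hd : ∀ t ∈ Icc 0 b, kobayashiDist E (f 0) (f t) ≤ Real.artanh t := fun t ht => by
      have := kobayashiDist_disc_le hf le_rfl ht.1 (ht.2.trans_lt hb1)
      rwa [Real.artanh_zero, sub_zero, Complex.ofReal_zero] at this
    rcases le_or_gt ρ α with hρα | hρα
    -- The cut falls on the first disc. Half of the slack `r - α - κ > 0` is spent on making the
    -- first distance strictly less than `ρ`; the other half keeps the second one strictly less than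
    -- `r - ρ`.
    · set β := max 0 (ρ - (r - α - κ) / 2) with hβ
      have hβ0 : 0 ≤ β := le_max_left _ _
      have hβρ : β < ρ := max_lt hρ (by linarith)
      have hβα : β ≤ α := hβρ.le.trans hρα
      obtain ⟨t, ht, htβ⟩ : ∃ t ∈ Icc 0 b, Real.artanh t = β := by
        refine ⟨Real.tanh β, ?_, Real.artanh_tanh β⟩
        have hbb : b ∈ Ioo (-1) (1 : ℝ) := ⟨by linarith, hb1⟩
        have htt : Real.tanh β ∈ Ioo (-1) (1 : ℝ) :=
          ⟨Real.neg_one_lt_tanh β, Real.tanh_lt_one β⟩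
        constructor
        · rw [← Real.artanh_le_artanh_iff ⟨by norm_num, by norm_num⟩ htt, Real.artanh_zero,
            Real.artanh_tanh]
          exact hβ0
        · rw [← Real.artanh_le_artanh_iff htt hbb, Real.artanh_tanh]
          exact hβα
      refine ⟨f t, ?_, ?_⟩
      · linarith [hd t ht]
      · have h1 := kobayashiDist_disc_le hf ht.1 ht.2 hb1
        have h2 : ρ - (r - α - κ) / 2 ≤ β := le_max_right _ _
        linarith [kobayashiDist_triangle (E := E) (f t) (f b) w]
    -- The cut falls beyond the first disc, whose length `α` is subtracted.
    · obtain ⟨y, hy1, hy2⟩ := ih (ρ - α) (by linarith) (by linarith)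
      refine ⟨y, ?_, by linarith⟩
      linarith [kobayashiDist_triangle (E := E) (f 0) (f b) y, hd b (right_mem_Icc.2 hb0)]

end Finite

/-! ### Hopf-Rinow for inner distances -/

section HopfRinow

/-- **Hopf-Rinow**: a complete locally compact metric space with almost intermediate points is
proper. -/
theorem properSpace_of_intermediate {X : Type*} [MetricSpace X] [CompleteSpace X]
    [LocallyCompactSpace X]
    (h : ∀ (x y : X) (r ρ : ℝ), dist x y < r → 0 < ρ → ρ < r →
      ∃ z, dist x z < ρ ∧ dist z y < r - ρ) : ProperSpace X := by
  refine ⟨fun x => ?_⟩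
  by_contra! hcon
  obtain ⟨r₀, hr₀⟩ := hcon
  -- If not all radii belong to `S`, its supremum `ρ` is finite. It is shown to be attained and then
  -- to be exceeded.
  set S := {r : ℝ | IsCompact (Metric.closedBall x r)} with hS
  have hlow : ∀ r ∈ S, ∀ r' ≤ r, r' ∈ S := fun r hr r' hr' =>
    IsCompact.of_isClosed_subset hr Metric.isClosed_closedBall (Metric.closedBall_subset_closedBall hr')
  have hbdd : BddAbove S := ⟨r₀, fun r hr => by
    by_contra! hlt
    exact hr₀ (hlow r hr r₀ hlt.le)⟩
  have h0 : (0 : ℝ) ∈ S := by simp [hS]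
  set ρ := sSup S with hρ
  have hρ0 : 0 ≤ ρ := le_csSup hbdd h0
  have hlt : ∀ r < ρ, r ∈ S := fun r hr => by
    obtain ⟨r', hr', hlt⟩ := exists_lt_of_lt_csSup ⟨0, h0⟩ hr
    exact hlow r' hr' r hlt.le
  have hρS : ρ ∈ S := by
    rcases hρ0.eq_or_lt with h1 | h1
    · rwa [← h1]
    refine isCompact_iff_totallyBounded_isComplete.2 ⟨Metric.totallyBounded_iff.2 fun ε hε => ?_,
      Metric.isClosed_closedBall.isComplete⟩
    -- `ρ / 2` makes `r` positive, as intermediate points require; `ρ - ε / 4` puts the whole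
    -- `ρ`-ball within `ε / 2` of the compact `r`-ball.
    set r := max (ρ / 2) (ρ - ε / 4) with hr
    have hr0 : 0 < r := lt_max_of_lt_left (by linarith)
    have hrρ : r < ρ := max_lt (by linarith) (by linarith)
    obtain ⟨t, ht, htr⟩ := Metric.totallyBounded_iff.1 (hlt r hrρ).totallyBounded (ε / 2)
      (by positivity)
    refine ⟨t, ht, fun y hy => ?_⟩
    rw [Metric.mem_closedBall, dist_comm] at hy
    obtain ⟨z, hz1, hz2⟩ := h x y (ρ + ε / 4) r (by linarith) hr0 (by linarith)
    rw [dist_comm] at hz1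
    obtain ⟨v, hv, hvz⟩ := mem_iUnion₂.1 (htr hz1.le)
    refine mem_iUnion₂.2 ⟨v, hv, ?_⟩
    have h3 : ρ - ε / 4 ≤ r := le_max_right _ _
    rw [Metric.mem_ball] at hvz ⊢
    linarith [dist_triangle_left y v z]
  -- By local compactness some thickening of the compact ball is still compact, and by innerness it
  -- contains a larger ball.
  obtain ⟨δ, hδ, hδc⟩ := IsCompact.exists_isCompact_cthickening (s := Metric.closedBall x ρ) hρS
  have h2 : ρ + δ / 2 ∈ S := by
    refine IsCompact.of_isClosed_subset hδc Metric.isClosed_closedBall fun y hy => ?_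
    rw [Metric.mem_closedBall, dist_comm] at hy
    -- Intermediate points exist only at positive distance, so `ρ = 0` is treated apart, with the
    -- centre in their place.
    rcases hρ0.eq_or_lt with h1 | h1
    · refine Metric.mem_cthickening_of_dist_le y x δ _ (Metric.mem_closedBall_self hρ0) ?_
      rw [dist_comm]; linarith
    · obtain ⟨z, hz1, hz2⟩ := h x y (ρ + δ) ρ (by linarith) h1 (by linarith)
      refine Metric.mem_cthickening_of_dist_le y z δ _ ?_ ?_
      · rw [Metric.mem_closedBall, dist_comm]; exact hz1.le
      · rw [dist_comm]; linarith
  linarith [le_csSup hbdd h2]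

end HopfRinow

/-! ### The Kobayashi topology and properness -/

section Barth

variable {E : Type*} [NormedAddCommGroup E] [NormedSpace ℂ E]
  {M : Type*} [TopologicalSpace M] [ChartedSpace E M] [IsManifold 𝓘(ℂ, E) 1 M]

theorem tendsto_kobayashiDist_nhds (z : M) :
    Tendsto (fun w => kobayashiDist E z w) (𝓝 z) (𝓝 0) := by
  obtain ⟨U, hU, A, hA, hUs, h⟩ := exists_kobayashiEDist_le (E := E) z
  have h1 : Tendsto (fun w => A * ‖chartAt E z z - chartAt E z w‖) (𝓝 z) (𝓝 0) := by
    have : ContinuousAt (fun w => A * ‖chartAt E z z - chartAt E z w‖) z := by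
      have := (chartAt E z).continuousAt (mem_chart_source E z)
      fun_prop
    simpa using this.tendsto
  refine squeeze_zero' (Eventually.of_forall fun w => kobayashiDist_nonneg z w) ?_ h1
  filter_upwards [hU] with w hw
  exact kobayashiDist_le_of_edist_le (by positivity) (h z (mem_of_mem_nhds hU) w hw)

variable [ConnectedSpace M]

theorem continuous_kobayashiDist (z : M) : Continuous (fun w => kobayashiDist E z w) := by
  refine continuous_iff_continuousAt.2 fun w => ?_
  rw [ContinuousAt, tendsto_iff_dist_tendsto_zero]
  refine squeeze_zero (fun _ => dist_nonneg) (fun y => ?_) (tendsto_kobayashiDist_nhds (E := E) w)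
  rw [Real.dist_eq, abs_le]
  constructor
  · linarith [kobayashiDist_triangle (E := E) z y w, kobayashiDist_comm (E := E) w y]
  · linarith [kobayashiDist_triangle (E := E) z w y]

variable [FiniteDimensional ℂ E]

/-- **Barth's theorem**: if the Kobayashi distance is a distance, its small balls are small. -/
theorem exists_kobayashiDist_lt_imp_mem [T2Space M]
    (h : ∀ z w : M, kobayashiDist E z w = 0 → z = w) {z : M} {U : Set M} (hU : U ∈ 𝓝 z) :
    ∃ η > 0, ∀ w, kobayashiDist E z w < η → w ∈ U := by
  have : LocallyCompactSpace E := by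
    have := FiniteDimensional.proper ℂ E
    infer_instance
  have : LocallyCompactSpace M := ChartedSpace.locallyCompactSpace E M
  obtain ⟨K, hK, hKU, hKc⟩ := local_compact_nhds hU
  have hzV : z ∈ interior K := mem_interior_iff_mem_nhds.2 hK
  have hS : IsCompact (frontier (interior K)) :=
    hKc.of_isClosed_subset isClosed_frontier (frontier_subset_closure.trans
      (closure_minimal interior_subset hKc.isClosed))
  -- The continuous function `k_M (z, ·)` attains its minimum on the compact frontier, and
  -- hyperbolicity makes this minimum positive.
  obtain ⟨η, hη, hηS⟩ : ∃ η > 0, ∀ w ∈ frontier (interior K), η ≤ kobayashiDist E z w := by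
    rcases (frontier (interior K)).eq_empty_or_nonempty with h0 | h0
    · exact ⟨1, one_pos, by simp [h0]⟩
    · obtain ⟨w, hw, hmin⟩ := hS.exists_isMinOn h0 (continuous_kobayashiDist (E := E) z).continuousOn
      refine ⟨kobayashiDist E z w, (kobayashiDist_nonneg z w).lt_of_ne fun h1 => ?_, hmin⟩
      rw [← h z w h1.symm, frontier, interior_interior] at hw
      exact hw.2 hzV
  refine ⟨η, hη, fun w hw => ?_⟩
  by_contra hwU
  -- A connected set inside the `η`-ball cannot cross the frontier, so it cannot join `z` to a point
  -- outside `U`.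
  obtain ⟨A, hA, hzA, hwA, hAη⟩ := exists_isPreconnected hw
  have hcl : closure (interior K) ⊆ U := (closure_minimal interior_subset hKc.isClosed).trans hKU
  obtain ⟨y, -, hy1, hy2⟩ := hA (interior K) (closure (interior K))ᶜ isOpen_interior
    isClosed_closure.isOpen_compl (fun y hyA => by
      by_contra hy
      rw [mem_union, not_or, mem_compl_iff, not_not] at hy
      refine absurd (hAη y hyA) (not_lt.2 (hηS y ⟨hy.2, ?_⟩))
      rw [interior_interior]
      exact hy.1) ⟨z, hzA, hzV⟩ ⟨w, hwA, fun h => hwU (hcl h)⟩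
  exact hy2 (subset_closure hy1)

variable (E) in
/-- The metric space structure given by the Kobayashi distance of a hyperbolic manifold. Its
topology is the given one. -/
abbrev kobayashiMetricSpace [T2Space M] (h : ∀ z w : M, kobayashiDist E z w = 0 → z = w) :
    MetricSpace M :=
  MetricSpace.replaceTopology
    { dist := kobayashiDist E
      dist_self := kobayashiDist_self
      dist_comm := kobayashiDist_comm
      dist_triangle := kobayashiDist_triangle
      eq_of_dist_eq_zero := h _ _ } (by
    refine TopologicalSpace.ext_nhds fun z => ?_
    let m : MetricSpace M :=
      { dist := kobayashiDist E
        dist_self := kobayashiDist_self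
        dist_comm := kobayashiDist_comm
        dist_triangle := kobayashiDist_triangle
        eq_of_dist_eq_zero := h _ _ }
    have hb := @Metric.nhds_basis_ball M m.toPseudoMetricSpace z
    refine le_antisymm (hb.ge_iff.2 fun ε hε => ?_) fun U hU => ?_
    · filter_upwards [(tendsto_kobayashiDist_nhds (E := E) z).eventually (gt_mem_nhds hε)] with w hw
      exact (kobayashiDist_comm w z).trans_lt hw
    · obtain ⟨η, hη, hw⟩ := exists_kobayashiDist_lt_imp_mem h hU
      exact hb.mem_iff.2 ⟨η, hη, fun w hwη => hw w ((kobayashiDist_comm z w).trans_lt hwη)⟩)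

/-- The Kobayashi distance of a complete hyperbolic manifold is proper. -/
theorem properSpace_kobayashi [T2Space M] (hM : IsCompleteHyperbolic E M) :
    @ProperSpace M (kobayashiMetricSpace E hM.eq_of_dist_eq_zero).toPseudoMetricSpace := by
  have : LocallyCompactSpace E := by
    have := FiniteDimensional.proper ℂ E
    infer_instance
  have hloc : LocallyCompactSpace M := ChartedSpace.locallyCompactSpace E M
  let m := kobayashiMetricSpace E hM.eq_of_dist_eq_zero
  have hd : ∀ z w : M, dist z w = kobayashiDist E z w := fun _ _ => rfl
  have : CompleteSpace M := by
    refine Metric.complete_of_cauchySeq_tendsto fun u hu => ?_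
    obtain ⟨x, hx⟩ := hM.complete u fun ε hε => by
      obtain ⟨N, hN⟩ := Metric.cauchySeq_iff.1 hu ε hε
      exact ⟨N, fun m hm n hn => hN m hm n hn⟩
    exact ⟨x, tendsto_iff_dist_tendsto_zero.2 hx⟩
  exact properSpace_of_intermediate fun x y r ρ h h1 h2 => exists_intermediate (E := E) h h1 h2

end Barth

/-! ### Curves and tangent vectors read in charts -/

section Charts

variable {E : Type*} [NormedAddCommGroup E] [NormedSpace ℂ E]
  {M : Type*} [TopologicalSpace M] [ChartedSpace E M]

/-- The real manifold underlying a complex manifold. -/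
theorem isManifold_real [IsManifold 𝓘(ℂ, E) ω M] : IsManifold 𝓘(ℝ, E) 1 M := by
  refine isManifold_of_contDiffOn _ _ _ fun e e' he he' => ?_
  have h1 : e.symm ≫ₕ e' ∈ contDiffGroupoid ω 𝓘(ℂ, E) := HasGroupoid.compatible he he'
  rw [contDiffGroupoid, mem_groupoid_of_pregroupoid] at h1
  exact (ContDiffOn.restrict_scalars ℝ h1.1).of_le le_top

theorem hasFDerivWithinAt_smulRight_iff {F : Type*} [NormedAddCommGroup F] [NormedSpace ℝ F]
    {x : ℝ → F} {s : Set ℝ} {t : ℝ} {v : F} :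
    HasFDerivWithinAt x ((1 : ℝ →L[ℝ] ℝ).smulRight v) s t ↔ HasDerivWithinAt x v s t := by
  rw [hasDerivWithinAt_iff_hasFDerivWithinAt]
  have : (1 : ℝ →L[ℝ] ℝ).smulRight v = ContinuousLinearMap.toSpanSingleton ℝ v := by ext; simp
  rw [this]

theorem hasMFDerivWithinAt_curve_iff {x : ℝ → M} {s : Set ℝ} {t : ℝ}
    {v : TangentSpace 𝓘(ℂ, E) (x t)} :
    HasMFDerivWithinAt 𝓘(ℝ, ℝ) 𝓘(ℝ, E) x s t ((1 : ℝ →L[ℝ] ℝ).smulRight (realVec E v)) ↔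
      ContinuousWithinAt x s t ∧
        HasDerivWithinAt (F := E) (fun τ => chartAt E (x t) (x τ)) v s t := by
  refine Iff.trans ?_ (and_congr_right fun _ => hasFDerivWithinAt_smulRight_iff (F := E))
  unfold HasMFDerivWithinAt
  simp only [mfld_simps, inter_univ]
  rfl

variable [IsManifold 𝓘(ℂ, E) 1 M]

/-- The tangent vector `v` at `z`, read in the chart at `q`. -/
def chartVec (q z : M) (v : TangentSpace 𝓘(ℂ, E) z) : E := tangentCoordChange 𝓘(ℂ, E) z q z v

theorem hasDerivWithinAt_chart_change {x : ℝ → M} {s : Set ℝ} {t : ℝ} {q q' : M} {u : E}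
    (hc : ContinuousWithinAt x s t)
    (hq : x t ∈ (chartAt E q).source) (hq' : x t ∈ (chartAt E q').source)
    (h : HasDerivWithinAt (fun τ => chartAt E q (x τ)) u s t) :
    HasDerivWithinAt (fun τ => chartAt E q' (x τ)) (tangentCoordChange 𝓘(ℂ, E) q q' (x t) u) s t := by
  have h1 := hasFDerivWithinAt_tangentCoordChange (I := 𝓘(ℂ, E)) (x := q) (y := q') (z := x t)
    (by simpa using ⟨hq, hq'⟩)
  simp only [mfld_simps, hasFDerivWithinAt_univ] at h1
  have h2 := (h1.restrictScalars ℝ).comp_hasDerivWithinAt_of_eq t h rfl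
  refine h2.congr_of_eventuallyEq ?_ ?_
  · filter_upwards [hc ((chartAt E q).open_source.mem_nhds hq)] with τ hτ
    simp [(chartAt E q).left_inv hτ]
  · simp [(chartAt E q).left_inv hq]

/-- The tangent vector at `z` whose reading in the chart at `q` is `u`. -/
def chartVecSymm (q z : M) (u : E) : TangentSpace 𝓘(ℂ, E) z := tangentCoordChange 𝓘(ℂ, E) q z z u

theorem chartVec_smul (q z : M) (c : ℂ) (v : TangentSpace 𝓘(ℂ, E) z) :
    chartVec q z (c • v) = c • chartVec q z v := map_smul (tangentCoordChange 𝓘(ℂ, E) z q z) c v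

theorem chartVec_zero (q z : M) : chartVec q z (0 : TangentSpace 𝓘(ℂ, E) z) = 0 :=
  map_zero (tangentCoordChange 𝓘(ℂ, E) z q z)

theorem chartVec_self (z : M) (v : TangentSpace 𝓘(ℂ, E) z) : chartVec z z v = v :=
  tangentCoordChange_self (by simp)

theorem chartVec_chartVecSymm {q z : M} (hz : z ∈ (chartAt E q).source) (u : E) :
    chartVec q z (chartVecSymm q z u) = u := by
  unfold chartVec chartVecSymm
  rw [tangentCoordChange_comp (by simpa using hz)]
  exact tangentCoordChange_self (by simpa using hz)

theorem chartVecSymm_chartVec {q z : M} (hz : z ∈ (chartAt E q).source)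
    (v : TangentSpace 𝓘(ℂ, E) z) : chartVecSymm q z (chartVec q z v) = v :=
  (tangentCoordChange_comp (I := 𝓘(ℂ, E)) (by simpa using hz)).trans
    (tangentCoordChange_self (by simp))

theorem chartVec_injective {q z : M} (hz : z ∈ (chartAt E q).source) :
    Function.Injective (chartVec q z : TangentSpace 𝓘(ℂ, E) z → E) :=
  Function.LeftInverse.injective (chartVecSymm_chartVec hz)

/-- The manifold derivative refers to the preferred chart at the moving point `x t`. The transition
maps and the chain rule allow one fixed chart at `q` instead, in which the analysis of curves is
carried out. -/
theorem hasMFDerivWithinAt_curve_iff_chart {x : ℝ → M} {s : Set ℝ} {t : ℝ}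
    {v : TangentSpace 𝓘(ℂ, E) (x t)} {q : M} (hq : x t ∈ (chartAt E q).source) :
    HasMFDerivWithinAt 𝓘(ℝ, ℝ) 𝓘(ℝ, E) x s t ((1 : ℝ →L[ℝ] ℝ).smulRight (realVec E v)) ↔
      ContinuousWithinAt x s t ∧
        HasDerivWithinAt (fun τ => chartAt E q (x τ)) (chartVec q (x t) v) s t := by
  rw [hasMFDerivWithinAt_curve_iff]
  refine and_congr_right fun hc => ⟨fun h => ?_, fun h => ?_⟩
  · exact hasDerivWithinAt_chart_change hc (mem_chart_source E (x t)) hq h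
  · have := hasDerivWithinAt_chart_change hc hq (mem_chart_source E (x t)) h
    rwa [show tangentCoordChange 𝓘(ℂ, E) q (x t) (x t) (chartVec q (x t) v) = v from
      chartVecSymm_chartVec hq v] at this

theorem hasMFDerivAt_curve_iff_chart {x : ℝ → M} {t : ℝ}
    {v : TangentSpace 𝓘(ℂ, E) (x t)} {q : M} (hq : x t ∈ (chartAt E q).source) :
    HasMFDerivAt 𝓘(ℝ, ℝ) 𝓘(ℝ, E) x t ((1 : ℝ →L[ℝ] ℝ).smulRight (realVec E v)) ↔
      ContinuousAt x t ∧
        HasDerivAt (fun τ => chartAt E q (x τ)) (chartVec q (x t) v) t := by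
  refine hasMFDerivWithinAt_univ.symm.trans ((hasMFDerivWithinAt_curve_iff_chart hq).trans ?_)
  rw [continuousWithinAt_univ, hasDerivWithinAt_univ]

/-- The preimage of a ball in the chart at `q`. -/
def chartBall (E : Type*) [NormedAddCommGroup E] {M : Type*} [TopologicalSpace M]
    [ChartedSpace E M] (q : M) (R : ℝ) : Set M :=
  (chartAt E q).source ∩ chartAt E q ⁻¹' Metric.ball (chartAt E q q) R

omit [NormedSpace ℂ E] [IsManifold 𝓘(ℂ, E) 1 M] in
theorem chartBall_mem_nhds (q : M) {R : ℝ} (hR : 0 < R) : chartBall E q R ∈ 𝓝 q :=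
  inter_mem ((chartAt E q).open_source.mem_nhds (mem_chart_source E q))
    (((chartAt E q).continuousAt (mem_chart_source E q)).preimage_mem_nhds
      (Metric.ball_mem_nhds _ hR))

omit [NormedSpace ℂ E] [IsManifold 𝓘(ℂ, E) 1 M] in
theorem isOpen_chartBall (q : M) (R : ℝ) : IsOpen (chartBall E q R) :=
  (chartAt E q).continuousOn.isOpen_inter_preimage (chartAt E q).open_source Metric.isOpen_ball

omit [NormedSpace ℂ E] [IsManifold 𝓘(ℂ, E) 1 M] in
theorem chartBall_mono (q : M) {R R' : ℝ} (h : R ≤ R') : chartBall E q R ⊆ chartBall E q R' :=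
  inter_subset_inter_right _ (preimage_mono (Metric.ball_subset_ball h))

omit [NormedSpace ℂ E] [IsManifold 𝓘(ℂ, E) 1 M] in
theorem exists_chartBall_subset {q : M} {U : Set M} (hU : U ∈ 𝓝 q) :
    ∃ R > 0, Metric.ball (chartAt E q q) R ⊆ (chartAt E q).target ∧ chartBall E q R ⊆ U := by
  have hq := mem_chart_source E q
  have h1 : (chartAt E q).target ∩ (chartAt E q).symm ⁻¹' U ∈ 𝓝 (chartAt E q q) := by
    refine inter_mem ((chartAt E q).open_target.mem_nhds ((chartAt E q).map_source hq)) ?_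
    refine ((chartAt E q).continuousAt_symm ((chartAt E q).map_source hq)).preimage_mem_nhds ?_
    rwa [(chartAt E q).left_inv hq]
  obtain ⟨R, hR, hsub⟩ := Metric.mem_nhds_iff.1 h1
  refine ⟨R, hR, fun y hy => (hsub hy).1, fun z hz => ?_⟩
  have := (hsub hz.2).2
  rwa [mem_preimage, (chartAt E q).left_inv hz.1] at this

end Charts

/-! ### Hermitian norms compared with norms in charts -/

section Metric

variable {E : Type*} [NormedAddCommGroup E] [NormedSpace ℂ E]
  {M : Type*} [TopologicalSpace M] [ChartedSpace E M] [IsManifold 𝓘(ℂ, E) ω M]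
  (h : HermitianMetric E M)

namespace HermitianMetric

theorem norm_nonneg (z : M) (v : TangentSpace 𝓘(ℂ, E) z) : 0 ≤ h.norm z v := Real.sqrt_nonneg _

theorem norm_smul (z : M) (c : ℂ) (v : TangentSpace 𝓘(ℂ, E) z) :
    h.norm z (c • v) = ‖c‖ * h.norm z v := by
  have h1 : (h.inner z (c • v) (c • v)).re = ‖c‖ ^ 2 * (h.inner z v v).re := by
    simp only [map_smulₛₗ, LinearMap.smul_apply, RingHom.id_apply, smul_eq_mul]
    rw [← mul_assoc, Complex.mul_conj, Complex.normSq_eq_norm_sq, Complex.re_ofReal_mul]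
  rw [norm, norm, h1, Real.sqrt_mul (by positivity), Real.sqrt_sq (_root_.norm_nonneg c)]

theorem norm_real_smul (z : M) (c : ℝ) (v : TangentSpace 𝓘(ℝ, E) z) :
    h.norm z (c • v : TangentSpace 𝓘(ℝ, E) z) = |c| * h.norm z v := by
  have h1 := h.norm_smul z (c : ℂ) v
  rwa [Complex.norm_real, Real.norm_eq_abs] at h1

/-- The Hermitian norm is locally equivalent to the norm in a chart. -/
theorem exists_norm_comparison [FiniteDimensional ℂ E] (q : M) :
    ∃ A > 0, ∃ U ∈ 𝓝 q, ∀ z ∈ U, ∀ v : TangentSpace 𝓘(ℂ, E) z,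
      ‖chartVec q z v‖ ≤ A * h.norm z v ∧ h.norm z v ≤ A * ‖chartVec q z v‖ := by
  have : ProperSpace E := FiniteDimensional.proper ℂ E
  have : LocallyCompactSpace M := ChartedSpace.locallyCompactSpace E M
  obtain ⟨K, hK, hKs, hKc⟩ := local_compact_nhds
    ((chartAt E q).open_source.mem_nhds (mem_chart_source E q))
  set e := trivializationAt E (TangentSpace 𝓘(ℂ, E) : M → Type _) q with he
  set Q : TangentBundle 𝓘(ℂ, E) M → ℝ := fun v => (h.inner v.proj v.snd v.snd).re with hQ
  have hbase : e.baseSet = (chartAt E q).source := rfl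
  -- On this compact set the squared norm has a positive lower and a finite upper bound; homogeneity
  -- extends the comparison to all vectors.
  set S : Set (M × E) := K ×ˢ Metric.sphere (0 : E) 1 with hS
  have hSc : IsCompact S := hKc.prod (isCompact_sphere 0 1)
  have hST : S ⊆ e.target := fun p hp => by
    rw [e.mem_target, hbase]
    exact hKs hp.1
  have hfc : ContinuousOn (fun p => Q (e.toOpenPartialHomeomorph.symm p)) S :=
    h.continuous.comp_continuousOn (e.toOpenPartialHomeomorph.continuousOn_symm.mono hST)
  have hfpos : ∀ p ∈ S, 0 < Q (e.toOpenPartialHomeomorph.symm p) := fun p hp => by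
    refine h.pos _ _ fun h0 => ?_
    have h1 : e (e.toOpenPartialHomeomorph.symm p) = p :=
      e.toOpenPartialHomeomorph.right_inv (hST hp)
    have h2 : chartVec q _ (e.toOpenPartialHomeomorph.symm p).snd = p.2 := congrArg Prod.snd h1
    rw [h0, chartVec_zero] at h2
    have h3 := mem_sphere_zero_iff_norm.1 hp.2
    rw [← h2] at h3
    simp at h3
  obtain ⟨m, hm, B, hB, hmB⟩ : ∃ m > 0, ∃ B > 0, ∀ p ∈ S,
      m ≤ Q (e.toOpenPartialHomeomorph.symm p) ∧ Q (e.toOpenPartialHomeomorph.symm p) ≤ B := by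
    rcases S.eq_empty_or_nonempty with h0 | h0
    · exact ⟨1, one_pos, 1, one_pos, by simp [h0]⟩
    · obtain ⟨p, hp, hmin⟩ := hSc.exists_isMinOn h0 hfc
      obtain ⟨p', hp', hmax⟩ := hSc.exists_isMaxOn h0 hfc
      exact ⟨_, hfpos p hp, _, hfpos p' hp', fun y hy => ⟨hmin hy, hmax hy⟩⟩
  have key : ∀ z ∈ K, ∀ v : TangentSpace 𝓘(ℂ, E) z,
      √m * ‖chartVec q z v‖ ≤ h.norm z v ∧ h.norm z v ≤ √B * ‖chartVec q z v‖ := by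
    intro z hz v
    by_cases hv : chartVec q z v = 0
    · have hv0 : v = 0 := chartVec_injective (hKs hz) (hv.trans (chartVec_zero q z).symm)
      have : h.norm z v = 0 := by rw [hv0, norm]; simp
      simp [this, hv]
    · have hn : 0 < ‖chartVec q z v‖ := norm_pos_iff.2 hv
      set c : ℂ := ((‖chartVec q z v‖⁻¹ : ℝ) : ℂ) with hc
      have hcn : ‖c‖ = ‖chartVec q z v‖⁻¹ := by
        rw [hc, Complex.norm_real, Real.norm_eq_abs, abs_of_pos (inv_pos.2 hn)]
      have hp : (z, chartVec q z (c • v)) ∈ S := by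
        refine ⟨hz, mem_sphere_zero_iff_norm.2 ?_⟩
        rw [chartVec_smul, _root_.norm_smul, hcn, inv_mul_cancel₀ hn.ne']
      have h1 : e.toOpenPartialHomeomorph.symm (z, chartVec q z (c • v)) =
          (⟨z, c • v⟩ : TangentBundle 𝓘(ℂ, E) M) :=
        e.toOpenPartialHomeomorph.left_inv (x := (⟨z, c • v⟩ : TangentBundle 𝓘(ℂ, E) M))
          (e.mem_source.2 (hKs hz))
      have h2 := hmB _ hp
      rw [h1] at h2
      have h3 : h.norm z (c • v) = √(Q ⟨z, c • v⟩) := rfl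
      rw [h.norm_smul, hcn, inv_mul_eq_div, div_eq_iff hn.ne'] at h3
      rw [h3]
      exact ⟨by gcongr; exact h2.1, by gcongr; exact h2.2⟩
  refine ⟨max (√m)⁻¹ (√B), lt_max_of_lt_right (Real.sqrt_pos.2 hB), K, hK, fun z hz v => ⟨?_, ?_⟩⟩
  · have hm' := Real.sqrt_pos.2 hm
    have := (key z hz v).1
    calc ‖chartVec q z v‖ ≤ (√m)⁻¹ * h.norm z v := by
          rw [inv_mul_eq_div, le_div_iff₀ hm', mul_comm]; exact this
      _ ≤ _ := by gcongr; exacts [h.norm_nonneg z v, le_max_left _ _]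
  · exact (key z hz v).2.trans (by gcongr; exact le_max_right _ _)

end HermitianMetric

end Metric

/-! ### The distance of a Hermitian metric compared with charts and topology -/

theorem tendsto_ofReal_mul_abs_sub (c τ : ℝ) :
    Tendsto (fun σ => ENNReal.ofReal (c * |τ - σ|)) (𝓝 τ) (𝓝 0) := by
  have h1 : Tendsto (fun σ => c * |τ - σ|) (𝓝 τ) (𝓝 0) := by
    have : Continuous (fun σ => c * |τ - σ|) := by fun_prop
    simpa using this.tendsto τ
  simpa using ENNReal.tendsto_ofReal h1

namespace HermitianMetric

variable {E : Type*} [NormedAddCommGroup E] [NormedSpace ℂ E]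
  {M : Type*} [TopologicalSpace M] [ChartedSpace E M] [IsManifold 𝓘(ℂ, E) ω M]
  (h : HermitianMetric E M)

/-- The extended norm on the real tangent spaces given by a Hermitian metric. -/
abbrev eNorm (x : M) : ENorm (TangentSpace 𝓘(ℝ, E) x) := ⟨fun v => ENNReal.ofReal (h.norm x v)⟩

theorem eNormSMulClass (x : M) :
    letI : ∀ x : M, ENorm (TangentSpace 𝓘(ℝ, E) x) := h.eNorm
    ENormSMulClass ℝ (TangentSpace 𝓘(ℝ, E) x) := by
  let _ : ∀ x : M, ENorm (TangentSpace 𝓘(ℝ, E) x) := h.eNorm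
  refine ⟨fun c v => ?_⟩
  change ENNReal.ofReal (h.norm x (c • v : TangentSpace 𝓘(ℝ, E) x)) = ‖c‖ₑ * ENNReal.ofReal (h.norm x v)
  rw [h.norm_real_smul, ENNReal.ofReal_mul (abs_nonneg c), Real.enorm_eq_ofReal_abs]

theorem edist_self (z : M) : h.edist z z = 0 := by
  let _ : ∀ x : M, ENorm (TangentSpace 𝓘(ℝ, E) x) := h.eNorm
  have := h.eNormSMulClass
  exact Manifold.riemannianEDist_self

theorem edist_comm (z w : M) : h.edist z w = h.edist w z := by
  let _ : ∀ x : M, ENorm (TangentSpace 𝓘(ℝ, E) x) := h.eNorm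
  have := h.eNormSMulClass
  exact Manifold.riemannianEDist_comm

theorem edist_triangle (z y w : M) : h.edist z w ≤ h.edist z y + h.edist y w := by
  have : IsManifold 𝓘(ℝ, E) 1 M := isManifold_real
  let _ : ∀ x : M, ENorm (TangentSpace 𝓘(ℝ, E) x) := h.eNorm
  have := h.eNormSMulClass
  exact Manifold.riemannianEDist_triangle

/-- The distance is bounded by the distance in a chart. -/
theorem edist_le_of_norm_le {q : M} {A R : ℝ}
    (hR : Metric.ball (chartAt E q q) R ⊆ (chartAt E q).target)
    (hb : ∀ z ∈ chartBall E q R, ∀ v : TangentSpace 𝓘(ℂ, E) z, h.norm z v ≤ A * ‖chartVec q z v‖)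
    {z w : M} (hz : z ∈ chartBall E q R) (hw : w ∈ chartBall E q R) :
    h.edist z w ≤ ENNReal.ofReal (A * ‖chartAt E q z - chartAt E q w‖) := by
  have : IsManifold 𝓘(ℝ, E) 1 M := isManifold_real
  let _ : ∀ x : M, ENorm (TangentSpace 𝓘(ℝ, E) x) := h.eNorm
  have := h.eNormSMulClass
  set χ := chartAt E q with hχ
  set η : ℝ → E := fun t => χ z + t • (χ w - χ z) with hη
  set γ : ℝ → M := fun t => χ.symm (η t) with hγ
  have hηball : ∀ t ∈ Icc (0 : ℝ) 1, η t ∈ Metric.ball (χ q) R := fun t ht =>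
    (convex_ball (χ q) R).add_smul_sub_mem hz.2 hw.2 ht
  have hγball : ∀ t ∈ Icc (0 : ℝ) 1, γ t ∈ chartBall E q R := fun t ht =>
    ⟨χ.map_target (hR (hηball t ht)), by
      rw [mem_preimage, ← hχ, hγ, χ.right_inv (hR (hηball t ht))]; exact hηball t ht⟩
  have hsm : ContMDiffOn 𝓘(ℝ, ℝ) 𝓘(ℝ, E) 1 γ (Icc 0 1) := by
    have h1 : ContMDiffOn 𝓘(ℝ, E) 𝓘(ℝ, E) 1 χ.symm χ.target := contMDiffOn_chart_symm
    refine h1.comp (t := χ.target) (ContDiff.contMDiff (by fun_prop)).contMDiffOn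
      fun t ht => hR (hηball t ht)
  have h1 : h.edist z w ≤ Manifold.pathELength 𝓘(ℝ, E) γ 0 1 :=
    Manifold.riemannianEDist_le_pathELength hsm (by simp [hγ, hη, χ.left_inv hz.1])
      (by simp [hγ, hη, χ.left_inv hw.1]) zero_le_one
  refine h1.trans ?_
  rw [Manifold.pathELength_eq_lintegral_mfderiv_Ioo]
  have h2 : ∀ t ∈ Ioo (0 : ℝ) 1, ‖mfderiv 𝓘(ℝ, ℝ) 𝓘(ℝ, E) γ t 1‖ₑ ≤
      ENNReal.ofReal (A * ‖χ z - χ w‖) := by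
    intro t ht
    have ht' := Ioo_subset_Icc_self ht
    have hc : ContinuousAt γ t := by
      refine ContinuousAt.comp (g := χ.symm) (χ.continuousAt_symm (hR (hηball t ht'))) ?_
      fun_prop
    have hd : HasMFDerivAt 𝓘(ℝ, ℝ) 𝓘(ℝ, E) γ t
        ((1 : ℝ →L[ℝ] ℝ).smulRight (realVec E (chartVecSymm q (γ t) (χ w - χ z)))) := by
      refine (hasMFDerivAt_curve_iff_chart (hγball t ht').1).2 ⟨hc, ?_⟩
      rw [chartVec_chartVecSymm (hγball t ht').1]
      have h3 : HasDerivAt η (χ w - χ z) t := by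
        have := ((hasDerivAt_id t).smul_const (χ w - χ z)).const_add (χ z)
        rwa [one_smul] at this
      refine h3.congr_of_eventuallyEq ?_
      filter_upwards [Ioo_mem_nhds ht.1 ht.2] with σ hσ
      exact χ.right_inv (hR (hηball σ (Ioo_subset_Icc_self hσ)))
    rw [hd.mfderiv]
    have h4 : ((1 : ℝ →L[ℝ] ℝ).smulRight (realVec E (chartVecSymm q (γ t) (χ w - χ z)))) 1 =
        realVec E (chartVecSymm q (γ t) (χ w - χ z)) := by simp
    refine (congrArg (fun v => ENNReal.ofReal (h.norm (γ t) v)) h4).le.trans ?_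
    refine ENNReal.ofReal_le_ofReal ((hb _ (hγball t ht') _).trans_eq ?_)
    rw [norm_sub_rev]
    exact congrArg (fun u => A * ‖u‖) (chartVec_chartVecSymm (hγball t ht').1 (χ w - χ z))
  refine (setLIntegral_mono' measurableSet_Ioo h2).trans_eq ?_
  simp

/-- The extension by zero of a compactly supported function, read in the chart at `q`. -/
def chartExtend {F : Type*} [Zero F] (q : M) (Ψ : E → F) : M → F :=
  (chartAt E q).source.indicator (Ψ ∘ chartAt E q)

section ChartExtend

variable {F : Type*} [NormedAddCommGroup F] [NormedSpace ℝ F] {q : M} {Ψ : E → F}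

omit [NormedSpace ℂ E] [IsManifold 𝓘(ℂ, E) ω M] [NormedSpace ℝ F] in
theorem chartExtend_eventuallyEq {z : M} (hz : z ∈ (chartAt E q).source) :
    chartExtend q Ψ =ᶠ[𝓝 z] Ψ ∘ chartAt E q := by
  filter_upwards [(chartAt E q).open_source.mem_nhds hz] with w hw
  exact indicator_of_mem hw _

omit [NormedSpace ℂ E] [IsManifold 𝓘(ℂ, E) ω M] [NormedSpace ℝ F] in
theorem chartExtend_eventuallyEq_zero [T2Space M] (hc : HasCompactSupport Ψ)
    (hs : tsupport Ψ ⊆ (chartAt E q).target) {z : M} (hz : z ∉ (chartAt E q).source) :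
    chartExtend q Ψ =ᶠ[𝓝 z] fun _ => 0 := by
  set χ := chartAt E q with hχ
  have hK : IsCompact (χ.symm '' tsupport Ψ) :=
    hc.image_of_continuousOn (χ.continuousOn_symm.mono hs)
  have hzK : z ∉ χ.symm '' tsupport Ψ := by
    rintro ⟨y, hy, rfl⟩
    exact hz (χ.map_target (hs hy))
  filter_upwards [hK.isClosed.isOpen_compl.mem_nhds hzK] with w hw
  by_cases hws : w ∈ χ.source
  · rw [chartExtend, ← hχ, indicator_of_mem hws]
    by_contra h0
    exact hw ⟨χ w, subset_tsupport _ h0, χ.left_inv hws⟩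
  · exact indicator_of_notMem hws _

theorem contMDiff_chartExtend [T2Space M] (hc : HasCompactSupport Ψ)
    (hs : tsupport Ψ ⊆ (chartAt E q).target) (hΨ : ContDiff ℝ 1 Ψ) :
    ContMDiff 𝓘(ℝ, E) 𝓘(ℝ, F) 1 (chartExtend q Ψ : M → F) := by
  have : IsManifold 𝓘(ℝ, E) 1 M := isManifold_real
  intro z
  by_cases hz : z ∈ (chartAt E q).source
  · refine ContMDiffAt.congr_of_eventuallyEq ?_ (chartExtend_eventuallyEq hz)
    exact hΨ.contMDiff.contMDiffAt.comp z
      (contMDiffOn_chart.contMDiffAt ((chartAt E q).open_source.mem_nhds hz))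
  · exact contMDiffAt_const.congr_of_eventuallyEq (chartExtend_eventuallyEq_zero hc hs hz)

/-- Compactly supported `C¹` functions in a chart are Lipschitz for the distance on `M`. -/
theorem exists_enorm_chartExtend_sub_le [T2Space M] {A R : ℝ} (hA : 0 < A)
    (hR : Metric.ball (chartAt E q q) R ⊆ (chartAt E q).target)
    (hb : ∀ z ∈ chartBall E q R, ∀ v : TangentSpace 𝓘(ℂ, E) z, ‖chartVec q z v‖ ≤ A * h.norm z v)
    (hc : HasCompactSupport Ψ) (hs : tsupport Ψ ⊆ Metric.ball (chartAt E q q) R)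
    (hΨ : ContDiff ℝ 1 Ψ) : ∃ B > 0, ∀ z w : M,
      ‖chartExtend q Ψ z - chartExtend q Ψ w‖ₑ ≤ ENNReal.ofReal B * h.edist z w := by
  have : IsManifold 𝓘(ℝ, E) 1 M := isManifold_real
  let _ : ∀ x : M, ENorm (TangentSpace 𝓘(ℝ, E) x) := h.eNorm
  obtain ⟨B₀, hB₀⟩ := (hΨ.continuous_fderiv one_ne_zero).bounded_above_of_compact_support
    (hc.fderiv ℝ)
  have hB₀0 : 0 ≤ B₀ := (_root_.norm_nonneg _).trans (hB₀ 0)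
  -- The summand `1` makes the constant positive, so that it can be moved across the inequality by
  -- division.
  have hBp : 0 < (B₀ + 1) * A := by positivity
  refine ⟨(B₀ + 1) * A, hBp, fun z w => ?_⟩
  set f : M → F := chartExtend q Ψ with hf
  have hfs : ContMDiff 𝓘(ℝ, E) 𝓘(ℝ, F) 1 f := contMDiff_chartExtend hc (hs.trans hR) hΨ
  have hB0 : ENNReal.ofReal ((B₀ + 1) * A) ≠ 0 := (ENNReal.ofReal_pos.2 hBp).ne'
  rw [mul_comm, ← ENNReal.div_le_iff_le_mul (Or.inl hB0) (Or.inl ENNReal.ofReal_ne_top)]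
  refine le_of_forall_gt fun r hr => ?_
  -- The path may leave the chart. Since the extension is globally `C¹` and its derivative vanishes
  -- off the coordinate ball, the bound on the derivative along `γ` holds at all interior times.
  obtain ⟨γ, rfl, rfl, hγ, hlt⟩ := Manifold.exists_lt_of_riemannianEDist_lt hr
  refine lt_of_le_of_lt ?_ hlt
  rw [ENNReal.div_le_iff_le_mul (Or.inl hB0) (Or.inl ENNReal.ofReal_ne_top), mul_comm,
    Manifold.pathELength_eq_lintegral_mfderiv_Ioo, ← lintegral_const_mul' _ _ ENNReal.ofReal_ne_top]
  have hfγ : ContDiffOn ℝ 1 (f ∘ γ) (Icc 0 1) :=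
    contMDiffOn_iff_contDiffOn.1 (hfs.comp_contMDiffOn hγ)
  have h1 := enorm_sub_le_lintegral_deriv_of_contDiffOn_Icc hfγ zero_le_one
  rw [← restrict_Ioo_eq_restrict_Icc, enorm_sub_rev] at h1
  refine h1.trans (setLIntegral_mono' measurableSet_Ioo fun t ht => ?_)
  have hd : MDifferentiableAt 𝓘(ℝ, ℝ) 𝓘(ℝ, E) γ t :=
    (hγ.contMDiffAt (Icc_mem_nhds ht.1 ht.2)).mdifferentiableAt one_ne_zero
  set v : TangentSpace 𝓘(ℝ, E) (γ t) := mfderiv 𝓘(ℝ, ℝ) 𝓘(ℝ, E) γ t 1 with hv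
  have hd' : HasMFDerivAt 𝓘(ℝ, ℝ) 𝓘(ℝ, E) γ t ((1 : ℝ →L[ℝ] ℝ).smulRight (realVec E v)) := by
    refine hd.hasMFDerivAt.congr_mfderiv (ContinuousLinearMap.ext_ring ?_)
    exact (one_smul ℝ v).symm
  suffices hsuf : ‖deriv (f ∘ γ) t‖ ≤ (B₀ + 1) * A * h.norm (γ t) v by
    rw [← ofReal_norm]
    refine (ENNReal.ofReal_le_ofReal hsuf).trans_eq ?_
    rw [ENNReal.ofReal_mul hBp.le]
    rfl
  have hnn : 0 ≤ (B₀ + 1) * A * h.norm (γ t) v := mul_nonneg hBp.le (h.norm_nonneg _ _)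
  by_cases hts : γ t ∈ (chartAt E q).source
  · have h2 := ((hasMFDerivAt_curve_iff_chart hts).1 hd').2
    have h3 : HasDerivAt (f ∘ γ) (fderiv ℝ Ψ (chartAt E q (γ t)) (chartVec q (γ t) v)) t := by
      have h4 := ((hΨ.differentiable one_ne_zero) (chartAt E q (γ t))).hasFDerivAt.comp_hasDerivAt_of_eq
        t h2 rfl
      exact h4.congr_of_eventuallyEq (hd.continuousAt.eventually (chartExtend_eventuallyEq hts))
    rw [h3.deriv]
    by_cases hball : chartAt E q (γ t) ∈ Metric.ball (chartAt E q q) R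
    · calc _ ≤ ‖fderiv ℝ Ψ (chartAt E q (γ t))‖ * ‖chartVec q (γ t) v‖ :=
            ContinuousLinearMap.le_opNorm _ _
        _ ≤ (B₀ + 1) * (A * h.norm (γ t) v) := by
            gcongr
            · exact (hB₀ _).trans (by linarith)
            · exact hb _ ⟨hts, hball⟩ v
        _ = _ := by ring
    · rw [fderiv_of_notMem_tsupport ℝ (fun hmem => hball (hs hmem))]
      simpa using hnn
  · have h3 : f ∘ γ =ᶠ[𝓝 t] fun _ => 0 :=
      hd.continuousAt.eventually (chartExtend_eventuallyEq_zero hc (hs.trans hR) hts)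
    rw [h3.deriv_eq]
    simpa using hnn

end ChartExtend

variable [FiniteDimensional ℂ E] [T2Space M]

/-- The metric is locally equivalent to the norm in a chart, both on tangent vectors and for the
distances. -/
theorem exists_comparison (q : M) : ∃ A > 0, ∃ R > 0,
    Metric.ball (chartAt E q q) R ⊆ (chartAt E q).target ∧
    (∀ z ∈ chartBall E q R, ∀ v : TangentSpace 𝓘(ℂ, E) z,
      ‖chartVec q z v‖ ≤ A * h.norm z v ∧ h.norm z v ≤ A * ‖chartVec q z v‖) ∧
    ∀ z ∈ chartBall E q R, ∀ w ∈ chartBall E q R,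
      h.edist z w ≤ ENNReal.ofReal (A * ‖chartAt E q z - chartAt E q w‖) ∧
      ‖chartAt E q z - chartAt E q w‖ₑ ≤ ENNReal.ofReal A * h.edist z w := by
  obtain ⟨A, hA, U, hU, hAU⟩ := h.exists_norm_comparison q
  obtain ⟨R, hR, hRt, hRU⟩ := exists_chartBall_subset (E := E) hU
  have : FiniteDimensional ℝ E := FiniteDimensional.complexToReal E
  let ψ : ContDiffBump (chartAt E q q) := ⟨R / 4, R / 2, by positivity, by linarith⟩
  -- The test map is the coordinate map times a bump function, which is the chart itself on the ball
  -- of radius `R / 4`.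
  obtain ⟨B, hB, hBl⟩ := h.exists_enorm_chartExtend_sub_le (F := E) (q := q)
    (Ψ := fun y => ψ y • y) hA hRt (fun z hz v => (hAU z (hRU hz) v).1) ψ.hasCompactSupport.smul_right
    ((tsupport_smul_subset_left _ _).trans (by
      rw [ψ.tsupport_eq]; exact Metric.closedBall_subset_ball (by change R / 2 < R; linarith)))
    (ψ.contDiff.smul contDiff_id)
  have hsub : chartBall E q (R / 4) ⊆ chartBall E q R := chartBall_mono q (by linarith)
  have hext : ∀ z ∈ chartBall E q (R / 4), chartExtend q (fun y => ψ y • y) z = chartAt E q z :=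
    fun z hz => by
      rw [chartExtend, indicator_of_mem hz.1, Function.comp_apply,
        ψ.one_of_mem_closedBall (Metric.ball_subset_closedBall hz.2), one_smul]
  refine ⟨max A B, lt_max_of_lt_left hA, R / 4, by positivity,
    (Metric.ball_subset_ball (by linarith)).trans hRt, fun z hz v => ⟨?_, ?_⟩,
    fun z hz w hw => ⟨?_, ?_⟩⟩
  · refine (hAU z (hRU (hsub hz)) v).1.trans ?_
    gcongr
    exacts [h.norm_nonneg z v, le_max_left _ _]
  · exact (hAU z (hRU (hsub hz)) v).2.trans (by gcongr; exact le_max_left _ _)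
  · refine (h.edist_le_of_norm_le hRt (fun z hz v => (hAU z (hRU hz) v).2)
      (hsub hz) (hsub hw)).trans (ENNReal.ofReal_le_ofReal ?_)
    gcongr
    exact le_max_left _ _
  · have := hBl z w
    rw [hext z hz, hext w hw] at this
    exact this.trans (by gcongr; exact le_max_right _ _)

/-- Small balls of the distance are small in the topology of `M`. -/
theorem exists_edist_lt_imp_mem {q : M} {U : Set M} (hU : U ∈ 𝓝 q) :
    ∃ ε > 0, ∀ w, h.edist q w < ENNReal.ofReal ε → w ∈ U := by
  obtain ⟨A, hA, V, hV, hAV⟩ := h.exists_norm_comparison q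
  obtain ⟨R, hR, hRt, hRU⟩ := exists_chartBall_subset (E := E) (inter_mem hU hV)
  have : FiniteDimensional ℝ E := FiniteDimensional.complexToReal E
  let ψ : ContDiffBump (chartAt E q q) := ⟨R / 4, R / 2, by positivity, by linarith⟩
  obtain ⟨B, hB, hBl⟩ := h.exists_enorm_chartExtend_sub_le (q := q)
    (Ψ := ψ) hA hRt (fun z hz v => (hAV z (hRU hz).2 v).1) ψ.hasCompactSupport (by
      rw [ψ.tsupport_eq]; exact Metric.closedBall_subset_ball (by change R / 2 < R; linarith))
    ψ.contDiff
  -- The bump function equals `1` at `q` and is `B`-Lipschitz, so it cannot vanish at distance less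
  -- than `1 / B`.
  refine ⟨1 / B, by positivity, fun w hw => ?_⟩
  have h1 := hBl q w
  have h2 : chartExtend q ψ q = 1 := by
    rw [chartExtend, indicator_of_mem (mem_chart_source E q), Function.comp_apply]
    exact ψ.one_of_mem_closedBall (Metric.mem_closedBall_self (by positivity))
  have h3 : chartExtend q ψ w ≠ 0 := by
    intro h0
    rw [h2, h0, sub_zero, enorm_one] at h1
    refine absurd h1 (not_le.2 ?_)
    calc ENNReal.ofReal B * h.edist q w < ENNReal.ofReal B * ENNReal.ofReal (1 / B) := by
          exact ENNReal.mul_lt_mul_right (by simp [hB]) (by simp) hw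
      _ = 1 := by rw [← ENNReal.ofReal_mul hB.le]; field_simp; simp
  have hws : w ∈ (chartAt E q).source := by
    by_contra hcon
    exact h3 (indicator_of_notMem hcon _)
  rw [chartExtend, indicator_of_mem hws, Function.comp_apply] at h3
  have h4 : chartAt E q w ∈ Function.support ψ := h3
  rw [ψ.support_eq] at h4
  exact (hRU ⟨hws, Metric.ball_subset_ball (by change R / 2 ≤ R; linarith) h4⟩).1

/-- Small coordinate balls are small for the distance, and small distance balls lie in given
neighbourhoods. Continuity of orbits thus follows from their Lipschitz bounds. -/
theorem tendsto_nhds_iff {ι : Type*} {l : Filter ι} {f : ι → M} {q : M} :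
    Tendsto f l (𝓝 q) ↔ Tendsto (fun i => h.edist q (f i)) l (𝓝 0) := by
  refine ⟨fun hf => ?_, fun hf => tendsto_def.2 fun U hU => ?_⟩
  · obtain ⟨A, hA, R, hR, -, -, hAR⟩ := h.exists_comparison q
    have h1 : Tendsto (fun i => ENNReal.ofReal (A * ‖chartAt E q q - chartAt E q (f i)‖)) l
        (𝓝 0) := by
      have h2 : Tendsto (fun i => chartAt E q (f i)) l (𝓝 (chartAt E q q)) :=
        ((chartAt E q).continuousAt (mem_chart_source E q)).tendsto.comp hf
      have h3 := ENNReal.tendsto_ofReal (((tendsto_const_nhds (x := chartAt E q q)).sub h2).norm.const_mul A)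
      simpa using h3
    refine tendsto_of_tendsto_of_tendsto_of_le_of_le' tendsto_const_nhds h1
      (Eventually.of_forall fun _ => zero_le) ?_
    filter_upwards [hf (chartBall_mem_nhds (E := E) q hR)] with i hi
    exact (hAR q (mem_of_mem_nhds (chartBall_mem_nhds q hR)) _ hi).1
  · obtain ⟨ε, hε, hεU⟩ := h.exists_edist_lt_imp_mem hU
    filter_upwards [hf (gt_mem_nhds (ENNReal.ofReal_pos.2 hε))] with i hi
    exact hεU _ hi

theorem continuousOn_of_edist_le {x : ℝ → M} {S : Set ℝ} {c : ℝ}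
    (hx : ∀ τ ∈ S, ∀ τ' ∈ S, h.edist (x τ) (x τ') ≤ ENNReal.ofReal (c * |τ - τ'|)) :
    ContinuousOn x S := by
  intro τ hτ
  refine h.tendsto_nhds_iff.2 (tendsto_of_tendsto_of_tendsto_of_le_of_le' tendsto_const_nhds
    ((tendsto_ofReal_mul_abs_sub c τ).mono_left nhdsWithin_le_nhds)
    (Eventually.of_forall fun _ => zero_le) ?_)
  filter_upwards [self_mem_nhdsWithin] with σ hσ
  exact hx τ hτ σ hσ

end HermitianMetric

/-! ### Differentiating the Kobayashi distance along curves -/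

section Differential

variable {E : Type*} [NormedAddCommGroup E] [NormedSpace ℂ E]
  {M : Type*} [TopologicalSpace M] [T2Space M] [ChartedSpace E M]

/-- The chain rule for the Kobayashi distance along a pair of curves. -/
theorem hasDerivWithinAt_kobayashiDist (hk : KobayashiDistC1 E M) {x y : ℝ → M} {S : Set ℝ} {t : ℝ}
    {u : TangentSpace 𝓘(ℂ, E) (x t)} {v : TangentSpace 𝓘(ℂ, E) (y t)} (hne : x t ≠ y t)
    (hx : HasMFDerivWithinAt 𝓘(ℝ, ℝ) 𝓘(ℝ, E) x S t ((1 : ℝ →L[ℝ] ℝ).smulRight (realVec E u)))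
    (hy : HasMFDerivWithinAt 𝓘(ℝ, ℝ) 𝓘(ℝ, E) y S t ((1 : ℝ →L[ℝ] ℝ).smulRight (realVec E v))) :
    HasDerivWithinAt (fun τ => kobayashiDist E (x τ) (y τ)) (kobayashiDifferential E u v) S t := by
  have hopen : IsOpen {p : M × M | p.1 ≠ p.2} := isOpen_ne_fun continuous_fst continuous_snd
  have h1 : HasMFDerivAt (𝓘(ℝ, E).prod 𝓘(ℝ, E)) 𝓘(ℝ, ℝ)
      (fun p : M × M => kobayashiDist E p.1 p.2) (x t, y t)
      (mfderiv (𝓘(ℝ, E).prod 𝓘(ℝ, E)) 𝓘(ℝ, ℝ)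
        (fun p : M × M => kobayashiDist E p.1 p.2) (x t, y t)) :=
    ((hk.contMDiffAt (hopen.mem_nhds hne)).mdifferentiableAt one_ne_zero).hasMFDerivAt
  have h2 := h1.comp_hasMFDerivWithinAt t (hx.prodMk hy)
  have h3 : HasFDerivWithinAt (F := ℝ) (fun τ => kobayashiDist E (x τ) (y τ))
      ((1 : ℝ →L[ℝ] ℝ).smulRight (kobayashiDifferential E u v)) S t := by
    refine (hasMFDerivWithinAt_iff_hasFDerivWithinAt.1 h2).congr_fderiv
      (ContinuousLinearMap.ext_ring ?_)
    refine Eq.trans ?_ (one_smul ℝ _).symm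
    exact congrArg₂ (fun a b => mfderiv (𝓘(ℝ, E).prod 𝓘(ℝ, E)) 𝓘(ℝ, ℝ)
      (fun p : M × M => kobayashiDist E p.1 p.2) (x t, y t) (a, b))
      (one_smul ℝ (realVec E u)) (one_smul ℝ (realVec E v))
  exact hasFDerivWithinAt_smulRight_iff.1 h3

end Differential

/-! ### Trajectories of a vector field -/

section Trajectories

variable {E : Type*} [NormedAddCommGroup E] [NormedSpace ℂ E]
  {M : Type*} [TopologicalSpace M] [ChartedSpace E M] [IsManifold 𝓘(ℂ, E) ω M]

/-- The curve `x` solves the differential equation given by `G` on `[s, t]`. -/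
structure IsTrajectory (h : HermitianMetric E M) (G : ∀ z : M, ℝ → TangentSpace 𝓘(ℂ, E) z)
    (s t : ℝ) (x : ℝ → M) : Prop where
  lipschitz : ∃ c : ℝ, 0 ≤ c ∧ ∀ τ ∈ Icc s t, ∀ τ' ∈ Icc s t,
    h.edist (x τ) (x τ') ≤ ENNReal.ofReal (c * |τ - τ'|)
  hasDeriv : ∀ᵐ τ ∂volume.restrict (Icc s t), HasMFDerivAt 𝓘(ℝ, ℝ) 𝓘(ℝ, E) x τ
    ((1 : ℝ →L[ℝ] ℝ).smulRight (realVec E (G (x τ) τ)))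

namespace IsTrajectory

variable {h : HermitianMetric E M} {G : ∀ z : M, ℝ → TangentSpace 𝓘(ℂ, E) z}
  {s t u : ℝ} {x y : ℝ → M}

theorem mono (hx : IsTrajectory h G s t x) {s' t' : ℝ} (hs : s ≤ s') (ht : t' ≤ t) :
    IsTrajectory h G s' t' x := by
  have hsub := Icc_subset_Icc hs ht
  obtain ⟨c, hc, hcl⟩ := hx.lipschitz
  exact ⟨⟨c, hc, fun τ hτ τ' hτ' => hcl τ (hsub hτ) τ' (hsub hτ')⟩,
    ae_restrict_of_ae_restrict_of_subset hsub hx.hasDeriv⟩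

theorem congr (hx : IsTrajectory h G s t x) (hxy : EqOn x y (Icc s t)) :
    IsTrajectory h G s t y := by
  obtain ⟨c, hc, hcl⟩ := hx.lipschitz
  refine ⟨⟨c, hc, fun τ hτ τ' hτ' => by rw [← hxy hτ, ← hxy hτ']; exact hcl τ hτ τ' hτ'⟩, ?_⟩
  have h1 := hx.hasDeriv
  rw [← restrict_Ioo_eq_restrict_Icc, ae_restrict_iff' measurableSet_Ioo] at h1 ⊢
  filter_upwards [h1] with τ hτ1 hτ
  have h2 := (hτ1 hτ).congr_of_eventuallyEq (f₁ := y) (by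
    filter_upwards [Ioo_mem_nhds hτ.1 hτ.2] with σ hσ
    exact (hxy (Ioo_subset_Icc_self hσ)).symm)
  rw [hxy (Ioo_subset_Icc_self hτ)] at h2
  exact h2

theorem refl (h : HermitianMetric E M) (G : ∀ z : M, ℝ → TangentSpace 𝓘(ℂ, E) z) (s : ℝ)
    (x : ℝ → M) : IsTrajectory h G s s x := by
  refine ⟨⟨0, le_rfl, fun τ hτ τ' hτ' => ?_⟩, ?_⟩
  · rw [Icc_self, mem_singleton_iff] at hτ hτ'
    rw [hτ, hτ', h.edist_self]
    exact zero_le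
  · rw [← restrict_Ioo_eq_restrict_Icc, Ioo_self]
    simp

/-- Concatenation of trajectories. -/
theorem concat (hsu : s ≤ u) (hut : u ≤ t) (hx : IsTrajectory h G s u x)
    (hy : IsTrajectory h G u t y) (hxy : y u = x u) :
    IsTrajectory h G s t (fun τ => if τ ≤ u then x τ else y τ) := by
  set w : ℝ → M := fun τ => if τ ≤ u then x τ else y τ with hw
  have hwx : EqOn x w (Icc s u) := fun τ hτ => by simp [hw, hτ.2]
  have hwy : EqOn y w (Icc u t) := fun τ hτ => by
    rcases hτ.1.eq_or_lt with rfl | hlt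
    · simp [hw, hxy]
    · simp [hw, hlt]
  have hx' := hx.congr hwx
  have hy' := hy.congr hwy
  obtain ⟨c, hc, hcl⟩ := hx'.lipschitz
  obtain ⟨c', hc', hcl'⟩ := hy'.lipschitz
  have key : ∀ τ ∈ Icc s t, ∀ τ' ∈ Icc s t, τ ≤ τ' →
      h.edist (w τ) (w τ') ≤ ENNReal.ofReal ((c + c') * |τ - τ'|) := by
    intro τ hτ τ' hτ' hle
    rcases le_total τ' u with h1 | h1
    · refine (hcl τ ⟨hτ.1, hle.trans h1⟩ τ' ⟨hτ'.1, h1⟩).trans (ENNReal.ofReal_le_ofReal ?_)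
      gcongr; linarith
    rcases le_total u τ with h2 | h2
    · refine (hcl' τ ⟨h2, hτ.2⟩ τ' ⟨h1, hτ'.2⟩).trans (ENNReal.ofReal_le_ofReal ?_)
      gcongr; linarith
    · refine (h.edist_triangle _ (w u) _).trans ((add_le_add (hcl τ ⟨hτ.1, h2⟩ u ⟨hsu, le_rfl⟩)
        (hcl' u ⟨le_rfl, hut⟩ τ' ⟨h1, hτ'.2⟩)).trans ?_)
      rw [← ENNReal.ofReal_add (by positivity) (by positivity)]
      refine ENNReal.ofReal_le_ofReal ?_
      rw [abs_of_nonpos (by linarith), abs_of_nonpos (by linarith), abs_of_nonpos (by linarith)]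
      nlinarith
  refine ⟨⟨c + c', by positivity, fun τ hτ τ' hτ' => ?_⟩, ?_⟩
  · rcases le_total τ τ' with h1 | h1
    · exact key τ hτ τ' hτ' h1
    · rw [h.edist_comm, abs_sub_comm]
      exact key τ' hτ' τ hτ h1
  · rw [← Icc_union_Icc_eq_Icc hsu hut, ae_restrict_union_iff]
    exact ⟨hx'.hasDeriv, hy'.hasDeriv⟩

theorem continuousOn [FiniteDimensional ℂ E] [T2Space M] (hx : IsTrajectory h G s t x) :
    ContinuousOn x (Icc s t) :=
  let ⟨_, _, hcl⟩ := hx.lipschitz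
  h.continuousOn_of_edist_le hcl

end IsTrajectory

end Trajectories

/-! ### Contraction along a Herglotz field -/

section Contraction

variable {E : Type*} [NormedAddCommGroup E] [NormedSpace ℂ E] [FiniteDimensional ℂ E]
  {M : Type*} [MetricSpace M] [ConnectedSpace M] [ChartedSpace E M] [IsManifold 𝓘(ℂ, E) ω M]
  (hd : ∀ z w : M, dist z w = kobayashiDist E z w) (hk : KobayashiDistC1 E M)
  {h : HermitianMetric E M} {G : ∀ z : M, ℝ → TangentSpace 𝓘(ℂ, E) z}
  {s t : ℝ} {x y : ℝ → M}

include hd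

/-- The Kobayashi distance is locally bounded by the distance of a Hermitian metric. -/
theorem exists_dist_le_edist (h : HermitianMetric E M) (q : M) : ∃ A > 0, ∃ U ∈ 𝓝 q,
    ∀ z ∈ U, ∀ w ∈ U, ENNReal.ofReal (dist z w) ≤ ENNReal.ofReal A * h.edist z w := by
  obtain ⟨A, hA, R, hR, -, -, hAR⟩ := h.exists_comparison q
  obtain ⟨U, hU, B, hB, -, hBU⟩ := exists_kobayashiEDist_le (E := E) q
  refine ⟨B * A, by positivity, U ∩ chartBall E q R, inter_mem hU (chartBall_mem_nhds q hR),
    fun z hz w hw => ?_⟩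
  rw [hd, ofReal_kobayashiDist]
  refine (hBU z hz.1 w hw.1).trans ?_
  rw [ENNReal.ofReal_mul hB.le, ENNReal.ofReal_mul hB.le, mul_assoc, ofReal_norm]
  gcongr
  exact (hAR z hz.2 w hw.2).2

/-- Locally `k_M` is bounded by a multiple of the Hermitian distance, and compactness of the time
interval makes the resulting Lipschitz constant uniform. -/
theorem IsTrajectory.exists_lipschitzOnWith (hx : IsTrajectory h G s t x) :
    ∃ K, LipschitzOnWith K x (Icc s t) := by
  refine LocallyLipschitzOn.exists_lipschitzOnWith_of_compact isCompact_Icc fun τ hτ => ?_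
  obtain ⟨A, hA, U, hU, hAU⟩ := exists_dist_le_edist hd h (x τ)
  obtain ⟨c, hc, hcl⟩ := hx.lipschitz
  refine ⟨Real.toNNReal (A * c), Icc s t ∩ x ⁻¹' U,
    inter_mem self_mem_nhdsWithin (hx.continuousOn τ hτ hU), ?_⟩
  refine LipschitzOnWith.of_dist_le_mul fun σ hσ σ' hσ' => ?_
  rw [Real.coe_toNNReal _ (by positivity), Real.dist_eq]
  have h1 := (hAU _ hσ.2 _ hσ'.2).trans (mul_le_mul_right (hcl σ hσ.1 σ' hσ'.1) _)
  rw [← ENNReal.ofReal_mul hA.le] at h1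
  rw [mul_assoc]
  exact (ENNReal.ofReal_le_ofReal_iff (by positivity)).1 h1

include hk

/-- Trajectories of a Herglotz vector field approach each other. -/
theorem IsTrajectory.dist_le (hG : IsHerglotzVectorField h G) (hs : 0 ≤ s) (hst : s ≤ t)
    (hx : IsTrajectory h G s t x) (hy : IsTrajectory h G s t y) :
    dist (x t) (y t) ≤ dist (x s) (y s) := by
  obtain ⟨K, hK⟩ := hx.exists_lipschitzOnWith hd
  obtain ⟨L, hL⟩ := hy.exists_lipschitzOnWith hd
  have hlip : LipschitzOnWith (K + L) (fun τ => dist (x τ) (y τ)) (Icc s t) := by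
    refine LipschitzOnWith.of_dist_le_mul fun τ hτ τ' hτ' => ?_
    calc dist (dist (x τ) (y τ)) (dist (x τ') (y τ'))
        ≤ dist (x τ) (x τ') + dist (y τ) (y τ') := dist_dist_dist_le _ _ _ _
      _ ≤ K * dist τ τ' + L * dist τ τ' := add_le_add (hK.dist_le_mul τ hτ τ' hτ')
          (hL.dist_le_mul τ hτ τ' hτ')
      _ = _ := by push_cast; ring
  refine le_of_lipschitzOnWith_of_deriv_nonpos hst hlip ?_
  have h1 := hx.hasDeriv
  have h2 := hy.hasDeriv
  have h3 := hG.dissipative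
  rw [ae_restrict_iff' measurableSet_Icc] at h1 h2
  rw [ae_restrict_iff' measurableSet_Ici] at h3
  filter_upwards [h1, h2, h3] with τ hτ1 hτ2 hτ3 hτ
  have hτ' := Ioo_subset_Icc_self hτ
  by_cases hne : x τ = y τ
  -- On the diagonal `k_M` need not be differentiable, but where the curves meet their distance is
  -- minimal, so `deriv` is zero (also when no derivative exists).
  · refine le_of_eq (IsLocalMin.deriv_eq_zero (Eventually.of_forall fun σ => ?_))
    change dist (x τ) (y τ) ≤ dist (x σ) (y σ)
    rw [hne, dist_self]
    exact dist_nonneg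
  · have h4 := hasDerivWithinAt_kobayashiDist hk hne (hτ1 hτ').hasMFDerivWithinAt
      (hτ2 hτ').hasMFDerivWithinAt (S := univ)
    rw [hasDerivWithinAt_univ] at h4
    simp only [hd]
    rw [h4.deriv]
    exact hτ3 (hs.trans hτ'.1) _ _ hne

theorem IsTrajectory.eqOn (hG : IsHerglotzVectorField h G) (hs : 0 ≤ s)
    (hx : IsTrajectory h G s t x) (hy : IsTrajectory h G s t y) (hxy : x s = y s) :
    EqOn x y (Icc s t) := by
  intro τ hτ
  have := (hx.mono le_rfl hτ.2).dist_le hd hk hG hs hτ.1 (hy.mono le_rfl hτ.2)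
  rw [hxy, dist_self] at this
  exact dist_le_zero.1 this

end Contraction

/-! ### Holomorphic maps and fields in charts -/

section ChartHolomorphic

variable {E : Type*} [NormedAddCommGroup E] [NormedSpace ℂ E]
  {M : Type*} [TopologicalSpace M] [ChartedSpace E M] [IsManifold 𝓘(ℂ, E) ω M]

theorem mdifferentiableAt_iff_chart {F : Type*} [NormedAddCommGroup F] [NormedSpace ℂ F]
    {f : M → F} {q z : M} (hz : z ∈ (chartAt E q).source) :
    MDifferentiableAt 𝓘(ℂ, E) 𝓘(ℂ, F) f z ↔
      DifferentiableAt ℂ (fun y => f ((chartAt E q).symm y)) (chartAt E q z) := by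
  have : IsManifold 𝓘(ℂ, E) 1 M := IsManifold.of_le (n := ω) le_top
  refine ⟨fun hf => ?_, fun hf => ?_⟩
  · refine MDifferentiableAt.differentiableAt ?_
    refine MDifferentiableAt.comp (I' := 𝓘(ℂ, E)) _ ?_ (mdifferentiableAt_atlas_symm
      (chart_mem_atlas E q) ((chartAt E q).map_source hz))
    rwa [(chartAt E q).left_inv hz]
  · have h1 : MDifferentiableAt 𝓘(ℂ, E) 𝓘(ℂ, F)
        ((fun y => f ((chartAt E q).symm y)) ∘ chartAt E q) z :=
      MDifferentiableAt.comp (I' := 𝓘(ℂ, E)) z hf.mdifferentiableAt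
        (mdifferentiableAt_atlas (chart_mem_atlas E q) hz)
    refine h1.congr_of_eventuallyEq ?_
    filter_upwards [(chartAt E q).open_source.mem_nhds hz] with w hw
    simp [(chartAt E q).left_inv hw]

/-- A vector field is holomorphic if and only if its readings in the charts are. -/
theorem mdifferentiableAt_section_iff_chart {X : ∀ z : M, TangentSpace 𝓘(ℂ, E) z} {q z : M}
    (hz : z ∈ (chartAt E q).source) :
    MDifferentiableAt 𝓘(ℂ, E) 𝓘(ℂ, E).tangent
        (fun w : M => (⟨w, X w⟩ : TangentBundle 𝓘(ℂ, E) M)) z ↔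
      DifferentiableAt ℂ (fun y => chartVec q ((chartAt E q).symm y) (X ((chartAt E q).symm y)))
        (chartAt E q z) := by
  have : IsManifold 𝓘(ℂ, E) 1 M := IsManifold.of_le (n := ω) le_top
  have h1 := (trivializationAt E (TangentSpace 𝓘(ℂ, E)) q).mdifferentiableAt_section_iff
    (IB := 𝓘(ℂ, E)) X (b₀ := z) hz
  refine h1.trans ?_
  exact mdifferentiableAt_iff_chart (f := fun w => chartVec q w (X w)) hz

theorem aestronglyMeasurable_chartVec {α : Type*} [MeasurableSpace α] {μ : Measure α}
    {q z : M} {v : α → TangentSpace 𝓘(ℂ, E) z} (hv : AEStronglyMeasurable v μ) :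
    AEStronglyMeasurable (fun a => chartVec q z (v a)) μ :=
  (tangentCoordChange 𝓘(ℂ, E) z q z).continuous.comp_aestronglyMeasurable hv

end ChartHolomorphic

/-! ### Local flows of weak holomorphic fields -/

section LocalFlow

variable {E : Type*} [NormedAddCommGroup E] [NormedSpace ℂ E]
  {M : Type*} [TopologicalSpace M] [ChartedSpace E M] [IsManifold 𝓘(ℂ, E) ω M]

/-- The maps `f τ`, `s ≤ τ ≤ t`, form the flow of `G` on `W` with initial time `s`. -/
structure IsFlowOn (h : HermitianMetric E M) (G : ∀ z : M, ℝ → TangentSpace 𝓘(ℂ, E) z)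
    (s t : ℝ) (W : Set M) (f : ℝ → M → M) : Prop where
  init : ∀ z ∈ W, f s z = z
  trajectory : ∀ z ∈ W, IsTrajectory h G s t (f · z)
  holomorphic : ∀ z ∈ W, ∀ τ ∈ Icc s t, MDifferentiableAt 𝓘(ℂ, E) 𝓘(ℂ, E) (f τ) z

variable {h : HermitianMetric E M} {G : ∀ z : M, ℝ → TangentSpace 𝓘(ℂ, E) z}

theorem IsFlowOn.mono {s t t' : ℝ} {W W' : Set M} {f : ℝ → M → M} (hf : IsFlowOn h G s t W f)
    (ht : t' ≤ t) (hW : W' ⊆ W) : IsFlowOn h G s t' W' f :=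
  ⟨fun z hz => hf.init z (hW hz), fun z hz => (hf.trajectory z (hW hz)).mono le_rfl ht,
    fun z hz τ hτ => hf.holomorphic z (hW hz) τ ⟨hτ.1, hτ.2.trans ht⟩⟩

/-- For order `∞` the bounding function may be replaced by its essential supremum; a constant bound
is what makes lifetimes uniform. -/
theorem exists_ae_norm_le (hG : IsWeakHolomorphicVectorField h ⊤ G) {K : Set M} (hK : IsCompact K)
    {T : ℝ} (hT : 0 < T) : ∃ B : ℝ, 0 ≤ B ∧
      ∀ᵐ t ∂volume.restrict (Icc 0 T), ∀ z ∈ K, h.norm z (G z t) ≤ B := by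
  obtain ⟨C, -, hC, hb⟩ := hG.bound K hK T hT
  refine ⟨(eLpNorm C ⊤ (volume.restrict (Icc 0 T))).toReal, ENNReal.toReal_nonneg, ?_⟩
  have h1 := enorm_ae_le_eLpNormEssSup C (volume.restrict (Icc 0 T))
  filter_upwards [hb, h1] with t ht ht' z hz
  refine (ht z hz).trans ((le_abs_self _).trans ?_)
  rw [← Real.norm_eq_abs, ← toReal_enorm]
  refine ENNReal.toReal_mono hC.2.ne ?_
  rwa [eLpNorm_exponent_top]

variable [FiniteDimensional ℂ E] [T2Space M]

/-- Local existence of the flow, with a uniform lifetime for bounded initial times. -/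
theorem exists_isFlowOn_nhds (hG : IsWeakHolomorphicVectorField h ⊤ G) (q : M) {T : ℝ}
    (hT : 0 < T) : ∃ W ∈ 𝓝 q, ∃ δ > 0, ∃ c ≥ 0, ∀ s ∈ Icc 0 T, ∃ f : ℝ → M → M,
      IsFlowOn h G s (s + δ) W f ∧ ∀ z ∈ W, ∀ τ ∈ Icc s (s + δ), ∀ τ' ∈ Icc s (s + δ),
        h.edist (f τ z) (f τ' z) ≤ ENNReal.ofReal (c * |τ - τ'|) := by
  have : IsManifold 𝓘(ℂ, E) 1 M := IsManifold.of_le (n := ω) le_top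
  have : ProperSpace E := FiniteDimensional.proper ℂ E
  obtain ⟨A, hA, R, hR, hRt, hAv, hAd⟩ := h.exists_comparison q
  set χ := chartAt E q with hχ
  have hball : ∀ r ≤ R, Metric.ball (χ q) r ⊆ χ.target := fun r hr =>
    (Metric.ball_subset_ball hr).trans hRt
  have hcb : Metric.closedBall (χ q) (R / 2) ⊆ Metric.ball (χ q) R :=
    Metric.closedBall_subset_ball (by linarith)
  have hsymm : ∀ y ∈ Metric.ball (χ q) R, χ.symm y ∈ chartBall E q R := fun y hy =>
    ⟨χ.map_target (hRt hy), by rwa [mem_preimage, ← hχ, χ.right_inv (hRt hy)]⟩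
  have hK : IsCompact (χ.symm '' Metric.closedBall (χ q) (R / 2)) :=
    (isCompact_closedBall _ _).image_of_continuousOn (χ.continuousOn_symm.mono (hcb.trans hRt))
  obtain ⟨B, hB, hBG⟩ := exists_ae_norm_le hG hK (T := T + 1) (by linarith)
  -- The bound holds only for a.e. time. Setting the field to zero at the other times makes it
  -- bounded at every time and changes the equation on a null set only.
  set P : ℝ → Prop := fun t =>
    ∀ z ∈ χ.symm '' Metric.closedBall (χ q) (R / 2), h.norm z (G z t) ≤ B with hP
  classical
  set g : E → ℝ → E := fun y t => if P t then chartVec q (χ.symm y) (G (χ.symm y) t) else 0 with hg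
  -- `δ ≤ 1` keeps `[s, s + δ]` inside `[0, T + 1]`; the second term gives the smallness condition
  -- `short` for the radius `R / 4`.
  set δ : ℝ := min 1 (R / 16 / (A * B + 1)) with hδ
  have hδ0 : 0 < δ := lt_min one_pos (by positivity)
  have hδs : A * B * δ ≤ R / 4 / 4 := by
    have h1 : δ ≤ R / 16 / (A * B + 1) := min_le_right _ _
    rw [le_div_iff₀ (by positivity)] at h1
    linarith
  have hr2 : 2 * (R / 4) = R / 2 := by ring
  refine ⟨chartBall E q (R / 4 / 2), chartBall_mem_nhds q (by positivity), δ, hδ0, A * (A * B),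
    by positivity, fun s hs => ?_⟩
  have hsub : Icc s (s + δ) ⊆ Icc 0 (T + 1) :=
    Icc_subset_Icc hs.1 (add_le_add hs.2 (min_le_left _ _))
  have hPae : ∀ᵐ t ∂volume.restrict (Icc s (s + δ)), P t :=
    ae_restrict_of_ae_restrict_of_subset hsub hBG
  have hfield : IsBoundedField g (χ q) (R / 4) (A * B) s (s + δ) := by
    refine ⟨by positivity, fun t ht => ?_, fun y hy => ?_, fun t ht y hy => ?_, by linarith,
      by rwa [add_sub_cancel_left]⟩
    · by_cases hPt : P t
      · simp only [hg, hPt, if_true]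
        rw [hr2]
        intro y hy
        have hy' := hball (R / 2) (by linarith) hy
        have h1 := (mdifferentiableAt_section_iff_chart (χ.map_target hy')).1
          (hG.holomorphic t (hs.1.trans ht.1) (χ.symm y))
        rw [← hχ, χ.right_inv hy'] at h1
        exact h1.differentiableWithinAt
      · simp only [hg, hPt, if_false]
        exact differentiableOn_const 0
    · have h1 : AEStronglyMeasurable (fun t => G (χ.symm y) t) (volume.restrict (Icc s (s + δ))) :=
        (hG.measurable (χ.symm y)).mono_measure (Measure.restrict_mono
          (fun t ht => (hs.1.trans ht.1 : (0:ℝ) ≤ t)) le_rfl)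
      refine (aestronglyMeasurable_chartVec (q := q) h1).congr ?_
      filter_upwards [hPae] with t ht
      simp [hg, ht]
    · rw [hr2] at hy
      by_cases hPt : P t
      · simp only [hg, hPt, if_true]
        have hy1 := Metric.ball_subset_closedBall hy
        refine (hAv _ (hsymm y (hcb hy1)) _).1.trans ?_
        gcongr
        exact hPt _ (mem_image_of_mem _ hy1)
      · simp only [hg, hPt, if_false, _root_.norm_zero]
        positivity
  obtain ⟨F, hF⟩ := hfield.exists_flow
  have hb4 : Metric.ball (χ q) (R / 4) ⊆ Metric.ball (χ q) R :=
    Metric.ball_subset_ball (by linarith)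
  have hlip : ∀ z ∈ chartBall E q (R / 4 / 2), ∀ τ ∈ Icc s (s + δ), ∀ τ' ∈ Icc s (s + δ),
      h.edist (χ.symm (F τ (χ z))) (χ.symm (F τ' (χ z))) ≤
        ENNReal.ofReal (A * (A * B) * |τ - τ'|) := by
    intro z hz τ hτ τ' hτ'
    obtain ⟨-, h2, h3, -⟩ := hF _ hz.2
    have h4 := hb4 (h2 τ hτ)
    have h5 := hb4 (h2 τ' hτ')
    refine (hAd _ (hsymm _ h4) _ (hsymm _ h5)).1.trans (ENNReal.ofReal_le_ofReal ?_)
    rw [← hχ, χ.right_inv (hRt h4), χ.right_inv (hRt h5), mul_assoc]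
    gcongr
    exact h3 τ hτ τ' hτ'
  refine ⟨fun τ z => χ.symm (F τ (χ z)), ⟨fun z hz => ?_, fun z hz => ⟨⟨_, by positivity,
    hlip z hz⟩, ?_⟩, fun z hz τ hτ => ?_⟩, hlip⟩
  · rw [(hF _ hz.2).1, χ.left_inv hz.1]
  · obtain ⟨-, h2, -, h4, -⟩ := hF _ hz.2
    rw [← restrict_Ioo_eq_restrict_Icc] at h4 hPae ⊢
    filter_upwards [h4, hPae, ae_restrict_mem measurableSet_Ioo] with τ hτ hPτ hτI
    have hτb := hb4 (h2 τ (Ioo_subset_Icc_self hτI))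
    refine (hasMFDerivAt_curve_iff_chart (q := q) (hsymm _ hτb).1).2 ⟨?_, ?_⟩
    · exact ContinuousAt.comp (g := χ.symm) (χ.continuousAt_symm (hRt hτb)) hτ.continuousAt
    · have h5 : g (F τ (χ z)) τ =
          chartVec q (χ.symm (F τ (χ z))) (G (χ.symm (F τ (χ z))) τ) := if_pos hPτ
      rw [← h5]
      refine hτ.congr_of_eventuallyEq ?_
      filter_upwards [Ioo_mem_nhds hτI.1 hτI.2] with σ hσ
      exact χ.right_inv (hRt (hb4 (h2 σ (Ioo_subset_Icc_self hσ))))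
  · obtain ⟨-, h2, -, -, h5⟩ := hF _ hz.2
    have h6 : MDifferentiableAt 𝓘(ℂ, E) 𝓘(ℂ, E) χ z :=
      mdifferentiableAt_atlas (chart_mem_atlas E q) hz.1
    have h7 : MDifferentiableAt 𝓘(ℂ, E) 𝓘(ℂ, E) χ.symm (F τ (χ z)) :=
      mdifferentiableAt_atlas_symm (chart_mem_atlas E q) (hRt (hb4 (h2 τ hτ)))
    exact h7.comp z ((h5 τ hτ).mdifferentiableAt.comp z h6)

/-- Local existence of the flow, uniformly near a compact set. -/
theorem exists_isFlowOn_of_isCompact (hG : IsWeakHolomorphicVectorField h ⊤ G) {K : Set M}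
    (hK : IsCompact K) {T : ℝ} (hT : 0 < T) : ∃ δ > 0, ∃ c ≥ 0, ∀ s ∈ Icc 0 T, ∀ q ∈ K,
      ∃ W ∈ 𝓝 q, ∃ f : ℝ → M → M,
      IsFlowOn h G s (s + δ) W f ∧ ∀ z ∈ W, ∀ τ ∈ Icc s (s + δ), ∀ τ' ∈ Icc s (s + δ),
        h.edist (f τ z) (f τ' z) ≤ ENNReal.ofReal (c * |τ - τ'|) := by
  refine hK.induction_on (p := fun K => ∃ δ > 0, ∃ c ≥ 0, ∀ s ∈ Icc 0 T, ∀ q ∈ K,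
      ∃ W ∈ 𝓝 q, ∃ f : ℝ → M → M,
      IsFlowOn h G s (s + δ) W f ∧ ∀ z ∈ W, ∀ τ ∈ Icc s (s + δ), ∀ τ' ∈ Icc s (s + δ),
        h.edist (f τ z) (f τ' z) ≤ ENNReal.ofReal (c * |τ - τ'|))
    ⟨1, one_pos, 0, le_rfl, fun _ _ _ => False.elim⟩ ?_ ?_ ?_
  · rintro K K' hKK' ⟨δ, hδ, c, hc, H⟩
    exact ⟨δ, hδ, c, hc, fun s hs q hq => H s hs q (hKK' hq)⟩
  · rintro K K' ⟨δ, hδ, c, hc, H⟩ ⟨δ', hδ', c', hc', H'⟩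
    refine ⟨min δ δ', lt_min hδ hδ', max c c', le_max_of_le_left hc, fun s hs q hq => ?_⟩
    rcases hq with hq | hq
    · obtain ⟨W, hW, f, hf, hfl⟩ := H s hs q hq
      have hle : s + min δ δ' ≤ s + δ := by gcongr; exact min_le_left _ _
      refine ⟨W, hW, f, hf.mono hle subset_rfl, fun z hz τ hτ τ' hτ' => ?_⟩
      refine (hfl z hz τ ⟨hτ.1, hτ.2.trans hle⟩ τ' ⟨hτ'.1, hτ'.2.trans hle⟩).trans
        (ENNReal.ofReal_le_ofReal ?_)
      gcongr
      exact le_max_left _ _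
    · obtain ⟨W, hW, f, hf, hfl⟩ := H' s hs q hq
      have hle : s + min δ δ' ≤ s + δ' := by gcongr; exact min_le_right _ _
      refine ⟨W, hW, f, hf.mono hle subset_rfl, fun z hz τ hτ τ' hτ' => ?_⟩
      refine (hfl z hz τ ⟨hτ.1, hτ.2.trans hle⟩ τ' ⟨hτ'.1, hτ'.2.trans hle⟩).trans
        (ENNReal.ofReal_le_ofReal ?_)
      gcongr
      exact le_max_right _ _
  · intro q _
    obtain ⟨W, hW, δ, hδ, c, hc, H⟩ := exists_isFlowOn_nhds hG q hT
    refine ⟨interior W, mem_nhdsWithin_of_mem_nhds (interior_mem_nhds.2 hW), δ, hδ, c, hc,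
      fun s hs z hz => ?_⟩
    obtain ⟨f, hf⟩ := H s hs
    exact ⟨W, mem_interior_iff_mem_nhds.1 hz, f, hf⟩

end LocalFlow

/-! ### Concatenation of flows -/

section FlowConcat

variable {E : Type*} [NormedAddCommGroup E] [NormedSpace ℂ E]
  {M : Type*} [TopologicalSpace M] [ChartedSpace E M] [IsManifold 𝓘(ℂ, E) ω M]
  {h : HermitianMetric E M} {G : ∀ z : M, ℝ → TangentSpace 𝓘(ℂ, E) z}

theorem IsFlowOn.refl (h : HermitianMetric E M) (G : ∀ z : M, ℝ → TangentSpace 𝓘(ℂ, E) z) (s : ℝ)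
    (W : Set M) : IsFlowOn h G s s W fun _ z => z :=
  ⟨fun _ _ => rfl, fun _ _ => IsTrajectory.refl h G s _, fun _ _ _ _ => mdifferentiableAt_id⟩

/-- Concatenation of flows. -/
theorem IsFlowOn.concat {s u t : ℝ} {W V : Set M} {f g : ℝ → M → M} (hsu : s ≤ u) (hut : u ≤ t)
    (hf : IsFlowOn h G s u W f) (hg : IsFlowOn h G u t V g) (hm : MapsTo (f u) W V) :
    IsFlowOn h G s t W fun τ z => if τ ≤ u then f τ z else g τ (f u z) := by
  refine ⟨fun z hz => ?_, fun z hz => ?_, fun z hz τ hτ => ?_⟩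
  · rw [if_pos hsu, hf.init z hz]
  · exact (hf.trajectory z hz).concat hsu hut (hg.trajectory _ (hm hz)) (hg.init _ (hm hz))
  · by_cases hτu : τ ≤ u
    · simp only [hτu, if_true]
      exact hf.holomorphic z hz τ ⟨hτ.1, hτu⟩
    · simp only [hτu, if_false]
      exact (hg.holomorphic _ (hm hz) τ ⟨(not_le.1 hτu).le, hτ.2⟩).comp z
        (hf.holomorphic z hz u ⟨hsu, le_rfl⟩)

/-- A flow can be extended by steps of a fixed length. -/
theorem exists_isFlowOn_of_step {s t δ : ℝ} {W V : Set M} (hδ : 0 < δ) (hst : s ≤ t)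
    (hV : ∀ u ∈ Icc s t, ∃ g, IsFlowOn h G u (u + δ) V g)
    (hm : ∀ u ∈ Icc s t, ∀ f, IsFlowOn h G s u W f → MapsTo (f u) W V) :
    ∃ f, IsFlowOn h G s t W f := by
  have key : ∀ n : ℕ, ∀ t' ∈ Icc s t, t' ≤ s + n * δ → ∃ f, IsFlowOn h G s t' W f := by
    intro n
    induction n with
    | zero =>
      intro t' ht' hle
      have : t' = s := le_antisymm (by simpa using hle) ht'.1
      rw [this]
      exact ⟨_, IsFlowOn.refl h G s W⟩
    | succ n ih =>
      intro t' ht' hle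
      rcases le_total t' (s + n * δ) with h1 | h1
      · exact ih t' ht' h1
      · have hu : s + n * δ ∈ Icc s t := ⟨by linarith [show 0 ≤ n * δ by positivity], h1.trans ht'.2⟩
        obtain ⟨f, hf⟩ := ih _ hu le_rfl
        obtain ⟨g, hg⟩ := hV _ hu
        push_cast at hle
        exact ⟨_, hf.concat hu.1 h1 (hg.mono (by linarith) subset_rfl) (hm _ hu f hf)⟩
  obtain ⟨n, hn⟩ := exists_nat_ge ((t - s) / δ)
  rw [div_le_iff₀ hδ] at hn
  exact key n t ⟨hst, le_rfl⟩ (by linarith)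

end FlowConcat

/-! ### Orbits of evolution families as trajectories -/

section Orbits

variable {E : Type*} [NormedAddCommGroup E] [NormedSpace ℂ E]
  {M : Type*} [TopologicalSpace M] [ChartedSpace E M] [IsManifold 𝓘(ℂ, E) ω M]
  {h : HermitianMetric E M} {φ : ℝ → ℝ → M → M}

theorem Ici_eq_iUnion_Icc_add_nat (s : ℝ) : Ici s = ⋃ n : ℕ, Icc s (s + n) := by
  ext t
  simp only [mem_Ici, mem_iUnion, mem_Icc]
  refine ⟨fun hst => ?_, fun ⟨_, hn⟩ => hn.1⟩
  obtain ⟨n, hn⟩ := exists_nat_ge (t - s)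
  exact ⟨n, hst, by linarith⟩

theorem IsEvolutionFamily.exists_edist_orbit_le (hφ : IsEvolutionFamily h φ) {s t : ℝ}
    (hs : 0 ≤ s) (z : M) : ∃ c : ℝ, 0 ≤ c ∧ ∀ τ ∈ Icc s t, ∀ τ' ∈ Icc s t,
      h.edist (φ s τ z) (φ s τ' z) ≤ ENNReal.ofReal (c * |τ - τ'|) := by
  obtain ⟨c, hc, H⟩ := hφ.lipschitz {z} isCompact_singleton (max t 1) (by positivity)
  exact ⟨c, hc.le, fun τ hτ τ' hτ' => H s τ τ' hs hτ.1 hτ'.1 (hτ.2.trans (le_max_left _ _))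
    (hτ'.2.trans (le_max_left _ _)) z rfl⟩

/-- The orbits of an evolution family generated by `G` are trajectories of `G`. -/
theorem IsEvolutionFamily.isTrajectory (hφ : IsEvolutionFamily h φ)
    {G : ∀ z : M, ℝ → TangentSpace 𝓘(ℂ, E) z} (hφG : IsGeneratedBy φ G) {s t : ℝ} (hs : 0 ≤ s)
    (z : M) : IsTrajectory h G s t (φ s · z) :=
  ⟨hφ.exists_edist_orbit_le hs z,
    ae_restrict_of_ae_restrict_of_subset Icc_subset_Ici_self (hφG s hs z)⟩

end Orbits

/-! ### Global existence and the evolution family of a Herglotz field -/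

section GlobalFlow

variable {E : Type*} [NormedAddCommGroup E] [NormedSpace ℂ E] [FiniteDimensional ℂ E]
  {M : Type*} [MetricSpace M] [ConnectedSpace M] [ChartedSpace E M] [IsManifold 𝓘(ℂ, E) ω M]
  (hd : ∀ z w : M, dist z w = kobayashiDist E z w) (hk : KobayashiDistC1 E M)
  {h : HermitianMetric E M} {G : ∀ z : M, ℝ → TangentSpace 𝓘(ℂ, E) z}
  (hG : IsHerglotzVectorField h G)

include hd hk hG

/-- Local flows can be glued. -/
theorem exists_isFlowOn_of_forall_nhds {s t : ℝ} {W : Set M} (hs : 0 ≤ s) (hW : IsOpen W)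
    (H : ∀ z ∈ W, ∃ V ∈ 𝓝 z, ∃ f, IsFlowOn h G s t V f) : ∃ f, IsFlowOn h G s t W f := by
  choose! V hV f hf using H
  refine ⟨fun τ z => f z τ z, fun z hz => (hf z hz).init z (mem_of_mem_nhds (hV z hz)),
    fun z hz => (hf z hz).trajectory z (mem_of_mem_nhds (hV z hz)), fun z hz τ hτ => ?_⟩
  -- The flow is chosen pointwise; uniqueness of trajectories identifies it near `z` with the single
  -- holomorphic flow `f z`.
  refine ((hf z hz).holomorphic z (mem_of_mem_nhds (hV z hz)) τ hτ).congr_of_eventuallyEq ?_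
  filter_upwards [hV z hz, hW.mem_nhds hz] with w hwV hwW
  have hw := mem_of_mem_nhds (hV w hwW)
  refine ((hf w hwW).trajectory w hw).eqOn hd hk hG hs ((hf z hz).trajectory w hwV) ?_ hτ
  rw [(hf w hwW).init w hw, (hf z hz).init w hwV]

omit [ConnectedSpace M] hd hk in
-- This lifetime of the single point `p` will be inherited by all of `M`. The uniform Lipschitz
-- constant of the local flow keeps the trajectory near `p` for a time independent of `s`.
theorem exists_dist_trajectory_le (p : M) {T : ℝ} (hT : 0 < T) : ∃ δ > 0, ∀ s ∈ Icc 0 T,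
    ∃ x : ℝ → M, IsTrajectory h G s (s + δ) x ∧ x s = p ∧
      ∀ τ ∈ Icc s (s + δ), dist (x τ) p ≤ 1 := by
  obtain ⟨δ, hδ, c, hc, H⟩ := exists_isFlowOn_of_isCompact hG.weak (isCompact_singleton (x := p)) hT
  obtain ⟨ε, hε, hεU⟩ := h.exists_edist_lt_imp_mem (Metric.ball_mem_nhds p one_pos)
  refine ⟨min δ (ε / (c + 1)), lt_min hδ (by positivity), fun s hs => ?_⟩
  obtain ⟨W, hW, f, hf, hfl⟩ := H s hs p rfl
  have hp := mem_of_mem_nhds hW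
  refine ⟨(f · p), (hf.trajectory p hp).mono le_rfl (by gcongr; exact min_le_left _ _),
    hf.init p hp, fun τ hτ => (hεU _ ?_).le⟩
  have h1 : τ - s ≤ ε / (c + 1) := by linarith [hτ.2, min_le_right δ (ε / (c + 1))]
  have h2 := hfl p hp s ⟨le_rfl, by linarith⟩ τ ⟨hτ.1, by linarith [hτ.2, min_le_left δ (ε / (c + 1))]⟩
  simp only [hf.init p hp] at h2
  refine h2.trans_lt ((ENNReal.ofReal_lt_ofReal_iff hε).2 ?_)
  rw [abs_sub_comm, abs_of_nonneg (by linarith [hτ.1])]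
  rw [le_div_iff₀ (by positivity)] at h1
  rcases hτ.1.eq_or_lt with h0 | h0
  · simpa [h0] using hε
  · nlinarith

variable [ProperSpace M]

/-- Global existence of the flow, for a uniform time. -/
theorem exists_isFlowOn_univ_of_le {T : ℝ} (hT : 0 < T) : ∃ δ > 0, ∀ s ∈ Icc 0 T,
    ∃ f, IsFlowOn h G s (s + δ) univ f := by
  obtain ⟨p⟩ := ConnectedSpace.toNonempty (α := M)
  obtain ⟨δ, hδ, H⟩ := exists_dist_trajectory_le hG p hT
  refine ⟨δ, hδ, fun s hs => ?_⟩
  obtain ⟨x, hx, hxs, hxp⟩ := H s hs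
  refine exists_isFlowOn_of_forall_nhds hd hk hG hs.1 isOpen_univ fun z _ =>
    ⟨Metric.ball p (dist z p + 1), Metric.isOpen_ball.mem_nhds (by simp), ?_⟩
  set R := dist z p + 1 with hR
  -- By contraction towards the trajectory of `p`, trajectories from the `R`-ball remain in the `(R
  -- + 1)`-ball up to time `s + δ`. Its closure is compact, so steps of one length `η` are available
  -- throughout; initial times now range up to `T + δ`.
  obtain ⟨η, hη, c, hc, L⟩ := exists_isFlowOn_of_isCompact hG.weak
    (isCompact_closedBall p (R + 1)) (T := T + δ) (by positivity)
  refine exists_isFlowOn_of_step (V := Metric.ball p (R + 1)) hη (by linarith) (fun u hu => ?_)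
    fun u hu f hf w hw => ?_
  · refine exists_isFlowOn_of_forall_nhds hd hk hG (hs.1.trans hu.1) Metric.isOpen_ball fun w hw => ?_
    obtain ⟨V, hV, f, hf, -⟩ := L u ⟨hs.1.trans hu.1, by linarith [hu.2, hs.2]⟩ w
      (Metric.ball_subset_closedBall hw)
    exact ⟨V, hV, f, hf⟩
  · have h1 := (hf.trajectory w hw).dist_le hd hk hG hs.1 hu.1 (hx.mono le_rfl hu.2)
    simp only [hf.init w hw, hxs] at h1
    rw [Metric.mem_ball] at hw ⊢
    linarith [dist_triangle (f u w) (x u) p, hxp u hu]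

/-- Global existence of the flow. -/
theorem exists_isFlowOn_univ {s t : ℝ} (hs : 0 ≤ s) (hst : s ≤ t) :
    ∃ f, IsFlowOn h G s t univ f := by
  obtain ⟨δ, hδ, H⟩ := exists_isFlowOn_univ_of_le hd hk hG (T := t + 1) (by linarith)
  exact exists_isFlowOn_of_step hδ hst (fun u hu => H u ⟨hs.trans hu.1, by linarith [hu.2]⟩)
    fun _ _ _ _ => mapsTo_univ _ _

/-- Flows with different final times agree by uniqueness, so the diagonal choice `F s t t` is a flow
for all final times at once. -/
theorem exists_isFlowOn_forall : ∃ φ : ℝ → ℝ → M → M, ∀ s t, 0 ≤ s → s ≤ t →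
    IsFlowOn h G s t univ (φ s) := by
  have H : ∀ s t : ℝ, ∃ f, 0 ≤ s → s ≤ t → IsFlowOn h G s t univ f := fun s t => by
    by_cases hst : 0 ≤ s ∧ s ≤ t
    · obtain ⟨f, hf⟩ := exists_isFlowOn_univ hd hk hG hst.1 hst.2
      exact ⟨f, fun _ _ => hf⟩
    · exact ⟨fun _ z => z, fun h1 h2 => absurd ⟨h1, h2⟩ hst⟩
  choose F hF using H
  refine ⟨fun s t => F s t t, fun s t hs hst => ?_⟩
  have heq : ∀ τ ∈ Icc s t, F s t τ = F s τ τ := fun τ hτ => funext fun z =>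
    (((hF s t hs hst).trajectory z trivial).mono le_rfl hτ.2).eqOn hd hk hG hs
      ((hF s τ hs hτ.1).trajectory z trivial) (by
        rw [(hF s t hs hst).init z trivial, (hF s τ hs hτ.1).init z trivial]) ⟨hτ.1, le_rfl⟩
  refine ⟨fun z _ => (hF s s hs le_rfl).init z trivial, fun z _ => ?_, fun z _ τ hτ => ?_⟩
  · exact ((hF s t hs hst).trajectory z trivial).congr fun τ hτ => congrFun (heq τ hτ) z
  · exact (hF s τ hs hτ.1).holomorphic z trivial τ ⟨hτ.1, le_rfl⟩

theorem exists_isEvolutionFamily : ∃ φ : ℝ → ℝ → M → M,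
    IsEvolutionFamily h φ ∧ IsGeneratedBy φ G ∧
      ∀ ψ : ℝ → ℝ → M → M, IsEvolutionFamily h ψ → IsGeneratedBy ψ G →
        ∀ s t : ℝ, 0 ≤ s → s ≤ t → ψ s t = φ s t := by
  obtain ⟨φ, hφ⟩ := exists_isFlowOn_forall hd hk hG
  have hinit : ∀ s, 0 ≤ s → ∀ z, φ s s z = z := fun s hs z => (hφ s s hs le_rfl).init z trivial
  have hcomp : ∀ s u t, 0 ≤ s → s ≤ u → u ≤ t → ∀ z, φ s t z = φ u t (φ s u z) := by
    intro s u t hs hsu hut z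
    refine IsTrajectory.eqOn hd hk hG (hs.trans hsu) (x := (φ s · z)) (y := (φ u · (φ s u z)))
      (((hφ s t hs (hsu.trans hut)).trajectory z trivial).mono hsu le_rfl)
      ((hφ u t (hs.trans hsu) hut).trajectory _ trivial) ?_ ⟨hut, le_rfl⟩
    exact (hinit u (hs.trans hsu) _).symm
  have hcontr : ∀ s t, 0 ≤ s → s ≤ t → ∀ z w, dist (φ s t z) (φ s t w) ≤ dist z w := by
    intro s t hs hst z w
    have := ((hφ s t hs hst).trajectory z trivial).dist_le hd hk hG hs hst
      ((hφ s t hs hst).trajectory w trivial)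
    rwa [hinit s hs, hinit s hs] at this
  obtain ⟨p⟩ := ConnectedSpace.toNonempty (α := M)
  -- Each time step `δ` costs at most `1`: after the first step the orbit differs by at most `1`
  -- from the orbit that starts afresh at `p`, and contraction preserves this.
  have hbdd : ∀ T > 0, ∃ N : ℝ, ∀ s t, 0 ≤ s → s ≤ t → t ≤ T → dist (φ s t p) p ≤ N := by
    intro T hT
    obtain ⟨δ, hδ, H⟩ := exists_dist_trajectory_le hG p hT
    have hshort : ∀ s t, 0 ≤ s → s ≤ t → t ≤ T → t ≤ s + δ → dist (φ s t p) p ≤ 1 := by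
      intro s t hs hst htT hle
      obtain ⟨x, hx, hxs, hxp⟩ := H s ⟨hs, hst.trans htT⟩
      have heq : φ s t p = x t := ((hφ s t hs hst).trajectory p trivial).eqOn hd hk hG hs
        (hx.mono le_rfl hle) (by rw [hinit s hs, hxs]) ⟨hst, le_rfl⟩
      rw [heq]
      exact hxp t ⟨hst, hle⟩
    have key : ∀ n : ℕ, ∀ s t, 0 ≤ s → s ≤ t → t ≤ T → t ≤ s + n * δ → dist (φ s t p) p ≤ n := by
      intro n
      induction n with
      | zero =>
        intro s t hs hst _ hle
        have : t = s := le_antisymm (by simpa using hle) hst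
        rw [this, hinit s hs, dist_self, Nat.cast_zero]
      | succ n ih =>
        intro s t hs hst htT hle
        push_cast at hle ⊢
        rcases le_total t (s + δ) with h1 | h1
        · have := hshort s t hs hst htT h1
          linarith [show (0 : ℝ) ≤ n by positivity]
        · rw [hcomp s (s + δ) t hs (by linarith) h1]
          have h2 := hshort s (s + δ) hs (by linarith) (h1.trans htT) le_rfl
          have h3 := ih (s + δ) t (by linarith) h1 htT (by linarith)
          have h4 := hcontr (s + δ) t (by linarith) h1 (φ s (s + δ) p) p
          linarith [dist_triangle (φ (s + δ) t (φ s (s + δ) p)) (φ (s + δ) t p) p]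
    obtain ⟨n, hn⟩ := exists_nat_ge (T / δ)
    rw [div_le_iff₀ hδ] at hn
    exact ⟨n, fun s t hs hst htT => key n s t hs hst htT (by linarith)⟩
  refine ⟨φ, ⟨fun s hs => funext (hinit s hs), fun s u t hs hsu hut => funext (hcomp s u t hs hsu hut),
    fun s t hs hst z => (hφ s t hs hst).holomorphic z trivial t ⟨hst, le_rfl⟩, ?_⟩, ?_, ?_⟩
  -- All orbits from `K` up to time `T` stay in one compact ball, where the local flows share a
  -- Lipschitz constant; short time intervals are then added up.
  · intro K hK T hT
    obtain ⟨N, hN⟩ := hbdd T hT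
    obtain ⟨r, hr⟩ := hK.isBounded.subset_closedBall p
    obtain ⟨δ, hδ, c, hc, L⟩ := exists_isFlowOn_of_isCompact hG.weak
      (isCompact_closedBall p (r + N)) hT
    have hmem : ∀ s t, 0 ≤ s → s ≤ t → t ≤ T → ∀ z ∈ K, φ s t z ∈ Metric.closedBall p (r + N) := by
      intro s t hs hst htT z hz
      rw [Metric.mem_closedBall]
      linarith [dist_triangle (φ s t z) (φ s t p) p, hcontr s t hs hst z p, hN s t hs hst htT,
        Metric.mem_closedBall.1 (hr hz)]
    have hshort : ∀ s t t', 0 ≤ s → s ≤ t → t ≤ t' → t' ≤ T → t' ≤ t + δ → ∀ z ∈ K,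
        h.edist (φ s t z) (φ s t' z) ≤ ENNReal.ofReal (c * (t' - t)) := by
      intro s t t' hs hst htt' htT hle z hz
      have ht0 := hs.trans hst
      obtain ⟨W, hW, f, hf, hfl⟩ := L t ⟨ht0, htt'.trans htT⟩ _
        (hmem s t hs hst (htt'.trans htT) z hz)
      have hw := mem_of_mem_nhds hW
      have h1 := hfl _ hw t ⟨le_rfl, by linarith⟩ t' ⟨htt', hle⟩
      have h2 : φ t t' (φ s t z) = f t' (φ s t z) :=
        ((hφ t t' ht0 htt').trajectory _ trivial).eqOn hd hk hG ht0
          ((hf.trajectory _ hw).mono le_rfl hle)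
          (by rw [hinit t ht0, hf.init _ hw]) ⟨htt', le_rfl⟩
      rw [hf.init _ hw, ← h2, ← hcomp s t t' hs hst htt', abs_sub_comm,
        abs_of_nonneg (by linarith)] at h1
      exact h1
    have key : ∀ n : ℕ, ∀ s t t', 0 ≤ s → s ≤ t → t ≤ t' → t' ≤ T → t' ≤ t + n * δ → ∀ z ∈ K,
        h.edist (φ s t z) (φ s t' z) ≤ ENNReal.ofReal (c * (t' - t)) := by
      intro n
      induction n with
      | zero =>
        intro s t t' _ _ htt' _ hle z _
        have : t' = t := le_antisymm (by simpa using hle) htt'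
        rw [this, h.edist_self]
        exact zero_le
      | succ n ih =>
        intro s t t' hs hst htt' htT hle z hz
        push_cast at hle
        rcases le_total t' (t + δ) with h1 | h1
        · exact hshort s t t' hs hst htt' htT h1 z hz
        · refine (h.edist_triangle _ (φ s (t + δ) z) _).trans ((add_le_add
            (hshort s t (t + δ) hs hst (by linarith) (by linarith) le_rfl z hz)
            (ih s (t + δ) t' hs (by linarith) h1 htT (by linarith) z hz)).trans_eq ?_)
          rw [← ENNReal.ofReal_add (by rw [add_sub_cancel_left]; positivity)
            (mul_nonneg hc (by linarith))]
          congr 1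
          ring
    obtain ⟨n, hn⟩ := exists_nat_ge (T / δ)
    rw [div_le_iff₀ hδ] at hn
    refine ⟨c + 1, by positivity, fun s t t' hs hst hst' htT htT' z hz => ?_⟩
    wlog htt' : t ≤ t' generalizing t t'
    · rw [h.edist_comm, abs_sub_comm]
      exact this t' t hst' hst htT' htT (le_of_not_ge htt')
    refine (key n s t t' hs hst htt' htT' (by linarith) z hz).trans (ENNReal.ofReal_le_ofReal ?_)
    rw [abs_sub_comm, abs_of_nonneg (by linarith)]
    gcongr
    linarith
  · intro s hs z
    rw [Ici_eq_iUnion_Icc_add_nat, ae_restrict_iUnion_iff]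
    exact fun n => ((hφ s (s + n) hs (by simp)).trajectory z trivial).hasDeriv
  · intro ψ hψ hψG s t hs hst
    funext z
    refine (hψ.isTrajectory hψG hs z (t := t)).eqOn hd hk hG hs
      ((hφ s t hs hst).trajectory z trivial) ?_ ⟨hst, le_rfl⟩
    rw [hψ.refl s hs, hinit s hs, id]

end GlobalFlow

/-! ### Velocities of Lipschitz curves -/

section LipschitzCurves

variable {E : Type*} [NormedAddCommGroup E] [NormedSpace ℂ E]
  {M : Type*} [TopologicalSpace M] [ChartedSpace E M] [IsManifold 𝓘(ℂ, E) ω M]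

omit [IsManifold 𝓘(ℂ, E) ω M] in
theorem exists_hasMFDerivAt_of_mdifferentiableAt {x : ℝ → M} {t : ℝ}
    (hx : MDifferentiableAt 𝓘(ℝ, ℝ) 𝓘(ℝ, E) x t) : ∃ v : TangentSpace 𝓘(ℂ, E) (x t),
      HasMFDerivAt 𝓘(ℝ, ℝ) 𝓘(ℝ, E) x t ((1 : ℝ →L[ℝ] ℝ).smulRight (realVec E v)) := by
  let v : TangentSpace 𝓘(ℝ, E) (x t) := mfderiv 𝓘(ℝ, ℝ) 𝓘(ℝ, E) x t 1
  refine ⟨v, hx.hasMFDerivAt.congr_mfderiv (ContinuousLinearMap.ext_ring ?_)⟩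
  exact (one_smul ℝ v).symm

theorem eq_of_hasMFDerivAt {x : ℝ → M} {t : ℝ} {u v : TangentSpace 𝓘(ℂ, E) (x t)}
    (hu : HasMFDerivAt 𝓘(ℝ, ℝ) 𝓘(ℝ, E) x t ((1 : ℝ →L[ℝ] ℝ).smulRight (realVec E u)))
    (hv : HasMFDerivAt 𝓘(ℝ, ℝ) 𝓘(ℝ, E) x t ((1 : ℝ →L[ℝ] ℝ).smulRight (realVec E v))) :
    u = v := by
  have : IsManifold 𝓘(ℂ, E) 1 M := IsManifold.of_le (n := ω) le_top
  have h1 := ((hasMFDerivAt_curve_iff_chart (q := x t) (mem_chart_source E _)).1 hu).2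
  have h2 := ((hasMFDerivAt_curve_iff_chart (q := x t) (mem_chart_source E _)).1 hv).2
  have h3 := h1.unique h2
  rwa [chartVec_self, chartVec_self] at h3

/-- Rademacher's theorem for curves. -/
theorem ae_mdifferentiableAt_of_edist_le [FiniteDimensional ℂ E] [T2Space M]
    (h : HermitianMetric E M) {x : ℝ → M} {s t c : ℝ}
    (hx : ∀ τ ∈ Icc s t, ∀ τ' ∈ Icc s t, h.edist (x τ) (x τ') ≤ ENNReal.ofReal (c * |τ - τ'|)) :
    ∀ᵐ τ ∂volume.restrict (Icc s t), MDifferentiableAt 𝓘(ℝ, ℝ) 𝓘(ℝ, E) x τ := by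
  have : IsManifold 𝓘(ℂ, E) 1 M := IsManifold.of_le (n := ω) le_top
  have : FiniteDimensional ℝ E := FiniteDimensional.complexToReal E
  have hxc := h.continuousOn_of_edist_le hx
  rw [← restrict_Ioo_eq_restrict_Icc, ae_restrict_iff' measurableSet_Ioo, ae_iff]
  -- Localizing in time confines the curve to a single coordinate ball, where the theorem for
  -- Lipschitz curves in `E` applies.
  refine measure_null_of_locally_null _ fun τ₀ hτ₀ => ?_
  rw [mem_ofPred_eq, Classical.not_imp] at hτ₀
  obtain ⟨A, hA, R, hR, hRt, -, hAd⟩ := h.exists_comparison (x τ₀)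
  have hU : Ioo s t ∩ x ⁻¹' chartBall E (x τ₀) R ∈ 𝓝 τ₀ := by
    refine inter_mem (Ioo_mem_nhds hτ₀.1.1 hτ₀.1.2) ?_
    exact (hxc.continuousAt (Icc_mem_nhds hτ₀.1.1 hτ₀.1.2)) (chartBall_mem_nhds (x τ₀) hR)
  obtain ⟨ε, hε, hεU⟩ := Metric.mem_nhds_iff.1 hU
  have hlip : LipschitzOnWith (Real.toNNReal (A * c)) (fun τ => chartAt E (x τ₀) (x τ))
      (Metric.ball τ₀ ε) := by
    refine LipschitzOnWith.of_dist_le_mul fun τ hτ τ' hτ' => ?_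
    have h1 := ((hAd _ (hεU hτ).2 _ (hεU hτ').2).2).trans (mul_le_mul_right (hx τ
      (Ioo_subset_Icc_self (hεU hτ).1) τ' (Ioo_subset_Icc_self (hεU hτ').1)) _)
    rw [← ENNReal.ofReal_mul hA.le, ← ofReal_norm, ← mul_assoc] at h1
    rw [dist_eq_norm, Real.dist_eq]
    refine (ENNReal.ofReal_le_ofReal_iff (by positivity)).1 (h1.trans (ENNReal.ofReal_le_ofReal ?_))
    gcongr
    exact Real.le_coe_toNNReal _
  have h2 := hlip.ae_differentiableWithinAt (μ := volume) Metric.isOpen_ball.measurableSet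
  rw [ae_restrict_iff' Metric.isOpen_ball.measurableSet, ae_iff] at h2
  refine ⟨_, inter_mem self_mem_nhdsWithin
    (mem_nhdsWithin_of_mem_nhds (Metric.ball_mem_nhds τ₀ hε)), measure_mono_null ?_ h2⟩
  rintro τ ⟨hτ1, hτ2⟩
  rw [mem_ofPred_eq, Classical.not_imp] at hτ1 ⊢
  refine ⟨hτ2, fun hd => hτ1.2 ?_⟩
  have hsrc := (hεU hτ2).2.1
  have hd' := hd.differentiableAt (Metric.isOpen_ball.mem_nhds hτ2)
  refine HasMFDerivAt.mdifferentiableAt ((hasMFDerivAt_curve_iff_chart (q := x τ₀)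
    (v := chartVecSymm (x τ₀) (x τ) (deriv (fun τ => chartAt E (x τ₀) (x τ)) τ)) hsrc).2 ⟨?_, ?_⟩)
  · exact hxc.continuousAt (Icc_mem_nhds hτ1.1.1 hτ1.1.2)
  · rw [chartVec_chartVecSymm hsrc]
    exact hd'.hasDerivAt

end LipschitzCurves

/-! ### Evolution families: contraction, density of reached points, continuity -/

section EvolutionFamily

variable {E : Type*} [NormedAddCommGroup E] [NormedSpace ℂ E]
  {M : Type*} [MetricSpace M] [ChartedSpace E M] [IsManifold 𝓘(ℂ, E) ω M]
  {h : HermitianMetric E M} {φ : ℝ → ℝ → M → M}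

namespace IsEvolutionFamily

theorem self_apply (hφ : IsEvolutionFamily h φ) {s : ℝ} (hs : 0 ≤ s) (z : M) : φ s s z = z :=
  congrFun (hφ.refl s hs) z

theorem comp_apply (hφ : IsEvolutionFamily h φ) {s u t : ℝ} (hs : 0 ≤ s) (hsu : s ≤ u)
    (hut : u ≤ t) (z : M) : φ s t z = φ u t (φ s u z) := congrFun (hφ.comp s u t hs hsu hut) z

theorem exists_edist_self_le (hφ : IsEvolutionFamily h φ) {K : Set M} (hK : IsCompact K) {T : ℝ}
    (hT : 0 < T) : ∃ c > 0, ∀ s t, 0 ≤ s → s ≤ t → t ≤ T → ∀ z ∈ K,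
      h.edist z (φ s t z) ≤ ENNReal.ofReal (c * (t - s)) := by
  obtain ⟨c, hc, H⟩ := hφ.lipschitz K hK T hT
  refine ⟨c, hc, fun s t hs hst htT z hz => ?_⟩
  have := H s s t hs le_rfl hst (hst.trans htT) htT z hz
  rwa [hφ.self_apply hs, abs_sub_comm, abs_of_nonneg (by linarith)] at this

theorem ae_mdifferentiableAt [FiniteDimensional ℂ E] (hφ : IsEvolutionFamily h φ) {s : ℝ}
    (hs : 0 ≤ s) (z : M) :
    ∀ᵐ t ∂volume.restrict (Ici s), MDifferentiableAt 𝓘(ℝ, ℝ) 𝓘(ℝ, E) (φ s · z) t := by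
  rw [Ici_eq_iUnion_Icc_add_nat, ae_restrict_iUnion_iff]
  intro n
  obtain ⟨c, -, hc⟩ := hφ.exists_edist_orbit_le hs (t := s + n) z
  exact ae_mdifferentiableAt_of_edist_le h hc

variable [FiniteDimensional ℂ E]

theorem continuousOn_orbit (hφ : IsEvolutionFamily h φ) {s : ℝ} (hs : 0 ≤ s) (z : M) :
    ContinuousOn (φ s · z) (Ici s) := by
  intro t ht
  obtain ⟨c, -, hc⟩ := hφ.exists_edist_orbit_le hs (t := t + 1) z
  refine (h.continuousOn_of_edist_le hc t ⟨ht, by linarith⟩).mono_of_mem_nhdsWithin ?_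
  rw [← Ici_inter_Iic]
  exact inter_mem self_mem_nhdsWithin (mem_nhdsWithin_of_mem_nhds (Iic_mem_nhds (by linarith)))

variable [ConnectedSpace M] (hd : ∀ z w : M, dist z w = kobayashiDist E z w)

include hd

omit [FiniteDimensional ℂ E] in
theorem dist_le (hφ : IsEvolutionFamily h φ) {s t : ℝ} (hs : 0 ≤ s) (hst : s ≤ t) (z w : M) :
    dist (φ s t z) (φ s t w) ≤ dist z w := by
  have : IsManifold 𝓘(ℂ, E) 1 M := IsManifold.of_le (n := ω) le_top
  rw [hd, hd]
  exact kobayashiDist_map_le (hφ.holomorphic s t hs hst) z w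

/-- The points reached at time `t > 0` from a dense set at rational times are dense. -/
theorem dense_reachable (hφ : IsEvolutionFamily h φ) {D : Set M} (hD : Dense D) {t : ℝ}
    (ht : 0 < t) :
    Dense {y | ∃ q : ℚ, 0 ≤ (q : ℝ) ∧ (q : ℝ) < t ∧ ∃ z ∈ D, φ q t z = y} := by
  intro p
  rw [Metric.mem_closure_iff]
  intro ε hε
  obtain ⟨ε', hε', hU⟩ := h.exists_edist_lt_imp_mem (Metric.ball_mem_nhds p (half_pos hε))
  obtain ⟨c, hc, hcl⟩ := hφ.exists_edist_self_le (isCompact_singleton (x := p)) ht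
  -- For `q` this close to `t` the map `φ q t` moves `p` by less than `ε / 2`, and by contraction a
  -- point of `D` near `p` lands near the image of `p`.
  obtain ⟨q, hq1, hq2⟩ := exists_rat_btwn (K := ℝ) (x := max 0 (t - ε' / c)) (y := t)
    (max_lt ht (by linarith [div_pos hε' hc]))
  have hq0 : 0 ≤ (q : ℝ) := (le_max_left _ _).trans hq1.le
  obtain ⟨z, hzD, hz⟩ := Metric.mem_closure_iff.1 (hD p) (ε / 2) (half_pos hε)
  refine ⟨_, ⟨q, hq0, hq2, z, hzD, rfl⟩, ?_⟩
  have h1 : dist (φ q t p) p < ε / 2 := by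
    refine Metric.mem_ball.1 (hU _ ((hcl q t hq0 hq2.le le_rfl p rfl).trans_lt
      ((ENNReal.ofReal_lt_ofReal_iff hε').2 ?_)))
    have h2 : t - q < ε' / c := by linarith [(le_max_right 0 (t - ε' / c)).trans_lt hq1]
    rwa [lt_div_iff₀ hc, mul_comm] at h2
  calc dist p (φ q t z) ≤ dist p (φ q t p) + dist (φ q t p) (φ q t z) := dist_triangle _ _ _
    _ < ε / 2 + ε / 2 := by
        rw [dist_comm p]
        exact add_lt_add_of_lt_of_le h1 ((hφ.dist_le hd hq0 hq2.le p z).trans hz.le)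
    _ = ε := add_halves ε

/-- Needed for measurability of the velocity. The initial time varies, so the two sides of `t₀` are
separate: `φ` factors through time `t₀` on the left and through time `t` on the right, and
contraction transports the small displacement of `z`. -/
theorem continuousOn_shift (hφ : IsEvolutionFamily h φ) {η : ℝ} (hη : 0 ≤ η) (z : M) :
    ContinuousOn (fun t => φ t (t + η) z) (Ici 0) := by
  intro t₀ ht₀
  rw [mem_Ici] at ht₀
  rw [← Icc_union_Ici_eq_Ici ht₀]
  refine ContinuousWithinAt.union ?_ ?_
  · obtain ⟨c, hc, hcl⟩ := hφ.lipschitz {z} isCompact_singleton (t₀ + η + 1) (by positivity)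
    have h1 : Tendsto (fun t => φ t t₀ z) (𝓝[Icc 0 t₀] t₀) (𝓝 z) := by
      refine h.tendsto_nhds_iff.2 (tendsto_of_tendsto_of_tendsto_of_le_of_le' tendsto_const_nhds
        ((tendsto_ofReal_mul_abs_sub c t₀).mono_left nhdsWithin_le_nhds)
        (Eventually.of_forall fun _ => zero_le) ?_)
      filter_upwards [self_mem_nhdsWithin] with t ht
      have := hcl t t t₀ ht.1 le_rfl ht.2 (by linarith [ht.2]) (by linarith) z rfl
      rwa [hφ.self_apply ht.1, abs_sub_comm] at this
    have h2 : Tendsto (fun t => φ t (t₀ + η) z) (𝓝[Icc 0 t₀] t₀) (𝓝 (φ t₀ (t₀ + η) z)) := by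
      rw [tendsto_iff_dist_tendsto_zero] at h1 ⊢
      refine squeeze_zero' (Eventually.of_forall fun _ => dist_nonneg) ?_ h1
      filter_upwards [self_mem_nhdsWithin] with t ht
      rw [hφ.comp_apply ht.1 ht.2 (by linarith)]
      exact hφ.dist_le hd ht₀ (by linarith) _ _
    have h3 := (h.tendsto_nhds_iff.1 h2).add
      ((tendsto_ofReal_mul_abs_sub c t₀).mono_left nhdsWithin_le_nhds)
    rw [add_zero] at h3
    rw [ContinuousWithinAt, h.tendsto_nhds_iff]
    refine tendsto_of_tendsto_of_tendsto_of_le_of_le' tendsto_const_nhds h3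
      (Eventually.of_forall fun _ => zero_le) ?_
    filter_upwards [self_mem_nhdsWithin] with t ht
    refine (h.edist_triangle _ (φ t (t₀ + η) z) _).trans (add_le_add le_rfl ?_)
    have := hcl t (t₀ + η) (t + η) ht.1 (by linarith [ht.2]) (by linarith) (by linarith)
      (by linarith [ht.2]) z rfl
    rwa [add_sub_add_right_eq_sub] at this
  · have h1 : Tendsto (fun t => φ t₀ (t + η) z) (𝓝[Ici t₀] t₀) (𝓝 (φ t₀ (t₀ + η) z)) := by
      refine (hφ.continuousOn_orbit ht₀ z (t₀ + η) (by simpa using hη)).tendsto.comp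
        (tendsto_nhdsWithin_iff.2 ⟨?_, ?_⟩)
      · exact ((continuous_add_const η).tendsto t₀).mono_left nhdsWithin_le_nhds
      · filter_upwards [self_mem_nhdsWithin] with t ht
        exact le_add_of_le_of_nonneg ht hη
    refine h1.congr_dist ?_
    have h2 : Tendsto (fun t => dist (φ t₀ t z) z) (𝓝[Ici t₀] t₀) (𝓝 0) := by
      rw [← tendsto_iff_dist_tendsto_zero]
      have := hφ.continuousOn_orbit ht₀ z t₀ self_mem_Ici
      rwa [ContinuousWithinAt, hφ.self_apply ht₀] at this
    refine squeeze_zero' (Eventually.of_forall fun _ => dist_nonneg) ?_ h2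
    filter_upwards [self_mem_nhdsWithin] with t ht
    rw [hφ.comp_apply ht₀ ht (by linarith)]
    exact hφ.dist_le hd (ht₀.trans ht) (by linarith) _ _

end IsEvolutionFamily

end EvolutionFamily

/-! ### The velocity field of an evolution family -/

section Velocity

variable (E : Type*) [NormedAddCommGroup E] [NormedSpace ℂ E]
  {M : Type*} [TopologicalSpace M] [ChartedSpace E M]

/-- At the time `t` all orbits `τ ↦ φ t τ z` have a right derivative. -/
def IsRegularTime (φ : ℝ → ℝ → M → M) (t : ℝ) : Prop :=
  ∀ z : M, ∃ v : E, HasDerivWithinAt (fun τ => chartAt E z (φ t τ z)) v (Ici t) t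

open Classical in
/-- The right derivative at `t` of the orbit `τ ↦ φ t τ z`, set to zero at irregular times. -/
def velocity (φ : ℝ → ℝ → M → M) (z : M) (t : ℝ) : TangentSpace 𝓘(ℂ, E) z :=
  if 0 ≤ t ∧ IsRegularTime E φ t then
    (derivWithin (fun τ => chartAt E z (φ t τ z)) (Ici t) t : E) else (0 : E)

variable {E}

theorem velocity_of_not_isRegularTime {φ : ℝ → ℝ → M → M} {t : ℝ} (ht : ¬ IsRegularTime E φ t)
    (z : M) : velocity E φ z t = 0 := if_neg fun H => ht H.2

end Velocity

/-! ### Regular times; holomorphy, bounds and measurability of the velocity -/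

section EvolutionFamily

variable {E : Type*} [NormedAddCommGroup E] [NormedSpace ℂ E] [FiniteDimensional ℂ E]
  {M : Type*} [MetricSpace M] [ChartedSpace E M] [IsManifold 𝓘(ℂ, E) ω M]
  {h : HermitianMetric E M} {φ : ℝ → ℝ → M → M}

namespace IsEvolutionFamily

omit [FiniteDimensional ℂ E] in
theorem hasDerivWithinAt_orbit_iff (hφ : IsEvolutionFamily h φ) {t : ℝ} (ht : 0 ≤ t) {q z : M}
    {v : E} : HasDerivWithinAt (fun τ => chartAt E q (φ t τ z)) v (Ici t) t ↔
      Tendsto (fun τ => (τ - t)⁻¹ • (chartAt E q (φ t τ z) - chartAt E q z)) (𝓝[>] t) (𝓝 v) := by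
  rw [← hasDerivWithinAt_Ioi_iff_Ici, hasDerivWithinAt_iff_tendsto_slope' self_notMem_Ioi]
  refine iff_of_eq (congrArg (Tendsto · (𝓝[>] t) (𝓝 v)) (funext fun τ => ?_))
  rw [slope, vsub_eq_sub, hφ.self_apply ht]

/-- The velocity at `z` is defined in the preferred chart at `z`; comparing different points
requires reading it in one chart. -/
theorem hasDerivWithinAt_velocity (hφ : IsEvolutionFamily h φ) {t : ℝ} (ht : 0 ≤ t)
    (hr : IsRegularTime E φ t) {q z : M} (hz : z ∈ (chartAt E q).source) :
    HasDerivWithinAt (fun τ => chartAt E q (φ t τ z)) (chartVec q z (velocity E φ z t))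
      (Ici t) t := by
  have : IsManifold 𝓘(ℂ, E) 1 M := IsManifold.of_le (n := ω) le_top
  obtain ⟨v, hv⟩ := hr z
  have h1 : velocity E φ z t = v :=
    (if_pos ⟨ht, hr⟩).trans (hv.derivWithin (uniqueDiffWithinAt_Ici t))
  have h2 := hasDerivWithinAt_chart_change (x := fun τ => φ t τ z) (q := z) (q' := q)
    (hφ.continuousOn_orbit ht z t self_mem_Ici)
    (by rw [hφ.self_apply ht]; exact mem_chart_source E z) (by rwa [hφ.self_apply ht]) hv
  rw [h1]
  simp only [hφ.self_apply ht] at h2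
  exact h2

/-- Uniform local bounds for the displacement of points. -/
theorem exists_norm_chart_sub_le (hφ : IsEvolutionFamily h φ) (p : M) {T : ℝ} (hT : 0 < T) :
    ∃ R > 0, ∃ C ≥ 0, ∃ η > 0, Metric.ball (chartAt E p p) R ⊆ (chartAt E p).target ∧
      (∀ z ∈ chartBall E p R, ∀ v : TangentSpace 𝓘(ℂ, E) z, h.norm z v ≤ C * ‖chartVec p z v‖) ∧
      ∀ t τ, 0 ≤ t → t ≤ T → t ≤ τ → τ ≤ t + η → ∀ z ∈ chartBall E p R,
        φ t τ z ∈ (chartAt E p).source ∧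
          ‖chartAt E p (φ t τ z) - chartAt E p z‖ ≤ C * (τ - t) := by
  have : ProperSpace E := FiniteDimensional.proper ℂ E
  obtain ⟨A, hA, R, hR, hRt, hAv, hAd⟩ := h.exists_comparison p
  set χ := chartAt E p with hχ
  have hcb : Metric.closedBall (χ p) (R / 2) ⊆ χ.target :=
    (Metric.closedBall_subset_ball (by linarith)).trans hRt
  have hK : IsCompact (χ.symm '' Metric.closedBall (χ p) (R / 2)) :=
    (isCompact_closedBall _ _).image_of_continuousOn (χ.continuousOn_symm.mono hcb)
  obtain ⟨c, hc, hcl⟩ := hφ.exists_edist_self_le hK (T := T + 1) (by linarith)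
  obtain ⟨ε, hε, hεU⟩ := h.exists_edist_lt_imp_mem (chartBall_mem_nhds (E := E) p hR)
  -- `R / 2` keeps `z` in the compact set. The distances from `p` to `z` and from `z` to its image
  -- are each bounded by `ε / 2`, the first strictly, so the image stays in the coordinate ball.
  have hR' : min (R / 2) (ε / (2 * A)) ≤ R := (min_le_left _ _).trans (by linarith)
  refine ⟨min (R / 2) (ε / (2 * A)), lt_min (by positivity) (by positivity), max A (A * c),
    le_max_of_le_left hA.le, min 1 (ε / (2 * c)), lt_min one_pos (by positivity),
    (Metric.ball_subset_ball hR').trans hRt, fun z hz v => ?_, fun t τ ht htT htτ hτη z hz => ?_⟩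
  · refine (hAv z (chartBall_mono p hR' hz) v).2.trans ?_
    gcongr
    exact le_max_left _ _
  · have hzR := chartBall_mono p hR' hz
    have hzK : z ∈ χ.symm '' Metric.closedBall (χ p) (R / 2) :=
      ⟨χ z, Metric.ball_subset_closedBall (Metric.ball_subset_ball (min_le_left _ _) hz.2),
        χ.left_inv hz.1⟩
    have hτ1 : τ - t ≤ ε / (2 * c) := by linarith [min_le_right 1 (ε / (2 * c))]
    have h1 := hcl t τ ht htτ (by linarith [min_le_left 1 (ε / (2 * c))]) z hzK
    have hpR := mem_of_mem_nhds (chartBall_mem_nhds (E := E) p hR)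
    have h2 : φ t τ z ∈ chartBall E p R := by
      refine hεU _ ((h.edist_triangle p z _).trans_lt ((add_le_add (hAd p hpR z hzR).1 h1).trans_lt ?_))
      rw [← ENNReal.ofReal_add (by positivity) (mul_nonneg hc.le (by linarith)),
        ENNReal.ofReal_lt_ofReal_iff hε]
      have h3 : ‖χ p - χ z‖ < ε / (2 * A) := by
        rw [← dist_eq_norm, dist_comm]
        exact (Metric.mem_ball.1 hz.2).trans_le (min_le_right _ _)
      rw [lt_div_iff₀ (by positivity)] at h3
      rw [le_div_iff₀ (by positivity)] at hτ1
      linarith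
    refine ⟨h2.1, ?_⟩
    have h3 := (hAd z hzR _ h2).2.trans (mul_le_mul_right h1 _)
    rw [← ENNReal.ofReal_mul hA.le, ← ofReal_norm, ENNReal.ofReal_le_ofReal_iff
      (mul_nonneg hA.le (mul_nonneg hc.le (by linarith))), norm_sub_rev, ← mul_assoc] at h3
    refine h3.trans ?_
    gcongr
    exact le_max_right _ _

omit [FiniteDimensional ℂ E] in
theorem differentiableAt_chart (hφ : IsEvolutionFamily h φ) {t τ : ℝ} (ht : 0 ≤ t) (htτ : t ≤ τ)
    {p : M} {y : E} (hy : y ∈ (chartAt E p).target)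
    (hφy : φ t τ ((chartAt E p).symm y) ∈ (chartAt E p).source) :
    DifferentiableAt ℂ (fun y => chartAt E p (φ t τ ((chartAt E p).symm y))) y := by
  have : IsManifold 𝓘(ℂ, E) 1 M := IsManifold.of_le (n := ω) le_top
  have h1 : MDifferentiableAt 𝓘(ℂ, E) 𝓘(ℂ, E) (fun z => chartAt E p (φ t τ z))
      ((chartAt E p).symm y) :=
    MDifferentiableAt.comp (I' := 𝓘(ℂ, E)) _
      (mdifferentiableAt_atlas (chart_mem_atlas E p) hφy) (hφ.holomorphic t τ ht htτ _)
  rw [mdifferentiableAt_iff_chart (q := p) ((chartAt E p).map_target hy),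
    (chartAt E p).right_inv hy] at h1
  exact h1

omit [FiniteDimensional ℂ E] in
theorem differentiableOn_quotient (hφ : IsEvolutionFamily h φ) {t τ : ℝ} (ht : 0 ≤ t) (htτ : t ≤ τ)
    {p : M} {R : ℝ} (hR : Metric.ball (chartAt E p p) R ⊆ (chartAt E p).target)
    (hφR : ∀ z ∈ chartBall E p R, φ t τ z ∈ (chartAt E p).source) :
    DifferentiableOn ℂ (fun y => (τ - t)⁻¹ • (chartAt E p (φ t τ ((chartAt E p).symm y)) - y))
      (Metric.ball (chartAt E p p) R) := by
  intro y hy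
  have h1 : (chartAt E p).symm y ∈ chartBall E p R :=
    ⟨(chartAt E p).map_target (hR hy), by rwa [mem_preimage, (chartAt E p).right_inv (hR hy)]⟩
  exact (((hφ.differentiableAt_chart ht htτ (hR hy) (hφR _ h1)).sub
    differentiableAt_id).const_smul _).differentiableWithinAt

omit [FiniteDimensional ℂ E] in
theorem norm_quotient_le {t τ C : ℝ} (htτ : t < τ) {u : E} (hu : ‖u‖ ≤ C * (τ - t)) :
    ‖(τ - t)⁻¹ • u‖ ≤ C := by
  have h1 : 0 < τ - t := by linarith
  rw [norm_smul, norm_inv, Real.norm_of_nonneg h1.le, inv_mul_le_iff₀ h1, mul_comm]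
  exact hu

variable [ConnectedSpace M] (hd : ∀ z w : M, dist z w = kobayashiDist E z w)

include hd

/-- At a reached point `y = φ q t z` the curve `τ ↦ φ t τ y` continues the orbit from `(q, z)`,
hence has a right derivative. Such points are dense and the quotients are bounded holomorphic maps,
so convergence spreads to every point. -/
theorem isRegularTime (hφ : IsEvolutionFamily h φ) {D : Set M} (hD : Dense D) {t : ℝ} (ht : 0 < t)
    (H : ∀ q : ℚ, 0 ≤ (q : ℝ) → (q : ℝ) ≤ t → ∀ z ∈ D,
      MDifferentiableAt 𝓘(ℝ, ℝ) 𝓘(ℝ, E) (φ q · z) t) : IsRegularTime E φ t := by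
  have : IsManifold 𝓘(ℂ, E) 1 M := IsManifold.of_le (n := ω) le_top
  intro p
  obtain ⟨R, hR, C, hC, η, hη, hRt, -, hdisp⟩ := hφ.exists_norm_chart_sub_le p ht
  set χ := chartAt E p with hχ
  set S : Set M := {y | ∃ q : ℚ, 0 ≤ (q : ℝ) ∧ (q : ℝ) < t ∧ ∃ z ∈ D, φ q t z = y} with hS
  have hpR := mem_of_mem_nhds (chartBall_mem_nhds (E := E) p hR)
  have hcl : χ p ∈ closure (χ '' (chartBall E p R ∩ S)) :=
    (χ.continuousAt hpR.1).continuousWithinAt.mem_closure_image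
      ((isOpen_chartBall p R).inter_closure ⟨hpR, hφ.dense_reachable hd hD ht p⟩)
  have hsymm : ∀ y ∈ Metric.ball (χ p) R, χ.symm y ∈ chartBall E p R := fun y hy =>
    ⟨χ.map_target (hRt hy), by rwa [mem_preimage, ← hχ, χ.right_inv (hRt hy)]⟩
  have hev : ∀ᶠ τ in 𝓝[>] t, t < τ ∧ τ ≤ t + η := by
    filter_upwards [Ioo_mem_nhdsGT (show t < t + η by linarith)] with τ hτ
    exact ⟨hτ.1, hτ.2.le⟩
  suffices hlim : ∃ v, Tendsto (fun τ => (τ - t)⁻¹ • (χ (φ t τ (χ.symm (χ p))) - χ p)) (𝓝[>] t)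
      (𝓝 v) by
    obtain ⟨v, hv⟩ := hlim
    refine ⟨v, (hφ.hasDerivWithinAt_orbit_iff ht.le).2 ?_⟩
    simpa only [χ.left_inv hpR.1] using hv
  refine exists_tendsto_of_dense (C := C) (f := fun τ y => (τ - t)⁻¹ • (χ (φ t τ (χ.symm y)) - y))
    hR _ hcl ?_ ?_ ?_
  · filter_upwards [hev] with τ hτ
    exact hφ.differentiableOn_quotient ht.le hτ.1.le hRt
      fun z hz => (hdisp t τ ht.le le_rfl hτ.1.le hτ.2 z hz).1
  · filter_upwards [hev] with τ hτ y hy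
    have := (hdisp t τ ht.le le_rfl hτ.1.le hτ.2 _ (hsymm y hy)).2
    rw [χ.right_inv (hRt hy)] at this
    exact norm_quotient_le hτ.1 this
  · rintro _ ⟨_, ⟨hyR, q, hq0, hqt, z, hz, rfl⟩, rfl⟩
    obtain ⟨v, hv⟩ := exists_hasMFDerivAt_of_mdifferentiableAt (H q hq0 hqt.le z hz)
    have h1 := ((hasMFDerivAt_curve_iff_chart hyR.1).1 hv).2.hasDerivWithinAt (s := Ici t)
    refine ⟨chartVec p (φ q t z) v, ?_⟩
    simp only [χ.left_inv hyR.1]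
    refine (hφ.hasDerivWithinAt_orbit_iff ht.le).1 (h1.congr (fun τ hτ => ?_) ?_)
    · rw [hφ.comp_apply hq0 hqt.le hτ z]
    · rw [hφ.self_apply ht.le]

/-- Countably many orbits suffice, so their exceptional sets have a null union; time zero, which no
earlier orbit reaches, is discarded. -/
theorem ae_isRegularTime [SecondCountableTopology M] (hφ : IsEvolutionFamily h φ) :
    ∀ᵐ t ∂volume.restrict (Ici (0 : ℝ)), IsRegularTime E φ t := by
  obtain ⟨D, hDc, hD⟩ := TopologicalSpace.exists_countable_dense M
  have H : ∀ᵐ t, ∀ q : ℚ, ∀ z ∈ D, 0 ≤ (q : ℝ) → (q : ℝ) ≤ t →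
      MDifferentiableAt 𝓘(ℝ, ℝ) 𝓘(ℝ, E) (φ q · z) t := by
    refine ae_all_iff.2 fun q => (ae_ball_iff hDc).2 fun z hz => ?_
    by_cases hq : 0 ≤ (q : ℝ)
    · have := hφ.ae_mdifferentiableAt hq z
      rw [ae_restrict_iff' measurableSet_Ici] at this
      filter_upwards [this] with t ht _ hqt using ht hqt
    · exact Eventually.of_forall fun t h0 => absurd h0 hq
  rw [← restrict_Ioi_eq_restrict_Ici, ae_restrict_iff' measurableSet_Ioi]
  filter_upwards [H] with t ht ht0
  exact hφ.isRegularTime hd hD ht0 fun q hq0 hqt z hz => ht q z hz hq0 hqt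

omit [ConnectedSpace M] hd in
-- At a regular time the field is a pointwise limit of locally bounded holomorphic quotients; at the
-- remaining times it is zero by definition.
theorem mdifferentiable_velocity (hφ : IsEvolutionFamily h φ) {t : ℝ} (ht : 0 ≤ t) :
    MDifferentiable 𝓘(ℂ, E) 𝓘(ℂ, E).tangent
      fun z : M => (⟨z, velocity E φ z t⟩ : TangentBundle 𝓘(ℂ, E) M) := by
  have : IsManifold 𝓘(ℂ, E) 1 M := IsManifold.of_le (n := ω) le_top
  intro p
  rw [mdifferentiableAt_section_iff_chart (mem_chart_source E p)]
  by_cases hr : IsRegularTime E φ t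
  · obtain ⟨R, hR, C, hC, η, hη, hRt, -, hdisp⟩ := hφ.exists_norm_chart_sub_le p
      (T := t + 1) (by linarith)
    set χ := chartAt E p with hχ
    have hsymm : ∀ y ∈ Metric.ball (χ p) R, χ.symm y ∈ chartBall E p R := fun y hy =>
      ⟨χ.map_target (hRt hy), by rwa [mem_preimage, ← hχ, χ.right_inv (hRt hy)]⟩
    set u : ℕ → ℝ := fun n => t + η / (n + 1) with hu
    have hut : ∀ n, t < u n := fun n => lt_add_of_pos_right t (by positivity)
    have huη : ∀ n, u n ≤ t + η := fun n => by
      have : η / (n + 1 : ℝ) ≤ η := div_le_self hη.le (by linarith [show (0:ℝ) ≤ n by positivity])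
      simp only [hu]
      linarith
    have hulim : Tendsto u atTop (𝓝[>] t) := by
      refine tendsto_nhdsWithin_iff.2 ⟨?_, Eventually.of_forall hut⟩
      have h1 := (tendsto_one_div_add_atTop_nhds_zero_nat (𝕜 := ℝ)).const_mul η
      have h2 := h1.const_add t
      simpa [hu, div_eq_mul_inv] using h2
    refine differentiableAt_of_tendsto_of_bounded (C := C) hR
      (f := fun n y => (u n - t)⁻¹ • (χ (φ t (u n) (χ.symm y)) - y)) (fun n => ?_)
      (fun n y hy => ?_) fun y hy => ?_
    · exact hφ.differentiableOn_quotient ht (hut n).le hRt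
        fun z hz => (hdisp t (u n) ht (by linarith) (hut n).le (huη n) z hz).1
    · have := (hdisp t (u n) ht (by linarith) (hut n).le (huη n) _ (hsymm y hy)).2
      rw [χ.right_inv (hRt hy)] at this
      exact norm_quotient_le (hut n) this
    · have h1 := (hφ.hasDerivWithinAt_orbit_iff ht).1
        (hφ.hasDerivWithinAt_velocity ht hr (hsymm y hy).1)
      rw [← hχ, χ.right_inv (hRt hy)] at h1
      exact h1.comp hulim
  · simp only [velocity_of_not_isRegularTime hr, chartVec_zero]
    exact differentiableAt_const 0

omit [ConnectedSpace M] hd in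
theorem exists_norm_velocity_le (hφ : IsEvolutionFamily h φ) {K : Set M} (hK : IsCompact K) {T : ℝ}
    (hT : 0 < T) : ∃ C ≥ 0, ∀ t ∈ Icc 0 T, ∀ z ∈ K, h.norm z (velocity E φ z t) ≤ C := by
  have : IsManifold 𝓘(ℂ, E) 1 M := IsManifold.of_le (n := ω) le_top
  refine hK.induction_on (p := fun K => ∃ C ≥ 0, ∀ t ∈ Icc 0 T, ∀ z ∈ K,
    h.norm z (velocity E φ z t) ≤ C) ⟨0, le_rfl, fun _ _ _ => False.elim⟩ ?_ ?_ fun p _ => ?_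
  · rintro K K' hKK' ⟨C, hC, H⟩
    exact ⟨C, hC, fun t ht z hz => H t ht z (hKK' hz)⟩
  · rintro K K' ⟨C, hC, H⟩ ⟨C', hC', H'⟩
    refine ⟨max C C', le_max_of_le_left hC, fun t ht z hz => hz.elim (fun hz => ?_) fun hz => ?_⟩
    · exact (H t ht z hz).trans (le_max_left _ _)
    · exact (H' t ht z hz).trans (le_max_right _ _)
  · obtain ⟨R, hR, C, hC, η, hη, hRt, hn, hdisp⟩ := hφ.exists_norm_chart_sub_le p hT
    -- One factor bounds the quotients in the chart, the other compares the Hermitian norm with the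
    -- chart norm.
    refine ⟨chartBall E p R, mem_nhdsWithin_of_mem_nhds (chartBall_mem_nhds p hR), C * C,
      by positivity, fun t ht z hz => (hn z hz _).trans ?_⟩
    gcongr
    by_cases hr : IsRegularTime E φ t
    · refine le_of_tendsto ((hφ.hasDerivWithinAt_orbit_iff ht.1).1
        (hφ.hasDerivWithinAt_velocity ht.1 hr hz.1)).norm ?_
      filter_upwards [Ioo_mem_nhdsGT (show t < t + η by linarith)] with τ hτ
      exact norm_quotient_le hτ.1 (hdisp t τ ht.1 ht.2 hτ.1.le hτ.2.le z hz).2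
    · rw [velocity_of_not_isRegularTime hr, chartVec_zero, _root_.norm_zero]
      exact hC

/-- At regular times the velocity is a limit of quotients of `t ↦ φ t (t + u n) z`, which is
continuous. The chart is extended by zero to be measurable on `M`; this does not affect the limit,
as the points end up in its domain. -/
theorem aestronglyMeasurable_velocity [SecondCountableTopology M] (hφ : IsEvolutionFamily h φ)
    (z : M) : AEStronglyMeasurable (fun t => velocity E φ z t) (volume.restrict (Ici (0 : ℝ))) := by
  classical
  have : IsManifold 𝓘(ℂ, E) 1 M := IsManifold.of_le (n := ω) le_top
  have : ProperSpace E := FiniteDimensional.proper ℂ E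
  borelize M E
  set χ := chartAt E z with hχ
  have hξ : Measurable (χ.source.piecewise χ 0) :=
    χ.continuousOn.measurable_piecewise continuousOn_const χ.open_source.measurableSet
  set u : ℕ → ℝ := fun n => 1 / ((n : ℝ) + 1) with hu
  have hu0 : ∀ n, 0 < u n := fun n => by positivity
  refine aestronglyMeasurable_of_tendsto_ae (β := E) atTop
    (f := fun n t => (u n)⁻¹ • (χ.source.piecewise χ 0 (φ t (t + u n) z) - χ z)) (fun n => ?_) ?_
  · have h1 : AEMeasurable (fun t => φ t (t + u n) z) (volume.restrict (Ici (0 : ℝ))) :=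
      (hφ.continuousOn_shift hd (hu0 n).le z).aemeasurable measurableSet_Ici
    have h2 := (hξ.comp_aemeasurable h1).aestronglyMeasurable
    exact (h2.sub aestronglyMeasurable_const).const_smul _
  · filter_upwards [hφ.ae_isRegularTime hd, ae_restrict_mem measurableSet_Ici] with t hr ht
    have hlim : Tendsto (fun n => t + u n) atTop (𝓝[>] t) := by
      refine tendsto_nhdsWithin_iff.2 ⟨?_, Eventually.of_forall fun n => ?_⟩
      · simpa only [add_zero] using (tendsto_one_div_add_atTop_nhds_zero_nat (𝕜 := ℝ)).const_add t
      · exact lt_add_of_pos_right t (hu0 n)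
    have h1 := ((hφ.hasDerivWithinAt_orbit_iff ht).1
      (hφ.hasDerivWithinAt_velocity ht hr (mem_chart_source E z))).comp hlim
    rw [chartVec_self] at h1
    refine Tendsto.congr' ?_ h1
    have h2 : Tendsto (fun n => φ t (t + u n) z) atTop (𝓝 z) := by
      have h3 := (hφ.continuousOn_orbit ht z t self_mem_Ici).tendsto
      rw [hφ.self_apply ht] at h3
      exact h3.comp (hlim.mono_right (nhdsWithin_mono t Ioi_subset_Ici_self))
    filter_upwards [h2 (χ.open_source.mem_nhds (mem_chart_source E z))] with n hn
    rw [Function.comp_apply, add_sub_cancel_left, piecewise_eq_of_mem (s := χ.source) _ _ hn]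

theorem isWeakHolomorphicVectorField_velocity [SecondCountableTopology M]
    (hφ : IsEvolutionFamily h φ) : IsWeakHolomorphicVectorField h ⊤ (velocity E φ) := by
  refine ⟨hφ.aestronglyMeasurable_velocity hd, fun t ht => hφ.mdifferentiable_velocity ht,
    fun K hK T hT => ?_⟩
  obtain ⟨C, hC, H⟩ := hφ.exists_norm_velocity_le hK hT
  refine ⟨fun _ => C, fun _ => hC, memLp_const C, ?_⟩
  filter_upwards [ae_restrict_mem measurableSet_Icc] with t ht z hz
  exact H t ht z hz

end IsEvolutionFamily

end EvolutionFamily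

/-! ### The velocity is Herglotz, generates the family, and is unique -/

section EvolutionFamily

variable {E : Type*} [NormedAddCommGroup E] [NormedSpace ℂ E] [FiniteDimensional ℂ E]
  {M : Type*} [MetricSpace M] [ChartedSpace E M] [IsManifold 𝓘(ℂ, E) ω M]
  {h : HermitianMetric E M} {φ : ℝ → ℝ → M → M}

omit [FiniteDimensional ℂ E] in
theorem hasDerivWithinAt_kobayashiDist_of_eq (hk : KobayashiDistC1 E M) {x y : ℝ → M} {S : Set ℝ}
    {t : ℝ} {z w : M} (hxz : x t = z) (hyw : y t = w) {u : TangentSpace 𝓘(ℂ, E) z}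
    {v : TangentSpace 𝓘(ℂ, E) w} (hne : z ≠ w)
    (hxc : ContinuousWithinAt x S t) (hyc : ContinuousWithinAt y S t)
    (hx : HasDerivWithinAt (fun τ => chartAt E z (x τ)) (chartVec z z u) S t)
    (hy : HasDerivWithinAt (fun τ => chartAt E w (y τ)) (chartVec w w v) S t) :
    HasDerivWithinAt (fun τ => kobayashiDist E (x τ) (y τ)) (kobayashiDifferential E u v) S t := by
  have : IsManifold 𝓘(ℂ, E) 1 M := IsManifold.of_le (n := ω) le_top
  subst hxz hyw
  exact hasDerivWithinAt_kobayashiDist hk hne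
    ((hasMFDerivWithinAt_curve_iff_chart (mem_chart_source E _)).2 ⟨hxc, hx⟩)
    ((hasMFDerivWithinAt_curve_iff_chart (mem_chart_source E _)).2 ⟨hyc, hy⟩)

namespace IsEvolutionFamily

variable [ConnectedSpace M] (hd : ∀ z w : M, dist z w = kobayashiDist E z w)

include hd

/-- The differential is the right derivative of `k_M` along two orbits issuing from `z` and `w`,
whose difference quotients are nonpositive because `φ t τ` is a contraction. -/
theorem kobayashiDifferential_velocity_le (hk : KobayashiDistC1 E M) (hφ : IsEvolutionFamily h φ)
    {t : ℝ} (ht : 0 ≤ t) (hr : IsRegularTime E φ t) {z w : M} (hzw : z ≠ w) :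
    kobayashiDifferential E (velocity E φ z t) (velocity E φ w t) ≤ 0 := by
  have h1 := hasDerivWithinAt_kobayashiDist_of_eq hk (hφ.self_apply ht z) (hφ.self_apply ht w) hzw
    (hφ.continuousOn_orbit ht z t self_mem_Ici) (hφ.continuousOn_orbit ht w t self_mem_Ici)
    (hφ.hasDerivWithinAt_velocity ht hr (mem_chart_source E z))
    (hφ.hasDerivWithinAt_velocity ht hr (mem_chart_source E w))
  rw [← hasDerivWithinAt_Ioi_iff_Ici, hasDerivWithinAt_iff_tendsto_slope' self_notMem_Ioi] at h1
  refine le_of_tendsto h1 ?_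
  filter_upwards [self_mem_nhdsWithin] with τ hτ
  rw [slope_def_field, hφ.self_apply ht, hφ.self_apply ht, ← hd, ← hd]
  exact div_nonpos_of_nonpos_of_nonneg (sub_nonpos.2 (hφ.dist_le hd ht (le_of_lt hτ) z w))
    (sub_nonneg.2 (le_of_lt hτ))

variable [SecondCountableTopology M]

theorem isHerglotzVectorField_velocity (hk : KobayashiDistC1 E M) (hφ : IsEvolutionFamily h φ) :
    IsHerglotzVectorField h (velocity E φ) := by
  refine ⟨hφ.isWeakHolomorphicVectorField_velocity hd, ?_⟩
  filter_upwards [hφ.ae_isRegularTime hd, ae_restrict_mem measurableSet_Ici] with t hr ht z w hzw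
  exact hφ.kobayashiDifferential_velocity_le hd hk ht hr hzw

/-- At a.e. `t` the orbit from time `s` has a two-sided derivative and `t` is regular. For `τ ≥ t`
the orbit restarts from `φ s t z`, so its right derivative is the velocity there, and the two
derivatives coincide. -/
theorem isGeneratedBy_velocity (hφ : IsEvolutionFamily h φ) :
    IsGeneratedBy φ (velocity E φ) := by
  have : IsManifold 𝓘(ℂ, E) 1 M := IsManifold.of_le (n := ω) le_top
  intro s hs z
  filter_upwards [hφ.ae_mdifferentiableAt hs z, ae_restrict_mem measurableSet_Ici,
    ae_restrict_of_ae_restrict_of_subset (Ici_subset_Ici.2 hs) (hφ.ae_isRegularTime hd)]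
    with t hm hst hr
  have ht : 0 ≤ t := hs.trans hst
  obtain ⟨v, hv⟩ := exists_hasMFDerivAt_of_mdifferentiableAt hm
  have hsrc := mem_chart_source E (φ s t z)
  have h1 := ((hasMFDerivAt_curve_iff_chart hsrc).1 hv).2.hasDerivWithinAt (s := Ici t)
  have h2 : HasDerivWithinAt (fun τ => chartAt E (φ s t z) (φ s τ z))
      (chartVec (φ s t z) (φ s t z) (velocity E φ (φ s t z) t)) (Ici t) t := by
    refine (hφ.hasDerivWithinAt_velocity ht hr hsrc).congr (fun τ hτ => ?_) ?_
    · rw [hφ.comp_apply hs hst hτ z]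
    · rw [hφ.self_apply ht]
  have h3 := (uniqueDiffWithinAt_Ici t).eq_deriv _ h1 h2
  rw [chartVec_self, chartVec_self] at h3
  rwa [h3] at hv

/-- A vector field that generates an evolution family is determined by it. -/
theorem ae_eq_of_isGeneratedBy (hφ : IsEvolutionFamily h φ)
    {G H : ∀ z : M, ℝ → TangentSpace 𝓘(ℂ, E) z}
    (hG : ∀ t : ℝ, 0 ≤ t → MDifferentiable 𝓘(ℂ, E) 𝓘(ℂ, E).tangent
      fun z : M => (⟨z, G z t⟩ : TangentBundle 𝓘(ℂ, E) M))
    (hH : ∀ t : ℝ, 0 ≤ t → MDifferentiable 𝓘(ℂ, E) 𝓘(ℂ, E).tangent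
      fun z : M => (⟨z, H z t⟩ : TangentBundle 𝓘(ℂ, E) M))
    (hφG : IsGeneratedBy φ G) (hφH : IsGeneratedBy φ H) :
    ∀ᵐ t ∂(volume.restrict (Ici (0 : ℝ))), ∀ z : M, G z t = H z t := by
  have : IsManifold 𝓘(ℂ, E) 1 M := IsManifold.of_le (n := ω) le_top
  obtain ⟨D, hDc, hD⟩ := TopologicalSpace.exists_countable_dense M
  have key : ∀ᵐ t, ∀ q : ℚ, ∀ z ∈ D, 0 ≤ (q : ℝ) → (q : ℝ) ≤ t →
      G (φ q t z) t = H (φ q t z) t := by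
    refine ae_all_iff.2 fun q => (ae_ball_iff hDc).2 fun z hz => ?_
    by_cases hq : 0 ≤ (q : ℝ)
    · have h1 := hφG q hq z
      have h2 := hφH q hq z
      rw [ae_restrict_iff' measurableSet_Ici] at h1 h2
      filter_upwards [h1, h2] with t ht1 ht2 _ hqt
      exact eq_of_hasMFDerivAt (x := (φ q · z)) (ht1 hqt) (ht2 hqt)
    · exact Eventually.of_forall fun t h0 => absurd h0 hq
  have hcont : ∀ {X : ∀ z : M, ℝ → TangentSpace 𝓘(ℂ, E) z} {t : ℝ}, (MDifferentiable 𝓘(ℂ, E)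
      𝓘(ℂ, E).tangent fun z : M => (⟨z, X z t⟩ : TangentBundle 𝓘(ℂ, E) M)) → ∀ p : M,
      ContinuousAt (fun z => chartVec p z (X z t)) p := fun {X t} hX p =>
    ((mdifferentiableAt_iff_chart (f := fun z => chartVec p z (X z t)) (mem_chart_source E p)).2
      ((mdifferentiableAt_section_iff_chart (mem_chart_source E p)).1 (hX p))).continuousAt
  rw [← restrict_Ioi_eq_restrict_Ici, ae_restrict_iff' measurableSet_Ioi]
  filter_upwards [key] with t hkey ht p
  rw [mem_Ioi] at ht
  -- Both fields are continuous and agree at the reached points, which accumulate at `p`.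
  have hcl := hφ.dense_reachable hd hD ht p
  rw [mem_closure_iff_nhdsWithin_neBot] at hcl
  have h1 := (hcont (hG t ht.le) p).tendsto.mono_left (nhdsWithin_le_nhds
    (s := {y | ∃ q : ℚ, 0 ≤ (q : ℝ) ∧ (q : ℝ) < t ∧ ∃ z ∈ D, φ q t z = y}))
  have h2 := (hcont (hH t ht.le) p).tendsto.mono_left (nhdsWithin_le_nhds
    (s := {y | ∃ q : ℚ, 0 ≤ (q : ℝ) ∧ (q : ℝ) < t ∧ ∃ z ∈ D, φ q t z = y}))
  have h3 := tendsto_nhds_unique_of_eventuallyEq h1 h2 (by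
    filter_upwards [self_mem_nhdsWithin] with y hy
    obtain ⟨q, hq0, hqt, z, hz, rfl⟩ := hy
    rw [hkey q z hz hq0 hqt.le])
  rwa [chartVec_self, chartVec_self] at h3

end IsEvolutionFamily

end EvolutionFamily

end Loewner

end

theorem theorem1p1 {E : Type*} [NormedAddCommGroup E] [NormedSpace ℂ E] [FiniteDimensional ℂ E]
    {M : Type*} [TopologicalSpace M] [T2Space M] [SecondCountableTopology M] [ConnectedSpace M]
    [ChartedSpace E M] [IsManifold 𝓘(ℂ, E) ω M]
    (h : Loewner.HermitianMetric E M)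
    (hM : Loewner.IsCompleteHyperbolic E M)
    (hk : Loewner.KobayashiDistC1 E M) :
    (∀ G : ∀ z : M, ℝ → TangentSpace 𝓘(ℂ, E) z, Loewner.IsHerglotzVectorField h G →
      ∃ φ : ℝ → ℝ → M → M,
        Loewner.IsEvolutionFamily h φ ∧ Loewner.IsGeneratedBy φ G ∧
        ∀ ψ : ℝ → ℝ → M → M, Loewner.IsEvolutionFamily h ψ → Loewner.IsGeneratedBy ψ G →
          ∀ s t : ℝ, 0 ≤ s → s ≤ t → ψ s t = φ s t) ∧
    (∀ φ : ℝ → ℝ → M → M, Loewner.IsEvolutionFamily h φ →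
      ∃ G : ∀ z : M, ℝ → TangentSpace 𝓘(ℂ, E) z,
        Loewner.IsHerglotzVectorField h G ∧ Loewner.IsGeneratedBy φ G ∧
        ∀ (d : ℝ≥0∞) (H : ∀ z : M, ℝ → TangentSpace 𝓘(ℂ, E) z), 1 ≤ d →
          Loewner.IsWeakHolomorphicVectorField h d H → Loewner.IsGeneratedBy φ H →
          ∀ᵐ t ∂(volume.restrict (Ici (0 : ℝ))), ∀ z : M, G z t = H z t) := by
  have : IsManifold 𝓘(ℂ, E) 1 M := IsManifold.of_le (n := ω) le_top
  -- The topology of this metric space is the given one by construction, so the manifold structure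
  -- and all hypotheses remain valid for it.
  let _ : MetricSpace M := Loewner.kobayashiMetricSpace E hM.eq_of_dist_eq_zero
  have : ProperSpace M := Loewner.properSpace_kobayashi hM
  have hd : ∀ z w : M, dist z w = Loewner.kobayashiDist E z w := fun _ _ => rfl
  refine ⟨fun G hG => Loewner.exists_isEvolutionFamily hd hk hG, fun φ hφ => ?_⟩
  have hweak := hφ.isWeakHolomorphicVectorField_velocity hd
  exact ⟨Loewner.velocity E φ, hφ.isHerglotzVectorField_velocity hd hk,
    hφ.isGeneratedBy_velocity hd, fun d H _ hH hφH => hφ.ae_eq_of_isGeneratedBy hd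
      hweak.holomorphic hH.holomorphic (hφ.isGeneratedBy_velocity hd) hφH⟩
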